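/- For $z,w\in\{0,1\}^n$ let $d_H(z,w)$ be the Hamming distance. For a set $S\subseteq\{0,1\}^n$ let $\mathrm{minPD}(S)$ be the minimum of $d_H(z,w)$ over distinct $z,w\in S$ (and $0$ if $S$ has at most one element). For a $k$-CNF formula $F$ on $n$ variables (every clause has at most $k$ literals) let $\Omega_F\subseteq\{0,1\}^n$ be its set of satisfying assignments and, for $1\le s\le|\Omega_F|$, let $\mathrm{Opt\text{-}min}(F,s)=\max\{\mathrm{minPD}(S): S\subseteq\Omega_F,\ |S|=s\}$. Let $H^{-1}:[0,1]\to[0,1/2]$ be the inverse of the restriction to $[0,1/2]$ of the binary entropy function $H(x)=-x\log_2 x-(1-x)\log_2(1-x)$. **Theorem.** Fix an integer $k\ge 3$. There is a randomized algorithm which takes as input a $k$-CNF formula $F$ on $n$ variables and an integer $s\ge 1$, always halts within time $O^*\!\left(s^3\cdot 2^{\,n-n/k}\right)$ (where $O^*$ hides a factor polynomial in $n$ and in the number of clauses of $F$), and which, whenever $|\Omega_F|\ge s$, outputs with probability at least $1-o(1)$ a set $S\subseteq\Omega_F$ of exactly $s$ satisfying assignments with $$\mathrm{minPD}(S)\ \ge\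 \frac12\left(1-\frac{1}{k\,H^{-1}(1-1/k)}\right)\cdot \mathrm{Opt\text{-}min}(F,s).$$ Here $o(1)$ denotes a quantity that, for fixed $k$, tends to $0$ as $n\to\infty$, uniformly in $F$ and $s$. -/

import Mathlib

open Filter Topology

namespace Dispersion

/-! ### CNF formulas and their solutions -/

/-- A literal over the variables `0, …, n - 1`: `(v, true)` is `x_v` and `(v, false)` is its
negation. -/
abbrev Literal (n : ℕ) := Fin n × Bool

/-- A CNF formula on `n` variables: a list of clauses, each clause a list of literals. -/
abbrev CNF (n : ℕ) := List (List (Literal n))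

/-- Every clause has at most `k` literals. -/
def IsKCNF {n : ℕ} (k : ℕ) (F : CNF n) : Prop := ∀ C ∈ F, C.length ≤ k

/-- The assignment `z` satisfies `F`: every clause contains a literal that is true under `z`. -/
def Satisfies {n : ℕ} (z : Fin n → Bool) (F : CNF n) : Prop :=
  ∀ C ∈ F, ∃ l ∈ C, z l.1 = l.2

open Classical in
/-- The set `Ω_F` of satisfying assignments. -/
noncomputable def solutions {n : ℕ} (F : CNF n) : Finset (Fin n → Bool) :=
  Finset.univ.filter fun z => Satisfies z F

/-- The minimum Hamming distance between two distinct elements of `S`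
(with the value `0` if there are no two distinct elements). -/
noncomputable def minPD {n : ℕ} (S : Finset (Fin n → Bool)) : ℕ :=
  sInf {d : ℕ | ∃ z ∈ S, ∃ w ∈ S, z ≠ w ∧ hammingDist z w = d}

/-- The maximum of `minPD S` over all sets `S` of exactly `s` satisfying assignments. -/
noncomputable def optMin {n : ℕ} (F : CNF n) (s : ℕ) : ℕ :=
  ((solutions F).powersetCard s).sup minPD

/-! ### The inverse of the binary entropy function -/

/-- The binary entropy `H(x) = -x log₂ x - (1 - x) log₂ (1 - x)`; Mathlib's `Real.binEntropy` uses
the natural logarithm. -/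
noncomputable def binH (x : ℝ) : ℝ := Real.binEntropy x / Real.log 2

/-- The inverse `H⁻¹ : [0, 1] → [0, 1/2]` of the restriction of `H` to `[0, 1/2]`. -/
noncomputable def binHInv (y : ℝ) : ℝ := Function.invFunOn binH (Set.Icc 0 (1 / 2)) y

/-- For `y ∈ [0, 1]`, `binHInv y` is the unique `x ∈ [0, 1/2]` with `H(x) = y`. -/
theorem binHInv_eq_iff {y : ℝ} (hy : y ∈ Set.Icc (0 : ℝ) 1) (x : ℝ) :
    binHInv y = x ↔ x ∈ Set.Icc (0 : ℝ) (1 / 2) ∧ binH x = y := by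
  have hl : (0 : ℝ) < Real.log 2 := Real.log_pos one_lt_two
  have hinj : Set.InjOn binH (Set.Icc 0 (1 / 2)) := by
    intro a ha b hb hab
    have h := Real.binEntropy_strictMonoOn.injOn
    rw [← one_div] at h
    exact h ha hb ((div_left_inj' hl.ne').1 hab)
  have hcont : ContinuousOn binH (Set.Icc 0 (1 / 2)) :=
    (Real.binEntropy_continuous.div_const _).continuousOn
  have h0 : binH 0 = 0 := by simp [binH]
  have h1 : binH (1 / 2) = 1 := by
    rw [one_div, binH, Real.binEntropy_two_inv, div_self hl.ne']
  have hex : ∃ a ∈ Set.Icc (0 : ℝ) (1 / 2), binH a = y := by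
    have := intermediate_value_Icc (by norm_num : (0 : ℝ) ≤ 1 / 2) hcont
    rw [h0, h1] at this
    exact this hy
  have hm := Function.invFunOn_mem hex
  have he := Function.invFunOn_eq hex
  constructor
  · rintro rfl
    exact ⟨hm, he⟩
  · rintro ⟨hx, hxy⟩
    exact hinj hm hx (he.trans hxy.symm)

/-! ### Randomized random-access programs with logarithmic cost

A program works on registers and on arrays of natural numbers of arbitrary size.  It may read and
write array cells at computed positions, draw uniformly random numbers, branch and loop.  Time is
charged by the logarithmic cost criterion: each operation costs one unit plus the bit lengths of
the numbers (operands, addresses and results) that it handles. -/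

/-- Memory of the machine, with a clock that programs cannot read. -/
structure State where
  /-- the registers -/
  reg : ℕ → ℕ
  /-- the arrays: `arr a i` is the content of cell `i` of array `a` -/
  arr : ℕ → ℕ → ℕ
  /-- the time used so far -/
  time : ℕ

/-- Arithmetic expressions; `sub` is truncated subtraction and `div` is division with rounding
down (`x / 0 = 0`). -/
inductive NExp where
  | const (v : ℕ)
  | reg (x : ℕ)
  | get (a : ℕ) (i : NExp)
  | add (e f : NExp)
  | sub (e f : NExp)
  | mul (e f : NExp)
  | div (e f : NExp)

/-- The value of an expression. -/
def NExp.val (σ : State) : NExp → ℕ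
  | const v => v
  | reg x => σ.reg x
  | get a i => σ.arr a (i.val σ)
  | add e f => e.val σ + f.val σ
  | sub e f => e.val σ - f.val σ
  | mul e f => e.val σ * f.val σ
  | div e f => e.val σ / f.val σ

/-- The cost of evaluating an expression: the sum, over all its subexpressions, of one plus the bit
length of the value of that subexpression. -/
def NExp.cost (σ : State) : NExp → ℕ
  | const v => 1 + v.size
  | reg x => 1 + (σ.reg x).size
  | get a i => i.cost σ + 1 + (σ.arr a (i.val σ)).size
  | add e f => e.cost σ + f.cost σ + 1 + (e.val σ + f.val σ).size
  | sub e f => e.cost σ + f.cost σ + 1 + (e.val σ - f.val σ).size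
  | mul e f => e.cost σ + f.cost σ + 1 + (e.val σ * f.val σ).size
  | div e f => e.cost σ + f.cost σ + 1 + (e.val σ / f.val σ).size

/-- Let `t` units of time pass. -/
def State.tick (σ : State) (t : ℕ) : State := { σ with time := σ.time + t }

/-- Write `v` into register `x`. -/
def State.setReg (σ : State) (x v : ℕ) : State := { σ with reg := Function.update σ.reg x v }

/-- Write `v` into cell `i` of array `a`. -/
def State.setArr (σ : State) (a i v : ℕ) : State :=
  { σ with arr := Function.update σ.arr a (Function.update (σ.arr a) i v) }

/-- Programs. -/
inductive Prog where
  /-- do nothing -/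
  | skip
  /-- `x := e` -/
  | assign (x : ℕ) (e : NExp)
  /-- `a[i] := e` -/
  | put (a : ℕ) (i e : NExp)
  /-- `x :=` a uniformly random element of `{0, …, e - 1}` (and `x := 0` if `e = 0`) -/
  | draw (x : ℕ) (e : NExp)
  /-- `p`, then `q` -/
  | seq (p q : Prog)
  /-- if `e ≠ 0` then `p` else `q` -/
  | ite (e : NExp) (p q : Prog)
  /-- while `e ≠ 0` do `p` -/
  | loop (e : NExp) (p : Prog)

/-- The uniform distribution on `{0, …, m - 1}`, and the point mass at `0` if `m = 0`. -/
noncomputable def unifBelow (m : ℕ) : PMF ℕ :=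
  if h : 0 < m then PMF.uniformOfFinset (Finset.range m) ⟨0, Finset.mem_range.2 h⟩ else PMF.pure 0

/-- `Exec p σ μ`: started in state `σ`, the program `p` halts for all outcomes of its random draws,
and `μ` is the distribution of its final state (including the time used). -/
inductive Exec : Prog → State → PMF State → Prop
  | skip (σ : State) : Exec .skip σ (PMF.pure (σ.tick 1))
  | assign (σ : State) (x : ℕ) (e : NExp) :
      Exec (.assign x e) σ (PMF.pure ((σ.setReg x (e.val σ)).tick (1 + e.cost σ)))
  | put (σ : State) (a : ℕ) (i e : NExp) :
      Exec (.put a i e) σ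
        (PMF.pure ((σ.setArr a (i.val σ) (e.val σ)).tick (1 + i.cost σ + e.cost σ)))
  | draw (σ : State) (x : ℕ) (e : NExp) :
      Exec (.draw x e) σ
        ((unifBelow (e.val σ)).map fun v => (σ.setReg x v).tick (1 + e.cost σ))
  | seq {σ : State} {p q : Prog} {μ : PMF State} {ν : State → PMF State} :
      Exec p σ μ → (∀ τ ∈ μ.support, Exec q τ (ν τ)) → Exec (.seq p q) σ (μ.bind ν)
  | ite_true {σ : State} {e : NExp} {p q : Prog} {μ : PMF State} :
      e.val σ ≠ 0 → Exec p (σ.tick (1 + e.cost σ)) μ → Exec (.ite e p q) σ μ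
  | ite_false {σ : State} {e : NExp} {p q : Prog} {μ : PMF State} :
      e.val σ = 0 → Exec q (σ.tick (1 + e.cost σ)) μ → Exec (.ite e p q) σ μ
  | loop_true {σ : State} {e : NExp} {p : Prog} {μ : PMF State} {ν : State → PMF State} :
      e.val σ ≠ 0 → Exec p (σ.tick (1 + e.cost σ)) μ →
      (∀ τ ∈ μ.support, Exec (.loop e p) τ (ν τ)) → Exec (.loop e p) σ (μ.bind ν)
  | loop_false {σ : State} {e : NExp} {p : Prog} :
      e.val σ = 0 → Exec (.loop e p) σ (PMF.pure (σ.tick (1 + e.cost σ)))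

/-- The final distribution is determined by the program and the initial state. -/
theorem Exec.unique {p : Prog} {σ : State} {μ μ' : PMF State} (h : Exec p σ μ)
    (h' : Exec p σ μ') : μ = μ' := by
  have key : ∀ (μ : PMF State) (ν ν' : State → PMF State),
      (∀ τ ∈ μ.support, ν τ = ν' τ) → μ.bind ν = μ.bind ν' := by
    intro μ ν ν' hν
    ext τ
    simp only [PMF.bind_apply]
    refine tsum_congr fun τ' => ?_
    by_cases hτ : μ τ' = 0
    · simp [hτ]
    · rw [hν τ' ((PMF.mem_support_iff _ _).2 hτ)]
  induction h generalizing μ' with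
  | skip | assign | put | draw => cases h'; rfl
  | seq _ _ ih₁ ih₂ =>
    cases h' with
    | seq h₁ h₂ =>
      obtain rfl := ih₁ h₁
      exact key _ _ _ fun τ hτ => ih₂ τ hτ (h₂ τ hτ)
  | ite_true he _ ih =>
    cases h' with
    | ite_true _ h => exact ih h
    | ite_false he' _ => exact absurd he' he
  | ite_false he _ ih =>
    cases h' with
    | ite_true he' _ => exact absurd he he'
    | ite_false _ h => exact ih h
  | loop_true he _ _ ih₁ ih₂ =>
    cases h' with
    | loop_true _ h₁ h₂ =>
      obtain rfl := ih₁ h₁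
      exact key _ _ _ fun τ hτ => ih₂ τ hτ (h₂ τ hτ)
    | loop_false he' => exact absurd he' he
  | loop_false he =>
    cases h' with
    | loop_true he' _ _ => exact absurd he he'
    | loop_false _ => rfl

/-! ### Input and output -/

/-- The code of an optional literal: `2 v + 2` for `x_v`, `2 v + 1` for its negation, `0` for an
absent literal. -/
def litCode {n : ℕ} : Option (Literal n) → ℕ
  | none => 0
  | some (v, true) => 2 * (v : ℕ) + 2
  | some (v, false) => 2 * (v : ℕ) + 1

/-- The initial state on input `(F, s)`.  Register `0` holds the number `n` of variables, register
`1` the number of clauses and register `2` the number `s`.  Array `0` holds the formula as a table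
with `k` columns: cell `k * j + i` (for `i < k`) holds the code of literal `i` of clause `j`.
Everything else is `0`. -/
def input {n : ℕ} (k : ℕ) (F : CNF n) (s : ℕ) : State where
  reg x := if x = 0 then n else if x = 1 then F.length else if x = 2 then s else 0
  arr a p := if a = 0 then litCode (F[p / k]?.bind fun C => C[p % k]?) else 0
  time := 0

/-- The assignment number `i` in the output, read from the cells `n * i, …, n * i + n - 1` of
array `1`. -/
def State.outAssignment (σ : State) (n i : ℕ) : Fin n → Bool :=
  fun v => decide (σ.arr 1 (n * i + v) = 1)

/-- The set consisting of the first `s` assignments in the output. -/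
def State.output (σ : State) (n s : ℕ) : Finset (Fin n → Bool) :=
  (Finset.range s).image (σ.outAssignment n)

/-- The output is a set of exactly `s` satisfying assignments of `F` whose minimum pairwise
distance is at least `ρ` times the optimum. -/
def ApproxOptMin {n : ℕ} (F : CNF n) (s : ℕ) (ρ : ℝ) (S : Finset (Fin n → Bool)) : Prop :=
  S ⊆ solutions F ∧ S.card = s ∧ ρ * (optMin F s : ℝ) ≤ (minPD S : ℝ)

end Dispersion

namespace Dispersion

/-! ### A program logic with time bounds and expectations -/

/-! The algorithm is greedy. Write `r` for the optimum and `H` for `binHInv (1 - 1/k)`. Given `c <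
s` solutions (rows), an optimal set has `s > c` points at mutual distance at least `r`, so by
pigeonhole and the triangle inequality one of them, `z`, is at distance at least `r/2` from every
row (`exists_far_solution`). A trial must find `z`, or a solution near it, with probability about
`2^(-(n - n/k))`.

If some row is at distance `D ≤ H n` from `z`, flipping the bits of that row at rate `D/n` hits `z`
itself with probability at least `2^(-n H(D/n))`, up to the guess of parameters, and `H(D/n) ≤ 1 -
1/k` (`reachable_ball`, `succProb_le_ball`).

Otherwise every row is farther than `H n` from `z`. A random walk that repairs falsified clauses,
started at a random point `y`, succeeds with probability at least `(1/k)^d(y,z)` by moving towards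
`z` only (`walk_wp`). The average of this over uniform `y` is `((1 + 1/k)/2)^n ≥ 2^(n/k - n)`.
Starts with `d(y,z) ≤ n/k` carry at least the fraction `1/(k+1)` of it, by Markov's inequality, and
walks moving towards `z` stay that close (`reachable_walk`). The solution found is at distance at
least `d(row,z) - n/k ≥ (1 - 1/(kH)) d(row,z)` from each row, which is the claimed ratio times `r`.

For small `k` the ratio can be negative, and then this says nothing about distinctness; hence the
`1` in `target`. Distinctness is forced separately: the start copies a row up to its first
disagreement with `z` and flips that position. For the row with the latest first disagreement, the
start agrees with `z` on a prefix in which every row differs from `z`, and moves towards `z` keep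
this (`exists_reachable`).

Each round repeats trials until its failure probability is at most `e^(-2n)`, and there are `s ≤ 2^n
≤ e^n` rounds (`failure_le`, `success_ge`). One factor `s` in the time comes from the rounds, one
from guessing the row, one from comparing a candidate with all rows (`algorithm_time`). -/

/-- The memory of the machine without its clock. -/
@[ext] structure Mem where
  reg : ℕ → ℕ
  arr : ℕ → ℕ → ℕ

/-- The memory part of a state. -/
def State.mem (σ : State) : Mem := ⟨σ.reg, σ.arr⟩

/-- The state with memory `m` and clock `t`. -/
def Mem.state (m : Mem) (t : ℕ) : State := ⟨m.reg, m.arr, t⟩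

/-- Write `v` into register `x`. -/
def Mem.setReg (m : Mem) (x v : ℕ) : Mem := { m with reg := Function.update m.reg x v }

/-- Write `v` into cell `i` of array `a`. -/
def Mem.setArr (m : Mem) (a i v : ℕ) : Mem :=
  { m with arr := Function.update m.arr a (Function.update (m.arr a) i v) }

/-- The value of an expression in a memory. -/
def Mem.eval (m : Mem) (e : NExp) : ℕ := e.val (m.state 0)

/-- The cost of an expression in a memory. -/
def Mem.cost (m : Mem) (e : NExp) : ℕ := e.cost (m.state 0)

/-- Expressions cannot see the clock, so all later reasoning takes place on memories. -/
theorem NExp.val_state (m : Mem) (t : ℕ) (e : NExp) : e.val (m.state t) = m.eval e := by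
  unfold Mem.eval
  induction e with
  | const | reg => rfl
  | get a i ih => simp only [NExp.val, ih]; rfl
  | add e f he hf | sub e f he hf | mul e f he hf | div e f he hf => simp only [NExp.val, he, hf]

theorem NExp.cost_state (m : Mem) (t : ℕ) (e : NExp) : e.cost (m.state t) = m.cost e := by
  unfold Mem.cost
  induction e with
  | const | reg => rfl
  | get a i ih => simp only [NExp.cost, ih, NExp.val_state]; rfl
  | add e f he hf | sub e f he hf | mul e f he hf | div e f he hf =>
    simp only [NExp.cost, he, hf, NExp.val_state]

section eval
variable (m : Mem)
@[simp] theorem Mem.eval_const (v : ℕ) : m.eval (.const v) = v := rfl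
@[simp] theorem Mem.eval_reg (x : ℕ) : m.eval (.reg x) = m.reg x := rfl
@[simp] theorem Mem.eval_get (a : ℕ) (i : NExp) : m.eval (.get a i) = m.arr a (m.eval i) := rfl
@[simp] theorem Mem.eval_add (e f : NExp) : m.eval (.add e f) = m.eval e + m.eval f := rfl
@[simp] theorem Mem.eval_sub (e f : NExp) : m.eval (.sub e f) = m.eval e - m.eval f := rfl
@[simp] theorem Mem.eval_mul (e f : NExp) : m.eval (.mul e f) = m.eval e * m.eval f := rfl
@[simp] theorem Mem.eval_div (e f : NExp) : m.eval (.div e f) = m.eval e / m.eval f := rfl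
@[simp] theorem Mem.setReg_reg (x v y : ℕ) :
    (m.setReg x v).reg y = if y = x then v else m.reg y := by
  simp [Mem.setReg, Function.update_apply]
@[simp] theorem Mem.setReg_arr (x v : ℕ) : (m.setReg x v).arr = m.arr := rfl
@[simp] theorem Mem.setArr_reg (a i v : ℕ) : (m.setArr a i v).reg = m.reg := rfl
theorem Mem.setArr_arr (a i v b j : ℕ) :
    (m.setArr a i v).arr b j = if b = a ∧ j = i then v else m.arr b j := by
  by_cases h : b = a
  · subst h; simp [Mem.setArr, Function.update_apply]
  · simp [Mem.setArr, h]
@[simp] theorem Mem.setArr_arr_ne (a i v b : ℕ) (h : b ≠ a) :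
    (m.setArr a i v).arr b = m.arr b := by
  simp [Mem.setArr, h]
@[simp] theorem State.mem_state (t : ℕ) : (m.state t).mem = m := rfl
@[simp] theorem State.time_state (t : ℕ) : (m.state t).time = t := rfl
end eval

/-- The expectation of `g` under `μ`. -/
noncomputable def expect (μ : PMF State) (g : State → ENNReal) : ENNReal := ∑' τ, μ τ * g τ

theorem expect_pure (σ : State) (g : State → ENNReal) : expect (PMF.pure σ) g = g σ := by
  unfold expect
  rw [tsum_eq_single σ]
  · simp
  · intro τ hτ; simp [PMF.pure_apply, hτ]

theorem expect_bind {α : Type} (μ : PMF α) (ν : α → PMF State) (g : State → ENNReal) :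
    expect (μ.bind ν) g = ∑' a, μ a * expect (ν a) g := by
  unfold expect
  simp only [PMF.bind_apply, ← ENNReal.tsum_mul_right, ← ENNReal.tsum_mul_left]
  rw [ENNReal.tsum_comm]
  simp only [mul_assoc]

theorem expect_mono (μ : PMF State) {g h : State → ENNReal} (H : ∀ τ ∈ μ.support, g τ ≤ h τ) :
    expect μ g ≤ expect μ h := by
  refine ENNReal.tsum_le_tsum fun τ => ?_
  by_cases hτ : μ τ = 0
  · simp [hτ]
  · gcongr; exact H τ ((PMF.mem_support_iff _ _).2 hτ)

theorem expect_const (μ : PMF State) (a : ENNReal) : expect μ (fun _ => a) = a := by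
  simp [expect, ENNReal.tsum_mul_right, μ.tsum_coe]

/-- Only an inequality, because negative summands are cut off at `0` on the right. Payoffs may be
negative, as for the potential of the filling. -/
theorem ofReal_sum_le {ι : Type*} (s : Finset ι) (g : ι → ℝ) :
    ENNReal.ofReal (∑ i ∈ s, g i) ≤ ∑ i ∈ s, ENNReal.ofReal (g i) := by
  classical
  induction s using Finset.induction_on with
  | empty => simp
  | insert a s ha ih =>
    rw [Finset.sum_insert ha, Finset.sum_insert ha]
    exact ENNReal.ofReal_add_le.trans (by gcongr)

theorem unifBelow_apply {N : ℕ} (hN : 0 < N) (x : ℕ) :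
    unifBelow N x = if x ∈ Finset.range N then (N : ENNReal)⁻¹ else 0 := by
  rw [unifBelow, dif_pos hN]
  refine (PMF.uniformOfFinset_apply _ x).trans ?_
  rw [Finset.card_range]
  split_ifs <;> rfl

/-- `Wp p t m R g v`: started in memory `m`, the program `p` halts within time `t` in a memory
satisfying `R`, and the expectation of `g` (cut off at `0`) in the final memory is at least `v`. -/
def Wp (p : Prog) (t : ℕ) (m : Mem) (R : Mem → Prop) (g : Mem → ℝ) (v : ℝ) : Prop :=
  ∀ t₀, ∃ μ : PMF State, Exec p (m.state t₀) μ ∧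
    (∀ τ ∈ μ.support, τ.time ≤ t₀ + t ∧ R τ.mem) ∧
    ENNReal.ofReal v ≤ expect μ fun τ => ENNReal.ofReal (g τ.mem)

section rules
variable {p q : Prog} {t t' : ℕ} {m : Mem} {R R' : Mem → Prop} {g g' : Mem → ℝ} {v v' : ℝ}

theorem Wp.mono (h : Wp p t m R g v) (ht : t ≤ t') (hR : ∀ m', R m' → R' m')
    (hg : ∀ m', R m' → g m' ≤ g' m') (hv : v' ≤ v) : Wp p t' m R' g' v' := by
  intro t₀
  obtain ⟨μ, h1, h2, h3⟩ := h t₀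
  refine ⟨μ, h1, fun τ hτ => ⟨(h2 τ hτ).1.trans (by omega), hR _ (h2 τ hτ).2⟩, ?_⟩
  exact (ENNReal.ofReal_le_ofReal hv).trans (h3.trans (expect_mono _ fun τ hτ =>
    ENNReal.ofReal_le_ofReal (hg _ (h2 τ hτ).2)))

theorem Wp.time_le (h : Wp p t m R g v) (ht : t ≤ t') : Wp p t' m R g v :=
  h.mono ht (fun _ => id) (fun _ _ => le_rfl) le_rfl

/-- Discards the payoff and keeps the postcondition. Subroutines whose effect is described by a
postcondition alone are therefore stated with the payoff `0 0`. -/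
theorem Wp.of_spec {g₀ : Mem → ℝ} {v₀ : ℝ} (h : Wp p t m R g₀ v₀) (hg : ∀ m', R m' → v ≤ g m') :
    Wp p t m R g v := by
  intro t₀
  obtain ⟨μ, h1, h2, -⟩ := h t₀
  refine ⟨μ, h1, h2, ?_⟩
  rw [← expect_const μ (ENNReal.ofReal v)]
  exact expect_mono _ fun τ hτ => ENNReal.ofReal_le_ofReal (hg _ (h2 τ hτ).2)

/-- Replace the payoff `g` by `a + b * g`. -/
theorem Wp.affine {a b : ℝ} (h : Wp p t m R g v) (ha : 0 ≤ a) (hb : 0 ≤ b) (hg : ∀ m', 0 ≤ g m')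
    (hv : 0 ≤ v) : Wp p t m R (fun m' => a + b * g m') (a + b * v) := by
  intro t₀
  obtain ⟨μ, h1, h2, h3⟩ := h t₀
  refine ⟨μ, h1, h2, ?_⟩
  have : (expect μ fun τ => ENNReal.ofReal (a + b * g τ.mem)) =
      ENNReal.ofReal a + ENNReal.ofReal b * expect μ fun τ => ENNReal.ofReal (g τ.mem) := by
    conv_rhs => rw [← expect_const μ (ENNReal.ofReal a)]
    unfold expect
    rw [← ENNReal.tsum_mul_left, ← ENNReal.tsum_add]
    refine tsum_congr fun τ => ?_
    beta_reduce
    rw [ENNReal.ofReal_add ha (mul_nonneg hb (hg _)), ENNReal.ofReal_mul hb]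
    ring
  rw [this, ENNReal.ofReal_add ha (mul_nonneg hb hv), ENNReal.ofReal_mul hb]
  gcongr

theorem Wp.skip (ht : 1 ≤ t) (hR : R m) (hv : v ≤ g m) : Wp .skip t m R g v := by
  intro t₀
  refine ⟨_, Exec.skip _, ?_, ?_⟩
  · intro τ hτ
    rw [PMF.support_pure, Set.mem_singleton_iff] at hτ
    subst hτ
    exact ⟨by simp [State.tick, Mem.state]; omega, hR⟩
  · rw [expect_pure]; exact ENNReal.ofReal_le_ofReal hv

theorem Wp.assign {x : ℕ} {e : NExp} (ht : 1 + m.cost e ≤ t) (hR : R (m.setReg x (m.eval e)))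
    (hv : v ≤ g (m.setReg x (m.eval e))) : Wp (.assign x e) t m R g v := by
  intro t₀
  refine ⟨_, Exec.assign _ _ _, ?_, ?_⟩
  · intro τ hτ
    rw [PMF.support_pure, Set.mem_singleton_iff, NExp.val_state, NExp.cost_state] at hτ
    subst hτ
    exact ⟨by simp only [State.tick, Mem.state, State.setReg]; omega, hR⟩
  · rw [expect_pure, NExp.val_state]; exact ENNReal.ofReal_le_ofReal hv

theorem Wp.put {a : ℕ} {i e : NExp} (ht : 1 + m.cost i + m.cost e ≤ t)
    (hR : R (m.setArr a (m.eval i) (m.eval e)))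
    (hv : v ≤ g (m.setArr a (m.eval i) (m.eval e))) : Wp (.put a i e) t m R g v := by
  intro t₀
  refine ⟨_, Exec.put _ _ _ _, ?_, ?_⟩
  · intro τ hτ
    rw [PMF.support_pure, Set.mem_singleton_iff] at hτ
    simp only [NExp.val_state, NExp.cost_state] at hτ
    subst hτ
    exact ⟨by simp only [State.tick, Mem.state, State.setArr]; omega, hR⟩
  · rw [expect_pure]; simp only [NExp.val_state]; exact ENNReal.ofReal_le_ofReal hv

theorem Wp.draw {x : ℕ} {e : NExp} {N : ℕ} (hN : m.eval e = N) (hpos : 0 < N)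
    (ht : 1 + m.cost e ≤ t)
    (hR : ∀ y < N, R (m.setReg x y))
    (hv : v ≤ (∑ y ∈ Finset.range N, g (m.setReg x y)) / N) : Wp (.draw x e) t m R g v := by
  intro t₀
  refine ⟨_, Exec.draw _ _ _, ?_, ?_⟩
  · intro τ hτ
    rw [NExp.val_state, NExp.cost_state, hN, PMF.support_map] at hτ
    obtain ⟨y, hy, rfl⟩ := hτ
    rw [PMF.mem_support_iff, unifBelow_apply hpos] at hy
    have hy' : y < N := by
      by_contra hc; simp [hc] at hy
    exact ⟨by simp only [State.tick, Mem.state, State.setReg]; omega, hR y hy'⟩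
  · rw [PMF.map, expect_bind, NExp.val_state, hN]
    simp only [Function.comp, expect_pure, unifBelow_apply hpos]
    rw [tsum_eq_sum (s := Finset.range N) (by intro b hb; simp only [hb, if_false, zero_mul])]
    have hN' : (0 : ℝ) < N := by exact_mod_cast hpos
    have h1 : ENNReal.ofReal v ≤
        ENNReal.ofReal (∑ y ∈ Finset.range N, (N : ℝ)⁻¹ * g (m.setReg x y)) := by
      refine ENNReal.ofReal_le_ofReal (hv.trans (le_of_eq ?_))
      rw [← Finset.mul_sum]; field_simp
    refine h1.trans ((ofReal_sum_le _ _).trans (le_of_eq (Finset.sum_congr rfl fun y hy => ?_)))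
    rw [if_pos hy, ENNReal.ofReal_mul (by positivity), ENNReal.ofReal_inv_of_pos hN',
      ENNReal.ofReal_natCast]
    rfl

/-- The law of total expectation: `f` bounds the conditional expectation of the final payoff from
below. -/
theorem Wp.seq {f : Mem → ℝ} (h₁ : Wp p t m R f v)
    (h₂ : ∀ m', R m' → Wp q t' m' R' g (f m')) : Wp (.seq p q) (t + t') m R' g v := by
  intro t₀
  obtain ⟨μ, hμ, hs, he⟩ := h₁ t₀
  have H : ∀ τ : State, ∃ ν : PMF State, τ ∈ μ.support → Exec q τ ν ∧
      (∀ τ' ∈ ν.support, τ'.time ≤ τ.time + t' ∧ R' τ'.mem) ∧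
      ENNReal.ofReal (f τ.mem) ≤ expect ν fun τ' => ENNReal.ofReal (g τ'.mem) := by
    intro τ
    by_cases hτ : τ ∈ μ.support
    · obtain ⟨ν, hν⟩ := h₂ τ.mem (hs τ hτ).2 τ.time
      exact ⟨ν, fun _ => hν⟩
    · exact ⟨PMF.pure τ, fun h => absurd h hτ⟩
  choose ν hν using H
  refine ⟨μ.bind ν, Exec.seq hμ fun τ hτ => (hν τ hτ).1, ?_, ?_⟩
  · intro τ' hτ'
    rw [PMF.mem_support_bind_iff] at hτ'
    obtain ⟨τ, hτ, hτ'⟩ := hτ'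
    obtain ⟨h1, h2⟩ := (hν τ hτ).2.1 τ' hτ'
    have := (hs τ hτ).1
    exact ⟨by omega, h2⟩
  · rw [expect_bind]
    exact he.trans (expect_mono (h := fun τ => expect (ν τ) _) μ fun τ hτ => (hν τ hτ).2.2)

theorem Wp.ite {e : NExp} (hc : 1 + m.cost e ≤ t) (h₁ : m.eval e ≠ 0 → Wp p t' m R g v)
    (h₂ : m.eval e = 0 → Wp q t' m R g v) : Wp (.ite e p q) (t + t') m R g v := by
  intro t₀
  have hs : (m.state t₀).tick (1 + m.cost e) = m.state (t₀ + (1 + m.cost e)) := rfl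
  by_cases he : m.eval e = 0
  · obtain ⟨μ, h1, h2, h3⟩ := h₂ he (t₀ + (1 + m.cost e))
    refine ⟨μ, Exec.ite_false (by rwa [NExp.val_state]) (by rwa [NExp.cost_state, hs]),
      fun τ hτ => ⟨(h2 τ hτ).1.trans (by omega), (h2 τ hτ).2⟩, h3⟩
  · obtain ⟨μ, h1, h2, h3⟩ := h₁ he (t₀ + (1 + m.cost e))
    refine ⟨μ, Exec.ite_true (by rwa [NExp.val_state]) (by rwa [NExp.cost_state, hs]),
      fun τ hτ => ⟨(h2 τ hτ).1.trans (by omega), (h2 τ hτ).2⟩, h3⟩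

theorem Wp.loop_false {e : NExp} (hc : 1 + m.cost e ≤ t) (he : m.eval e = 0) (hR : R m)
    (hv : v ≤ g m) : Wp (.loop e p) t m R g v := by
  intro t₀
  refine ⟨_, Exec.loop_false (by rwa [NExp.val_state]), ?_, ?_⟩
  · intro τ hτ
    rw [PMF.support_pure, Set.mem_singleton_iff, NExp.cost_state] at hτ
    subst hτ
    exact ⟨by simp only [State.tick, Mem.state]; omega, hR⟩
  · rw [expect_pure]; exact ENNReal.ofReal_le_ofReal hv

theorem Wp.loop_true {e : NExp} {f : Mem → ℝ} {t₁ : ℕ} (hc : 1 + m.cost e ≤ t₁)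
    (he : m.eval e ≠ 0) (h₁ : Wp p t m R f v)
    (h₂ : ∀ m', R m' → Wp (.loop e p) t' m' R' g (f m')) :
    Wp (.loop e p) (t₁ + t + t') m R' g v := by
  intro t₀
  obtain ⟨μ, hμ, hs, he'⟩ := h₁ (t₀ + (1 + m.cost e))
  have H : ∀ τ : State, ∃ ν : PMF State, τ ∈ μ.support → Exec (.loop e p) τ ν ∧
      (∀ τ' ∈ ν.support, τ'.time ≤ τ.time + t' ∧ R' τ'.mem) ∧
      ENNReal.ofReal (f τ.mem) ≤ expect ν fun τ' => ENNReal.ofReal (g τ'.mem) := by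
    intro τ
    by_cases hτ : τ ∈ μ.support
    · obtain ⟨ν, hν⟩ := h₂ τ.mem (hs τ hτ).2 τ.time
      exact ⟨ν, fun _ => hν⟩
    · exact ⟨PMF.pure τ, fun h => absurd h hτ⟩
  choose ν hν using H
  refine ⟨μ.bind ν, Exec.loop_true (by rwa [NExp.val_state])
    (by rw [NExp.cost_state]; exact hμ) fun τ hτ => (hν τ hτ).1, ?_, ?_⟩
  · intro τ' hτ'
    rw [PMF.mem_support_bind_iff] at hτ'
    obtain ⟨τ, hτ, hτ'⟩ := hτ'
    obtain ⟨h1, h2⟩ := (hν τ hτ).2.1 τ' hτ'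
    have := (hs τ hτ).1
    exact ⟨by omega, h2⟩
  · rw [expect_bind]
    exact he'.trans (expect_mono (h := fun τ => expect (ν τ) _) μ fun τ hτ => (hν τ hτ).2.2)

end rules

/-! ### Bounded memories and the cost of expressions -/

/-- All values in the memory have bit length at most `β`. -/
def Bd (β : ℕ) (m : Mem) : Prop := (∀ x, m.reg x < 2 ^ β) ∧ ∀ a i, m.arr a i < 2 ^ β

/-- The value of `e` has bit length at most `e.vw * β` in memories bounded by `β`. -/
def NExp.vw : NExp → ℕ
  | const v => v
  | reg _ => 1
  | get _ _ => 1
  | add e f => e.vw + f.vw + 1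
  | sub e _ => e.vw
  | mul e f => e.vw + f.vw
  | div e _ => e.vw

/-- The cost of `e` is at most `e.cw * β` in memories bounded by `β`. -/
def NExp.cw : NExp → ℕ
  | const v => v + 1
  | reg _ => 2
  | get _ i => i.cw + 2
  | add e f => e.cw + f.cw + 1 + (e.vw + f.vw + 1)
  | sub e f => e.cw + f.cw + 1 + e.vw
  | mul e f => e.cw + f.cw + 1 + (e.vw + f.vw)
  | div e f => e.cw + f.cw + 1 + e.vw

theorem Mem.eval_lt {β : ℕ} {m : Mem} (hm : Bd β m) (hβ : 1 ≤ β) (e : NExp) :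
    m.eval e < 2 ^ (β * e.vw) := by
  induction e with
  | const v =>
    exact (Nat.lt_two_pow_self (n := v)).trans_le
      (Nat.pow_le_pow_right (by norm_num) (Nat.le_mul_of_pos_left v hβ))
  | reg x => simpa [NExp.vw] using hm.1 x
  | get a i ih => simpa [NExp.vw] using hm.2 a _
  | add e f he hf =>
    simp only [Mem.eval_add, NExp.vw]
    have h1 : 2 ^ (β * e.vw) ≤ 2 ^ (β * (e.vw + f.vw)) :=
      Nat.pow_le_pow_right (by norm_num) (Nat.mul_le_mul_left _ (by omega))
    have h2 : 2 ^ (β * f.vw) ≤ 2 ^ (β * (e.vw + f.vw)) :=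
      Nat.pow_le_pow_right (by norm_num) (Nat.mul_le_mul_left _ (by omega))
    have h3 : 2 * 2 ^ (β * (e.vw + f.vw)) ≤ 2 ^ (β * (e.vw + f.vw + 1)) := by
      rw [← pow_succ']
      exact Nat.pow_le_pow_right (by norm_num) (by rw [mul_add β _ 1]; omega)
    omega
  | sub e f he hf => exact (Nat.sub_le _ _).trans_lt he
  | mul e f he hf =>
    simp only [Mem.eval_mul, NExp.vw, mul_add, pow_add]
    exact Nat.mul_lt_mul'' he hf
  | div e f he hf => exact (Nat.div_le_self _ _).trans_lt he

/-- Bit lengths at most add up under every operation, with one more bit for sums. So costs are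
bounded by `β` times a syntactic constant, which `decide` can compare with `200`. -/
theorem Mem.cost_le {β : ℕ} {m : Mem} (hm : Bd β m) (hβ : 1 ≤ β) (e : NExp) :
    m.cost e ≤ β * e.cw := by
  have size : ∀ e : NExp, (m.eval e).size ≤ β * e.vw := fun e =>
    Nat.size_le.2 (m.eval_lt hm hβ e)
  induction e with
  | const v =>
    have := size (.const v)
    simp only [Mem.eval_const, NExp.vw] at this
    simp only [Mem.cost, NExp.cost, NExp.cw, mul_add]
    omega
  | reg x =>
    have := size (.reg x)
    simp only [Mem.eval_reg, NExp.vw] at this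
    simp only [Mem.cost, NExp.cost, NExp.cw, Mem.state]
    omega
  | get a i ih =>
    have := size (.get a i)
    simp only [Mem.eval_get, NExp.vw] at this
    simp only [Mem.cost, NExp.cost, NExp.cw, mul_add] at ih ⊢
    change _ + 1 + (m.arr a (m.eval i)).size ≤ _
    omega
  | add e f he hf =>
    have := size (.add e f)
    simp only [NExp.vw] at this
    simp only [Mem.cost, NExp.cost, NExp.cw] at he hf ⊢
    change _ + _ + 1 + (m.eval (.add e f)).size ≤ _
    rw [mul_add β (_ + _ + 1), mul_add β (_ + _) 1, mul_add β _ f.cw]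
    omega
  | sub e f he hf =>
    have := size (.sub e f)
    simp only [NExp.vw] at this
    simp only [Mem.cost, NExp.cost, NExp.cw] at he hf ⊢
    change _ + _ + 1 + (m.eval (.sub e f)).size ≤ _
    rw [mul_add β (_ + _ + 1), mul_add β (_ + _) 1, mul_add β _ f.cw]
    omega
  | mul e f he hf =>
    have := size (.mul e f)
    simp only [NExp.vw] at this
    simp only [Mem.cost, NExp.cost, NExp.cw] at he hf ⊢
    change _ + _ + 1 + (m.eval (.mul e f)).size ≤ _
    rw [mul_add β (_ + _ + 1), mul_add β (_ + _) 1, mul_add β _ f.cw]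
    omega
  | div e f he hf =>
    have := size (.div e f)
    simp only [NExp.vw] at this
    simp only [Mem.cost, NExp.cost, NExp.cw] at he hf ⊢
    change _ + _ + 1 + (m.eval (.div e f)).size ≤ _
    rw [mul_add β (_ + _ + 1), mul_add β (_ + _) 1, mul_add β _ f.cw]
    omega

/-- A bound for the cost of every single instruction used below, in memories bounded by `β`. -/
def opCost (β : ℕ) : ℕ := β * 200

theorem Mem.cost_lt {β : ℕ} {m : Mem} (hm : Bd β m) (hβ : 1 ≤ β) (e : NExp)
    (he : e.cw + 1 ≤ 200) : 1 + m.cost e ≤ opCost β := by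
  have h1 := m.cost_le hm hβ e
  have h2 := Nat.mul_le_mul_left β he
  rw [mul_add] at h2
  unfold opCost
  omega

theorem Mem.cost_lt₂ {β : ℕ} {m : Mem} (hm : Bd β m) (hβ : 1 ≤ β) (e f : NExp)
    (he : e.cw + f.cw + 1 ≤ 200) : 1 + m.cost e + m.cost f ≤ opCost β := by
  have h1 := m.cost_le hm hβ e
  have h3 := m.cost_le hm hβ f
  have h2 := Nat.mul_le_mul_left β he
  rw [mul_add, mul_add] at h2
  unfold opCost
  omega

theorem Bd.setReg {β : ℕ} {m : Mem} (hm : Bd β m) {x v : ℕ} (hv : v < 2 ^ β) :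
    Bd β (m.setReg x v) := by
  refine ⟨fun y => ?_, hm.2⟩
  rw [Mem.setReg_reg]
  split_ifs
  · exact hv
  · exact hm.1 y

theorem Bd.setArr {β : ℕ} {m : Mem} (hm : Bd β m) {a i v : ℕ} (hv : v < 2 ^ β) :
    Bd β (m.setArr a i v) := by
  refine ⟨hm.1, fun b j => ?_⟩
  rw [Mem.setArr_arr]
  split_ifs
  · exact hv
  · exact hm.2 b j

/-- `for x := 0, …, e - 1 do p`, for an expression `e` whose value does not change. -/
def forN (x : ℕ) (e : NExp) (p : Prog) : Prog :=
  .seq (.assign x (.const 0))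
    (.loop (.sub e (.reg x)) (.seq p (.assign x (.add (.reg x) (.const 1)))))

/-- `f i` plays the role of a submartingale at the start of iteration `i`. Every iteration pays for
a test and an increment, and the whole loop for the initial assignment and the last test. -/
theorem Wp.forN {β x : ℕ} {e : NExp} {p : Prog} {N t : ℕ} {m : Mem} {v : ℝ}
    (Inv : ℕ → Mem → Prop) (f : ℕ → Mem → ℝ) (hβ : 1 ≤ β) (hm : Bd β m) (hcw : e.cw ≤ 100)
    (hvw : e.vw ≤ 50)
    (hI : ∀ i ≤ N, ∀ m', Inv i m' → Bd β m' ∧ m'.eval e = N ∧ m'.reg x = i)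
    (h0 : Inv 0 (m.setReg x 0)) (hv : v ≤ f 0 (m.setReg x 0))
    (hb : ∀ i < N, ∀ m', Inv i m' → Wp p t m'
      (fun m'' => m''.reg x = i ∧ Bd β m'' ∧ Inv (i + 1) (m''.setReg x (i + 1)))
      (fun m'' => f (i + 1) (m''.setReg x (i + 1))) (f i m')) :
    Wp (forN x e p) (N * (t + 2 * opCost β) + 2 * opCost β) m (Inv N) (f N) v := by
  have key : ∀ d i, i + d = N → ∀ m', Inv i m' →
      Wp (.loop (.sub e (.reg x)) (.seq p (.assign x (.add (.reg x) (.const 1)))))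
        (d * (t + 2 * opCost β) + opCost β) m' (Inv N) (f N) (f i m') := by
    intro d
    induction d with
    | zero =>
      intro i hi m' hm'
      obtain rfl : i = N := by omega
      obtain ⟨h1, h2, h3⟩ := hI i le_rfl m' hm'
      refine (Wp.loop_false (m'.cost_lt h1 hβ _ ?_) ?_ hm' le_rfl).time_le (by omega)
      · simp only [NExp.cw]; omega
      · simp [h2, h3]
    | succ d ih =>
      intro i hi m' hm'
      obtain ⟨h1, h2, h3⟩ := hI i (by omega) m' hm'
      refine (Wp.loop_true (m'.cost_lt h1 hβ _ ?_) ?_ (Wp.seq (hb i (by omega) m' hm')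
        (fun m'' hm'' => Wp.assign (R := Inv (i + 1)) (g := f (i + 1))
          (m''.cost_lt hm''.2.1 hβ _ ?_) ?_ ?_))
        (fun m'' hm'' => ih (i + 1) (by omega) m'' hm'')).time_le ?_
      · simp only [NExp.cw]; omega
      · simp only [Mem.eval_sub, Mem.eval_reg, h2, h3]; omega
      · simp [NExp.cw, NExp.vw]
      · simpa [hm''.1] using hm''.2.2
      · simp [hm''.1]
      · rw [Nat.succ_mul d]; omega
  refine (Wp.seq (Wp.assign (R := fun m' => Inv 0 m') (g := f 0) (m.cost_lt hm hβ _ ?_) h0 hv)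
    (fun m' hm' => key N 0 (by omega) m' hm')).time_le (by omega)
  simp [NExp.cw]

section rules'
variable {β : ℕ} {p q : Prog} {t t' : ℕ} {m : Mem} {R R' : Mem → Prop} {g : Mem → ℝ} {v : ℝ}

theorem Wp.spec_seq {g₀ : Mem → ℝ} {v₀ : ℝ} (h₁ : Wp p t m R g₀ v₀)
    (h₂ : ∀ m', R m' → Wp q t' m' R' g v) : Wp (.seq p q) (t + t') m R' g v :=
  Wp.seq (f := fun _ => v) (h₁.of_spec fun _ _ => le_rfl) h₂

theorem Wp.assign_op (hm : Bd β m) (hβ : 1 ≤ β) {x : ℕ} {e : NExp} (hcw : e.cw + 1 ≤ 200)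
    (hR : R (m.setReg x (m.eval e))) (hv : v ≤ g (m.setReg x (m.eval e))) :
    Wp (.assign x e) (opCost β) m R g v :=
  Wp.assign (m.cost_lt hm hβ e hcw) hR hv

theorem Wp.assign_seq (hm : Bd β m) (hβ : 1 ≤ β) {x : ℕ} {e : NExp} (hcw : e.cw + 1 ≤ 200)
    (h : Wp q t (m.setReg x (m.eval e)) R g v) :
    Wp (.seq (.assign x e) q) (opCost β + t) m R g v :=
  Wp.spec_seq (R := fun m' => m' = m.setReg x (m.eval e)) (g₀ := 0) (v₀ := 0)
    (Wp.assign_op hm hβ hcw rfl le_rfl) (by rintro _ rfl; exact h)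

theorem Wp.draw_seq (hm : Bd β m) (hβ : 1 ≤ β) {x : ℕ} {e : NExp} (hcw : e.cw + 1 ≤ 200) {N : ℕ}
    (hN : m.eval e = N) (hpos : 0 < N) (f : ℕ → ℝ)
    (h : ∀ y < N, Wp q t (m.setReg x y) R g (f y)) (hv : v ≤ (∑ y ∈ Finset.range N, f y) / N) :
    Wp (.seq (.draw x e) q) (opCost β + t) m R g v :=
  Wp.seq (R := fun m' => ∃ y < N, m' = m.setReg x y) (f := fun m' => f (m'.reg x))
    (Wp.draw hN hpos (m.cost_lt hm hβ e hcw) (fun y hy => ⟨y, hy, rfl⟩) (by simpa using hv))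
    (by rintro _ ⟨y, hy, rfl⟩; simpa using h y hy)

/-- A draw of which one outcome is used. -/
theorem Wp.draw_single_seq (hm : Bd β m) (hβ : 1 ≤ β) {x : ℕ} {e : NExp} (hcw : e.cw + 1 ≤ 200)
    {N : ℕ} (hN : m.eval e = N) {y₀ : ℕ} (hy₀ : y₀ < N) {w : ℝ}
    (h : ∀ y < N, Wp q t (m.setReg x y) R g (if y = y₀ then w else 0)) (hv : v ≤ w / N) :
    Wp (.seq (.draw x e) q) (opCost β + t) m R g v :=
  Wp.draw_seq hm hβ hcw hN (by omega) _ h (by simpa [hy₀] using hv)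

end rules'

/-! ### The program -/

section program
open NExp Prog

/-- The index of the variable of the literal whose code is in register `r`. -/
def varE (r : ℕ) : NExp := div (sub (reg r) (const 1)) (const 2)

/-- The sign of the literal whose code is in register `r`. -/
def signE (r : ℕ) : NExp := sub (sub (reg r) (const 1)) (mul (const 2) (varE r))

/-- `1` if `e ≠ 0` and `0` otherwise. -/
def posE (e : NExp) : NExp := sub (const 1) (sub (const 1) e)

/-- `|e - f|`. -/
def distE (e f : NExp) : NExp := add (sub e f) (sub f e)

/-- Register `12` becomes `0` if the assignment in array `2` satisfies the formula, and otherwise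
`j + 1` for some falsified clause `j`. -/
def findUnsat : Prog :=
  .seq (assign 12 (const 0)) <|
  forN 13 (reg 1) <|
  .seq (assign 15 (const 0)) <|
  .seq (forN 14 (reg 3) <|
    .seq (assign 16 (get 0 (add (mul (reg 3) (reg 13)) (reg 14))))
      (assign 15 (add (reg 15)
        (mul (posE (reg 16)) (sub (const 1) (distE (get 2 (varE 16)) (signE 16))))))) <|
  ite (reg 15) skip (assign 12 (add (reg 13) (const 1)))

/-- One step of the random walk on assignments: satisfy a random literal of a falsified clause. -/
def walkStep : Prog :=
  .seq findUnsat <|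
  .seq (draw 13 (reg 3)) <|
  .seq (assign 14 (get 0 (add (mul (reg 3) (sub (reg 12) (const 1))) (reg 13)))) <|
  -- The product vanishes if the formula is already satisfied, or if the drawn column lies beyond
  -- the end of the clause (code `0`). In both cases the assignment stays as it is.
  ite (mul (reg 12) (reg 14)) (put 2 (varE 14) (signE 14)) skip

/-- Fill array `2` with a random perturbation of row `reg 8` of array `1`. -/
def fill : Prog :=
  forN 11 (reg 0) <|
  .seq (draw 12 (mul (const 2) (reg 0))) <|
  -- `distE` of two bits is their exclusive or. The second bit is `0` before position `reg 9`, is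
  -- `1` at it, and after it is `1` iff the draw from `2 n` outcomes is below `reg 10`, so the flip
  -- rate is `reg 10 / (2 n)`.
  put 2 (reg 11) (distE (get 1 (add (mul (reg 0) (reg 8)) (reg 11)))
    (add (sub (const 1) (distE (reg 11) (reg 9)))
      (mul (posE (sub (reg 11) (reg 9))) (posE (sub (reg 10) (reg 12))))))

/-- Register `11` becomes the minimum of `n + 1` and the distances of the assignment in array `2`
from the rows `0, …, reg 5 - 1` of array `1`. -/
def minDist : Prog :=
  .seq (assign 11 (add (reg 0) (const 1))) <|
  forN 12 (reg 5) <|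
  .seq (assign 14 (const 0)) <|
  .seq (forN 13 (reg 0) <|
    assign 14 (add (reg 14)
      (distE (get 2 (reg 13)) (get 1 (add (mul (reg 0) (reg 12)) (reg 13)))))) <|
  -- With truncated subtraction, `a - (a - b)` is the minimum of `a` and `b`.
  assign 11 (sub (reg 11) (sub (reg 11) (reg 14)))

/-- Copy the assignment in array `2` to row `reg 5` of array `1` if it is a solution and better
than the present one. -/
def accept : Prog :=
  ite (reg 12) skip <|
  ite (sub (reg 11) (reg 7))
    (.seq (assign 7 (reg 11)) <|
      forN 13 (reg 0) <| put 1 (add (mul (reg 0) (reg 5)) (reg 13)) (get 2 (reg 13)))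
    skip

/-- One attempt at finding a new solution. -/
def trial : Prog :=
  -- One index more than there are finished rows, so that the range is nonempty in the first round.
  .seq (draw 8 (add (reg 5) (const 1))) <|
  .seq (draw 9 (add (reg 0) (const 1))) <|
  .seq (draw 10 (add (reg 0) (const 1))) <|
  .seq fill <|
  .seq (forN 11 (reg 0) walkStep) <|
  .seq minDist <|
  .seq findUnsat accept

/-- Find a new solution, far away from the previous ones. -/
def round : Prog := .seq (assign 7 (const 0)) (forN 6 (reg 4) trial)

/-- Register `4` becomes `2 ^ e`. -/
def pow2 (e : NExp) : Prog :=
  .seq (assign 4 (const 1)) (forN 5 e (assign 4 (add (reg 4) (reg 4))))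

/-- The approximation algorithm. -/
def algorithm (k : ℕ) : Prog :=
  .seq (assign 3 (const k)) <|
  .seq (pow2 (reg 0)) <|
  -- If `s > 2 ^ n` there cannot be `s` solutions. Stopping here keeps the bit lengths of all later
  -- numbers linear in `inSize k F`.
  ite (sub (reg 2) (reg 4)) skip <|
  .seq (pow2 (sub (reg 0) (div (reg 0) (reg 3)))) <|
  .seq (assign 4 (mul (mul (mul (const 2) (add (reg 3) (const 1)))
    (mul (reg 2) (mul (add (reg 0) (const 1)) (mul (add (reg 0) (const 1))
      (add (reg 0) (const 1)))))) (reg 4))) <|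
  forN 5 (reg 2) round

end program

/-! ### Memory invariants and frame conditions -/

/-- The assignment stored in array `2`. -/
def Mem.asg (m : Mem) (n : ℕ) : Fin n → Bool := fun v => decide (m.arr 2 v = 1)

/-- The assignment stored in row `i` of array `1`. -/
def Mem.row (m : Mem) (n i : ℕ) : Fin n → Bool := fun v => decide (m.arr 1 (n * i + v) = 1)

/-- The memory holds the input, Boolean values in the arrays `1` and `2`, and small numbers. -/
structure Inv {n : ℕ} (k : ℕ) (F : CNF n) (s β : ℕ) (m : Mem) : Prop where
  r0 : m.reg 0 = n
  r1 : m.reg 1 = F.length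
  r2 : m.reg 2 = s
  r3 : m.reg 3 = k
  a0 : ∀ p, m.arr 0 p = litCode (F[p / k]?.bind fun C => C[p % k]?)
  b1 : ∀ p, m.arr 1 p ≤ 1
  b2 : ∀ p, m.arr 2 p ≤ 1
  bd : Bd β m

theorem Inv.setReg {n k s β : ℕ} {F : CNF n} {m : Mem} (h : Inv k F s β m) {x v : ℕ} (hx : 4 ≤ x)
    (hv : v < 2 ^ β) : Inv k F s β (m.setReg x v) := by
  obtain ⟨h0, h1, h2, h3, h4, h5, h6, h7⟩ := h
  refine ⟨?_, ?_, ?_, ?_, h4, h5, h6, h7.setReg hv⟩ <;> rw [Mem.setReg_reg, if_neg (by omega)] <;>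
    assumption

theorem Inv.setArr {n k s β : ℕ} {F : CNF n} {m : Mem} (h : Inv k F s β m) {a i v : ℕ}
    (ha : 1 ≤ a) (hv : v ≤ 1) (hβ : 1 ≤ β) : Inv k F s β (m.setArr a i v) := by
  obtain ⟨h0, h1, h2, h3, h4, h5, h6, h7⟩ := h
  refine ⟨h0, h1, h2, h3, ?_, ?_, ?_, h7.setArr ?_⟩
  · intro p; rw [Mem.setArr_arr, if_neg (by omega), h4]
  · intro p; rw [Mem.setArr_arr]; split_ifs; exacts [hv, h5 p]
  · intro p; rw [Mem.setArr_arr]; split_ifs; exacts [hv, h6 p]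
  · exact hv.trans_lt (Nat.one_lt_two_pow (by omega))

/-- Nothing but the registers from `b` on has changed. -/
def Same (b : ℕ) (m m' : Mem) : Prop := (∀ x < b, m'.reg x = m.reg x) ∧ m'.arr = m.arr

theorem Same.refl (b : ℕ) (m : Mem) : Same b m m := ⟨fun _ _ => rfl, rfl⟩

theorem Same.trans {b : ℕ} {m m' m'' : Mem} (h : Same b m m') (h' : Same b m' m'') :
    Same b m m'' := ⟨fun x hx => (h'.1 x hx).trans (h.1 x hx), h'.2.trans h.2⟩

theorem Same.mono {a b : ℕ} {m m' : Mem} (h : Same b m m') (hab : a ≤ b) : Same a m m' :=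
  ⟨fun x hx => h.1 x (by omega), h.2⟩

theorem Same.setReg {b : ℕ} {m m' : Mem} (h : Same b m m') {x v : ℕ} (hx : b ≤ x) :
    Same b m (m'.setReg x v) :=
  ⟨fun y hy => by rw [Mem.setReg_reg, if_neg (by omega)]; exact h.1 y hy, h.2⟩

theorem Same.asg {b n : ℕ} {m m' : Mem} (h : Same b m m') : m'.asg n = m.asg n := by
  unfold Mem.asg; rw [h.2]

theorem Same.row {b n i : ℕ} {m m' : Mem} (h : Same b m m') : m'.row n i = m.row n i := by
  unfold Mem.row; rw [h.2]

/-! ### Searching for a falsified clause -/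

theorem litCode_le {n : ℕ} (o : Option (Literal n)) : litCode o ≤ 2 * n := by
  rcases o with _ | ⟨v, _ | _⟩ <;> simp only [litCode] <;> omega

theorem litCode_var {n : ℕ} (v : Fin n) (b : Bool) : (litCode (some (v, b)) - 1) / 2 = v := by
  cases b <;> simp only [litCode] <;> omega

theorem litCode_sign {n : ℕ} (v : Fin n) (b : Bool) :
    litCode (some (v, b)) - 1 - 2 * v = b.toNat := by
  cases b <;> simp only [litCode, Bool.toNat] <;> simp

theorem litCode_pos {n : ℕ} (v : Fin n) (b : Bool) : 1 ≤ litCode (some (v, b)) := by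
  cases b <;> simp only [litCode] <;> omega

/-- The displayed number is what the program adds to its count of true literals. The factor `1 - (1
- q)` removes absent literals, and the other one tests equality of value and sign. -/
theorem eval_literal {n : ℕ} (o : Option (Literal n)) (a : ℕ → ℕ) (ha : ∀ p, a p ≤ 1) {q : ℕ}
    (hq : q = litCode o) :
    (1 - (1 - q)) * (1 - ((a ((q - 1) / 2) - (q - 1 - 2 * ((q - 1) / 2))) +
      (q - 1 - 2 * ((q - 1) / 2) - a ((q - 1) / 2)))) ≤ 1 ∧
    ((1 - (1 - q)) * (1 - ((a ((q - 1) / 2) - (q - 1 - 2 * ((q - 1) / 2))) +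
      (q - 1 - 2 * ((q - 1) / 2) - a ((q - 1) / 2)))) = 0 ↔
      ∀ l, o = some l → decide (a l.1 = 1) ≠ l.2) := by
  subst hq
  rcases o with _ | ⟨v, b⟩
  · simp [litCode]
  · have hp := litCode_pos v b
    have h := ha v
    rw [litCode_var, litCode_sign]
    rw [show 1 - (1 - litCode (some (v, b))) = 1 by omega]
    have : a v = 0 ∨ a v = 1 := by omega
    cases b <;> rcases this with h | h <;> simp [h]

theorem clause_index {n k : ℕ} (F : CNF n) {j i : ℕ} (hi : i < k) :
    (F[(k * j + i) / k]?.bind fun C => C[(k * j + i) % k]?) = F[j]?.bind fun C => C[i]? := by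
  rw [Nat.mul_add_div (by omega), Nat.mul_add_mod, Nat.mod_eq_of_lt hi, Nat.div_eq_of_lt hi,
    add_zero]

section
variable {n k s β : ℕ} {F : CNF n} {m : Mem}

/-- All small numbers fit into `β` bits. -/
def Fits (n k s β : ℕ) (F : CNF n) : Prop := 2 * n + F.length + s + k + 10 < 2 ^ β

theorem Fits.pos (h : Fits n k s β F) : 1 ≤ β := by
  rcases β with _ | β
  · simp [Fits] at h
  · omega

theorem findUnsat_wp (hF : IsKCNF k F) (hβ : Fits n k s β F) (hI : Inv k F s β m) :
    Wp findUnsat (opCost β + (F.length * ((opCost β + ((k * (opCost β + opCost β + 2 * opCost β) +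
        2 * opCost β) + (opCost β + opCost β))) + 2 * opCost β) + 2 * opCost β)) m
      (fun m' => Inv k F s β m' ∧ Same 12 m m' ∧
        ((m'.reg 12 = 0 ∧ Satisfies (m.asg n) F) ∨ (m'.reg 12 ≠ 0 ∧ ∃ C,
          F[m'.reg 12 - 1]? = some C ∧ ∀ l ∈ C, m.asg n l.1 ≠ l.2))) 0 0 := by
  have hβ1 := hβ.pos
  unfold Fits at hβ
  refine Wp.assign_seq hI.bd hβ1 (by decide) ?_
  refine Wp.mono (Wp.forN (N := F.length) (fun j m' => Inv k F s β m' ∧ Same 12 m m' ∧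
    m'.reg 13 = j ∧
    ((m'.reg 12 = 0 ∧ ∀ j' < j, ∀ C, F[j']? = some C → ∃ l ∈ C, m.asg n l.1 = l.2) ∨
      (m'.reg 12 ≠ 0 ∧ ∃ C, F[m'.reg 12 - 1]? = some C ∧ ∀ l ∈ C, m.asg n l.1 ≠ l.2)))
    (fun _ => 0) hβ1 (hI.setReg (by omega) (by simp)).bd (by decide) (by decide)
    ?_ ?_ (le_refl 0) ?_) le_rfl ?_ (fun _ _ => le_rfl) le_rfl
  · rintro i hi m' ⟨h1, h2, h3, -⟩
    exact ⟨h1.bd, h1.r1, h3⟩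
  · refine ⟨(hI.setReg (by omega) (by simp)).setReg (by omega) (by simp),
      ((Same.refl _ _).setReg (by omega)).setReg (by omega), by simp, Or.inl ⟨by simp, by simp⟩⟩
  · rintro j hj m' ⟨h1, h2, h3, h4⟩
    refine Wp.assign_seq h1.bd hβ1 (by decide) ?_
    have h1' := h1.setReg (x := 15) (v := 0) (by omega) (by simp)
    refine Wp.spec_seq (Wp.forN (N := k) (fun i m'' => Inv k F s β m'' ∧ Same 14 m' m'' ∧
      m''.reg 14 = i ∧ m''.reg 15 ≤ i ∧ (m''.reg 15 = 0 ↔ ∀ i' < i, ∀ l,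
        F[j][i']? = some l → m.asg n l.1 ≠ l.2))
      (fun _ => 0) hβ1 h1'.bd (by decide) (by decide) ?_ ?_ (le_refl 0) ?_) ?_
    · rintro i hi m'' ⟨g1, g2, g3, -⟩
      exact ⟨g1.bd, g1.r3, g3⟩
    · refine ⟨h1'.setReg (by omega) (by simp),
        ((Same.refl _ _).setReg (by omega)).setReg (by omega), by simp, by simp, by simp⟩
    · rintro i hi m'' ⟨g1, g2, g3, g4, g5⟩
      have hq : m''.arr 0 (k * j + i) = litCode (F[j][i]?) := by
        rw [g1.a0, clause_index F hi, List.getElem?_eq_getElem hj]; rfl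
      have hql : litCode (F[j][i]?) < 2 ^ β := (litCode_le _).trans_lt (by omega)
      have e13 : m''.reg 13 = j := (g2.1 13 (by omega)).trans h3
      have hasg : m''.asg n = m.asg n := g2.asg.trans h2.asg
      obtain ⟨hl1, hl2⟩ := eval_literal (F[j][i]?) (m''.arr 2) g1.b2 rfl
      refine Wp.assign_seq g1.bd hβ1 (by decide) ?_
      have g1' := g1.setReg (x := 16) (v := litCode (F[j][i]?)) (by omega) hql
      simp only [Mem.eval_get, Mem.eval_add, Mem.eval_mul, Mem.eval_reg, g1.r3, e13, g3, hq]
      refine Wp.assign_op g1'.bd hβ1 (by decide) ?_ le_rfl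
      simp only [posE, distE, varE, signE, Mem.eval_get, Mem.eval_add, Mem.eval_mul, Mem.eval_reg,
        Mem.eval_sub, Mem.eval_div, Mem.eval_const, Mem.setReg_reg, Mem.setReg_arr]
      norm_num only [if_true, if_false]
      set T := (1 - (1 - litCode (F[j][i]?))) * _
      have hb : m''.reg 15 + T < 2 ^ β := by omega
      refine ⟨by simpa using g3, (g1'.setReg (by omega) hb).bd,
        (g1'.setReg (by omega) hb).setReg (by omega) (by omega),
        ((g2.setReg (by omega)).setReg (by omega)).setReg (by omega), by simp,
        by omega, ?_⟩
      rw [Nat.add_eq_zero_iff, g5, hl2]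
      constructor
      · rintro ⟨a1, a2⟩ i' hi' l hl
        rcases Nat.lt_succ_iff_lt_or_eq.1 hi' with h | rfl
        · exact a1 i' h l hl
        · rw [← hasg]; exact a2 l hl
      · intro a
        refine ⟨fun i' hi' => a i' (by omega), fun l hl => ?_⟩
        have := a i (by omega) l hl
        rwa [← hasg] at this
    · rintro m'' ⟨g1, g2, g3, g4, g5⟩
      have e13 : m''.reg 13 = j := (g2.1 13 (by omega)).trans h3
      have e12 : m''.reg 12 = m'.reg 12 := (g2.1 12 (by omega))
      -- The `k` columns of the table cover the whole clause, so a zero count means that the clause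
      -- is falsified.
      have hlen : (F[j]).length ≤ k := hF _ (List.getElem_mem hj)
      refine Wp.ite (m''.cost_lt g1.bd hβ1 _ (by decide)) (fun hne => ?_) (fun he => ?_)
      · refine Wp.skip (by unfold opCost; omega) ⟨e13, g1.bd, g1.setReg (by omega) (by omega),
          (h2.trans (g2.mono (by omega))).setReg (by omega), by simp, ?_⟩ le_rfl
        simp only [Mem.setReg_reg]
        norm_num only [if_true, if_false]
        rw [e12]
        rcases h4 with ⟨a1, a2⟩ | a
        · refine Or.inl ⟨a1, fun j' hj' C hC => ?_⟩
          rcases Nat.lt_succ_iff_lt_or_eq.1 hj' with h | rfl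
          · exact a2 j' h C hC
          · rw [List.getElem?_eq_getElem hj, Option.some_inj] at hC
            subst hC
            rw [Mem.eval_reg, Ne, g5] at hne
            push Not at hne
            obtain ⟨i', -, l, hl, hl'⟩ := hne
            exact ⟨l, List.mem_of_getElem? hl, hl'⟩
        · exact Or.inr a
      · refine Wp.assign_op g1.bd hβ1 (by decide) ?_ le_rfl
        simp only [Mem.eval_add, Mem.eval_reg, Mem.eval_const, e13]
        refine ⟨by simpa using e13, (g1.setReg (by omega) (by omega)).bd,
          (g1.setReg (by omega) (by omega)).setReg (by omega) (by omega),
          ((h2.trans (g2.mono (by omega))).setReg (by omega)).setReg (by omega), by simp, ?_⟩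
        right
        simp only [Mem.setReg_reg]
        norm_num only [if_true, if_false]
        refine ⟨by omega, F[j], by simp, fun l hl => ?_⟩
        obtain ⟨i', hi', rfl⟩ := List.getElem_of_mem hl
        exact g5.1 he i' (by omega) _ (by simp)
  · rintro m' ⟨h1, h2, h3, h4⟩
    refine ⟨h1, h2, h4.imp (fun h => ⟨h.1, fun C hC => ?_⟩) id⟩
    obtain ⟨j, hj, rfl⟩ := List.getElem_of_mem hC
    exact h.2 j hj _ (by simp)

end

/-! ### The random walk -/

/-- Nothing but array `2` and the registers from `b` on has changed. -/
def Same₂ (b : ℕ) (m m' : Mem) : Prop :=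
  (∀ x < b, m'.reg x = m.reg x) ∧ ∀ a ≠ 2, m'.arr a = m.arr a

theorem Same.same₂ {b : ℕ} {m m' : Mem} (h : Same b m m') : Same₂ b m m' :=
  ⟨h.1, fun _ _ => by rw [h.2]⟩

theorem Same₂.trans {b : ℕ} {m m' m'' : Mem} (h : Same₂ b m m') (h' : Same₂ b m' m'') :
    Same₂ b m m'' :=
  ⟨fun x hx => (h'.1 x hx).trans (h.1 x hx), fun a ha => (h'.2 a ha).trans (h.2 a ha)⟩

theorem Same₂.mono {a b : ℕ} {m m' : Mem} (h : Same₂ b m m') (hab : a ≤ b) : Same₂ a m m' :=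
  ⟨fun x hx => h.1 x (by omega), h.2⟩

theorem Same₂.setReg {b : ℕ} {m m' : Mem} (h : Same₂ b m m') {x v : ℕ} (hx : b ≤ x) :
    Same₂ b m (m'.setReg x v) :=
  ⟨fun y hy => by rw [Mem.setReg_reg, if_neg (by omega)]; exact h.1 y hy, h.2⟩

theorem Same₂.setArr {b : ℕ} {m m' : Mem} (h : Same₂ b m m') {i v : ℕ} :
    Same₂ b m (m'.setArr 2 i v) :=
  ⟨h.1, fun a ha => by rw [Mem.setArr_arr_ne _ _ _ _ _ ha]; exact h.2 a ha⟩

theorem Same₂.row {b n i : ℕ} {m m' : Mem} (h : Same₂ b m m') : m'.row n i = m.row n i := by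
  unfold Mem.row; rw [h.2 1 (by norm_num)]

@[simp] theorem Mem.asg_setReg (m : Mem) (n x v : ℕ) : (m.setReg x v).asg n = m.asg n := rfl

@[simp] theorem Mem.row_setReg (m : Mem) (n i x v : ℕ) : (m.setReg x v).row n i = m.row n i := rfl

theorem Mem.asg_setArr (m : Mem) {n : ℕ} (v : Fin n) (b : Bool) :
    (m.setArr 2 v b.toNat).asg n = Function.update (m.asg n) v b := by
  funext u
  simp only [Mem.asg, Mem.setArr_arr, Function.update_apply, Fin.ext_iff, true_and]
  split_ifs
  · cases b <;> simp
  · rfl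

section
variable {n k s β : ℕ} {F : CNF n} {m : Mem}

/-- The size of the input. -/
abbrev inSize {n : ℕ} (k : ℕ) (F : CNF n) : ℕ := n + F.length + k + 1

theorem one_le_inSize (F : CNF n) : 1 ≤ inSize k F := by unfold inSize; omega
theorem vars_le_inSize (F : CNF n) : n ≤ inSize k F := by unfold inSize; omega
theorem length_le_inSize (F : CNF n) : F.length ≤ inSize k F := by unfold inSize; omega
theorem width_le_inSize (F : CNF n) : k ≤ inSize k F := by unfold inSize; omega

/-- All running times are kept in the form `U * (a * Z)`: a loop multiplies `Z` by a bound for its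
length and adds `4` to `a`, and sequencing adds the values of `a`. -/
theorem loop_time' {N t U a M Z : ℕ} (hM : 1 ≤ M) (hZ : 1 ≤ Z) (hN : N ≤ M)
    (ht : t ≤ U * (a * Z)) : N * (t + 2 * U) + 2 * U ≤ U * ((a + 4) * (M * Z)) := by
  calc N * (t + 2 * U) + 2 * U ≤ M * (U * (a * Z) + 2 * U) + 2 * U := by gcongr
    _ = U * (a * (M * Z) + 2 * (M * 1) + 2 * (1 * 1)) := by ring
    _ ≤ U * (a * (M * Z) + 2 * (M * Z) + 2 * (M * Z)) := by gcongr
    _ = U * ((a + 4) * (M * Z)) := by ring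

theorem op_time' (U : ℕ) {Z : ℕ} (hZ : 1 ≤ Z) : U ≤ U * (1 * Z) := by
  rw [one_mul]; exact Nat.le_mul_of_pos_right _ hZ

theorem add_time' {t t' U Z a a' : ℕ} (h : t ≤ U * (a * Z)) (h' : t' ≤ U * (a' * Z)) :
    t + t' ≤ U * ((a + a') * Z) := by
  calc t + t' ≤ _ := add_le_add h h'
    _ = _ := by ring

theorem loop_time {N t U X a b : ℕ} (hX : 1 ≤ X) (hN : N ≤ X) (ht : t ≤ U * (a * X ^ b)) :
    N * (t + 2 * U) + 2 * U ≤ U * ((a + 4) * X ^ (b + 1)) := by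
  rw [pow_succ']
  exact loop_time' hX (Nat.one_le_pow _ _ hX) hN ht

theorem op_time {X : ℕ} (U b : ℕ) (hX : 1 ≤ X) : U ≤ U * (1 * X ^ b) :=
  op_time' U (Nat.one_le_pow _ _ hX)

theorem findUnsat_time (F : CNF n) (U : ℕ) :
    U + (F.length * ((U + ((k * (U + U + 2 * U) + 2 * U) + (U + U))) + 2 * U) + 2 * U) ≤
      U * (14 * inSize k F ^ 2) := by
  have hX : 1 ≤ inSize k F := one_le_inSize F
  refine (add_time' (op_time U 2 hX) (loop_time hX (length_le_inSize F) (add_time' (op_time U 1 hX)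
    (add_time' (loop_time hX (width_le_inSize F) (a := 2) ?_)
    (add_time' (op_time U 1 hX) (op_time U 1 hX)))))).trans (le_of_eq (by ring))
  exact add_time' (op_time U 0 hX) (op_time U 0 hX)

/-- Every literal of the falsified clause is drawn with probability exactly `1/k`, even if the
clause is short, because the draw is over all `k` columns. Only one literal is counted; the other
outcomes contribute something nonnegative. -/
theorem walkStep_wp (hk : 1 ≤ k) (hF : IsKCNF k F) (hβ : Fits n k s β F) (hI : Inv k F s β m)
    {h : (Fin n → Bool) → ℝ} (hh : ∀ y, 0 ≤ h y) {v : ℝ}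
    (hs : Satisfies (m.asg n) F → v ≤ h (m.asg n))
    (hu : 0 < v → ∀ C ∈ F, (∀ l ∈ C, m.asg n l.1 ≠ l.2) →
      ∃ l ∈ C, v ≤ h (Function.update (m.asg n) l.1 l.2) / k) :
    Wp walkStep (opCost β * (18 * inSize k F ^ 2)) m
      (fun m' => Inv k F s β m' ∧ Same₂ 12 m m') (fun m' => h (m'.asg n)) v := by
  have hβ1 := hβ.pos
  have hX : 1 ≤ inSize k F := one_le_inSize F
  refine Wp.time_le (Wp.spec_seq (findUnsat_wp hF hβ hI)
    (t' := opCost β + (opCost β + (opCost β + opCost β))) ?_) ((add_time' (findUnsat_time F _)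
    (add_time' (op_time _ 2 hX) (add_time' (op_time _ 2 hX) (add_time' (op_time _ 2 hX)
    (op_time _ 2 hX))))).trans (le_of_eq (by ring)))
  unfold Fits at hβ
  rintro m₁ ⟨h1, h2, h3⟩
  have hasg : m₁.asg n = m.asg n := h2.asg
  have kpos : (0 : ℝ) < k := by exact_mod_cast hk
  -- The rest of the step after column `y` has been drawn, with a payoff `w` that may depend on `y`.
  have tail : ∀ y < k, ∀ w : ℝ, (m₁.reg 12 = 0 → w ≤ h (m.asg n)) →
      (m₁.reg 12 ≠ 0 → ∀ C, F[m₁.reg 12 - 1]? = some C →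
        (C[y]? = none → w ≤ 0) ∧
        ∀ l, C[y]? = some l → w ≤ h (Function.update (m.asg n) l.1 l.2)) →
      Wp (.seq (.assign 14 (.get 0 (.add (.mul (.reg 3) (.sub (.reg 12) (.const 1))) (.reg 13))))
        (.ite (.mul (.reg 12) (.reg 14)) (.put 2 (varE 14) (signE 14)) .skip))
        (opCost β + (opCost β + opCost β)) (m₁.setReg 13 y)
        (fun m' => Inv k F s β m' ∧ Same₂ 12 m m') (fun m' => h (m'.asg n)) w := by
    intro y hy w hw0 hw1
    have g1 := h1.setReg (x := 13) (v := y) (by omega) (by omega)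
    refine Wp.assign_seq g1.bd hβ1 (by decide) ?_
    have ha : (m₁.setReg 13 y).eval
        (.get 0 (.add (.mul (.reg 3) (.sub (.reg 12) (.const 1))) (.reg 13))) =
        litCode (F[m₁.reg 12 - 1]?.bind fun C => C[y]?) := by
      simp only [Mem.eval_get, Mem.eval_add, Mem.eval_mul, Mem.eval_reg, Mem.eval_sub,
        Mem.eval_const, Mem.setReg_reg, Mem.setReg_arr]
      norm_num only [if_true, if_false]
      rw [h1.r3, h1.a0, clause_index F hy]
    rw [ha]
    set o := F[m₁.reg 12 - 1]?.bind fun C => C[y]? with ho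
    have hob := litCode_le o
    have g2 := g1.setReg (x := 14) (v := litCode o) (by omega) (by omega)
    have hS : Same₂ 12 m ((m₁.setReg 13 y).setReg 14 (litCode o)) :=
      ((h2.setReg (by omega)).setReg (by omega)).same₂
    refine Wp.ite (Mem.cost_lt g2.bd hβ1 _ (by decide)) (fun hne => ?_) (fun he => ?_)
    · simp only [Mem.eval_mul, Mem.eval_reg, Mem.setReg_reg] at hne
      norm_num only [if_true, if_false] at hne
      obtain ⟨hn1, hn2⟩ := mul_ne_zero_iff.1 hne
      rcases hoo : o with _ | ⟨u, b⟩
      · rw [hoo] at hn2; simp [litCode] at hn2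
      rw [hoo] at g2 hS
      have e1 : ((m₁.setReg 13 y).setReg 14 (litCode (some (u, b)))).eval (varE 14) = u := by
        simp only [varE, Mem.eval_sub, Mem.eval_div, Mem.eval_const, Mem.eval_reg, Mem.setReg_reg,
          if_true, litCode_var]
      have e2 : ((m₁.setReg 13 y).setReg 14 (litCode (some (u, b)))).eval (signE 14) =
          b.toNat := by
        simp only [signE, Mem.eval_sub, Mem.eval_mul, e1, Mem.eval_const, Mem.eval_reg,
          Mem.setReg_reg, if_true, litCode_sign]
      refine Wp.put (Mem.cost_lt₂ g2.bd hβ1 _ _ (by decide)) ?_ ?_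
      · rw [e1, e2]
        exact ⟨g2.setArr (by omega) (Bool.toNat_le b) hβ1, hS.setArr⟩
      · rw [e1, e2, Mem.asg_setArr]
        simp only [Mem.asg_setReg, hasg]
        rw [ho, Option.bind_eq_some_iff] at hoo
        obtain ⟨C, hC, hl⟩ := hoo
        exact (hw1 hn1 C hC).2 _ hl
    · refine Wp.skip (by unfold opCost; omega) ⟨g2, hS⟩ ?_
      simp only [Mem.asg_setReg, hasg]
      simp only [Mem.eval_mul, Mem.eval_reg, Mem.setReg_reg] at he
      norm_num only [if_true, if_false] at he
      by_cases h0 : m₁.reg 12 = 0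
      · exact hw0 h0
      · have hc : litCode o = 0 := (Nat.mul_eq_zero.1 he).resolve_left h0
        rcases hoo : o with _ | ⟨u, b⟩
        · rcases h3 with h3 | ⟨-, C, hC, -⟩
          · exact absurd h3.1 h0
          · rw [ho, hC] at hoo
            exact ((hw1 h0 C hC).1 hoo).trans (hh _)
        · have := litCode_pos u b
          rw [hoo] at hc; omega
  rcases h3 with ⟨h0, hsat⟩ | ⟨h0, C, hC, hCf⟩
  · refine Wp.draw_seq h1.bd hβ1 (by decide) h1.r3 (by omega) (fun _ => v) (fun y hy =>
      tail y hy v (fun _ => hs hsat) (fun h => absurd h0 h)) ?_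
    simp [kpos.ne']
  · have hCF : C ∈ F := List.mem_of_getElem? hC
    rcases le_or_gt v 0 with hv0 | hv0
    · exact Wp.draw_seq h1.bd hβ1 (by decide) h1.r3 (by omega) (fun _ => 0) (fun y hy =>
        tail y hy 0 (fun _ => hh _) (fun _ _ _ => ⟨fun _ => le_rfl, fun _ _ => hh _⟩)) (by simpa)
    obtain ⟨l, hl, hv⟩ := hu hv0 C hCF hCf
    obtain ⟨i, hi, rfl⟩ := List.getElem_of_mem hl
    refine Wp.draw_single_seq h1.bd hβ1 (by decide) h1.r3 (y₀ := i) (hi.trans_le (hF C hCF))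
      (fun y hy => tail y hy _ (fun h => absurd h h0) (fun _ C' hC' => ?_)) hv
    obtain rfl : C = C' := by rwa [hC, Option.some_inj] at hC'
    split_ifs with hyi
    · subst hyi
      refine ⟨fun h => ?_, fun l h => ?_⟩
      · simp [List.getElem?_eq_getElem hi] at h
      · rw [List.getElem?_eq_getElem hi, Option.some_inj] at h
        rw [h]
    · exact ⟨fun _ => le_rfl, fun _ _ => hh _⟩

/-- The potential of the random walk. -/
noncomputable def pot (k : ℕ) (z y : Fin n → Bool) : ℝ := (1 / (k : ℝ)) ^ hammingDist y z

theorem pot_nonneg (z y : Fin n → Bool) : 0 ≤ pot k z y := by unfold pot; positivity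

theorem hammingDist_update {y z : Fin n → Bool} {v : Fin n} (h : y v ≠ z v) :
    hammingDist (Function.update y v (z v)) z + 1 = hammingDist y z := by
  unfold hammingDist
  rw [← Finset.card_erase_add_one (a := v) (s := Finset.univ.filter fun i => y i ≠ z i)
    (by simpa using h)]
  congr 2
  ext u
  by_cases hu : u = v
  · subst hu; simp
  · simp [hu]

-- A falsified clause contains a literal that is true under `z`. Choosing it has probability `1/k`
-- and decreases the distance to `z` by one, which multiplies the potential by `k`, so the potential
-- does not decrease in expectation. Such moves preserve `A`, and solutions are absorbing. Points
-- that are no solutions count only while the remaining steps suffice to reach `z`; hence the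
-- condition on `hammingDist + i`.
open Classical in
theorem walk_wp (hk : 1 ≤ k) (hF : IsKCNF k F) (hβ : Fits n k s β F) (hI : Inv k F s β m)
    (z : Fin n → Bool) (A : (Fin n → Bool) → Prop) (hz : ∀ y, A y → Satisfies z F)
    (hA : ∀ y v, A y → y v ≠ z v → A (Function.update y v (z v))) :
    Wp (forN 11 (.reg 0) walkStep) (opCost β * (22 * inSize k F ^ 3)) m
      (fun m' => Inv k F s β m' ∧ Same₂ 11 m m')
      (fun m' => if A (m'.asg n) ∧ Satisfies (m'.asg n) F then 1 else 0)
      (if A (m.asg n) then pot k z (m.asg n) else 0) := by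
  have hβ1 := hβ.pos
  have hX : 1 ≤ inSize k F := one_le_inSize F
  have kpos : (0 : ℝ) < k := by exact_mod_cast hk
  have hk1 : 1 / (k : ℝ) ≤ 1 := by
    rw [div_le_one kpos]; exact_mod_cast hk
  refine Wp.mono (Wp.forN (N := n) (t := opCost β * (18 * inSize k F ^ 2))
    (fun i m' => Inv k F s β m' ∧ Same₂ 11 m m' ∧ m'.reg 11 = i)
    (fun i m' => if A (m'.asg n) ∧ (Satisfies (m'.asg n) F ∨ hammingDist (m'.asg n) z + i ≤ n)
      then pot k z (m'.asg n) else 0) hβ1 hI.bd (by decide) (by decide)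
    (fun i _ m' h => ⟨h.1.bd, h.1.r0, h.2.2⟩) ?_ le_rfl ?_)
    ((loop_time hX (vars_le_inSize F) le_rfl).trans (le_of_eq (by ring)))
    (fun m' h => ⟨h.1, h.2.1⟩) ?_ ?_
  · exact ⟨hI.setReg (by omega) (by simp), (Same.refl _ _).same₂.setReg (by omega), by simp⟩
  · rintro i hi m' ⟨h1, h2, h3⟩
    have hin : i + 1 < 2 ^ β := by unfold Fits at hβ; omega
    refine Wp.mono (walkStep_wp hk hF hβ h1 (v := if A (m'.asg n) ∧ (Satisfies (m'.asg n) F ∨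
      hammingDist (m'.asg n) z + i ≤ n) then pot k z (m'.asg n) else 0)
      (h := fun y => if A y ∧ (Satisfies y F ∨ hammingDist y z + (i + 1) ≤ n)
        then pot k z y else 0) ?_ ?_ ?_) le_rfl ?_ (fun _ _ => le_rfl) le_rfl
    · intro y; split_ifs
      · exact pot_nonneg _ _
      · exact le_rfl
    · intro hs
      simp [hs]
    · intro hpos C hC hCf
      have hns : ¬ Satisfies (m'.asg n) F := fun h => by
        obtain ⟨l, hl, hl'⟩ := h C hC
        exact hCf l hl hl'
      have hAy : A (m'.asg n) ∧ hammingDist (m'.asg n) z + i ≤ n := by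
        by_contra hc
        rw [if_neg (by tauto)] at hpos
        exact lt_irrefl _ hpos
      obtain ⟨l, hl, hl'⟩ := hz _ hAy.1 C hC
      refine ⟨l, hl, ?_⟩
      have hne : m'.asg n l.1 ≠ z l.1 := by rw [hl']; exact hCf l hl
      have hd := hammingDist_update hne
      have hA' := hA _ _ hAy.1 hne
      rw [hl'] at hd hA'
      rw [if_pos ⟨hAy.1, Or.inr hAy.2⟩, if_pos ⟨hA', Or.inr (by omega)⟩]
      unfold pot
      rw [← hd, pow_succ]
      apply le_of_eq
      field_simp
    · rintro m'' ⟨g1, g2⟩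
      have g3 : m''.reg 11 = i := (g2.1 11 (by omega)).trans h3
      exact ⟨g3, g1.bd, g1.setReg (by omega) hin, (h2.trans (g2.mono (by omega))).setReg (by omega),
        by simp⟩
  · rintro m' -
    split_ifs with c1 c2 c2
    · exact pow_le_one₀ (by positivity) hk1
    · refine absurd ⟨c1.1, ?_⟩ c2
      rcases c1.2 with h | h
      · exact h
      -- After `n` steps a walk that still counts without being at a known solution has distance `0`
      -- from `z`.
      · have : m'.asg n = z := hammingDist_eq_zero.1 (by omega)
        rw [this]; exact hz _ c1.1
    · exact zero_le_one
    · exact le_rfl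
  · have : hammingDist (m.asg n) z ≤ n := by
      simpa using hammingDist_le_card_fintype (x := m.asg n) (y := z)
    simp [this]

end

/-! ### The random starting point -/

theorem sum_range_ite_lt {N a : ℕ} (h : a ≤ N) (P Q : ℝ) :
    ∑ y ∈ Finset.range N, (if y < a then P else Q) = a * P + (N - a) * Q := by
  obtain ⟨d, rfl⟩ := Nat.exists_eq_add_of_le h
  clear h
  induction d with
  | zero =>
    rw [add_zero, Finset.sum_congr rfl fun y hy => if_pos (Finset.mem_range.1 hy)]
    simp
  | succ d ih =>
    rw [← add_assoc, Finset.sum_range_succ, ih, if_neg (by omega)]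
    push_cast; ring

/-- `2 n` times the probability that position `v` is flipped by `fill`. -/
def flipWeight (n i j v : ℕ) : ℕ := if v < i then 0 else if v = i then 2 * n else j

section
variable {n k s β : ℕ} {F : CNF n} {m : Mem}

/-- `Ψ` is a subharmonic family for the random filling of the array. -/
def IsFillPotential (w : Fin n → Bool) (i j : ℕ) (Ψ : ℕ → (Fin n → Bool) → ℝ) : Prop :=
  ∀ (v : Fin n) (y : Fin n → Bool), 2 * (n : ℝ) * Ψ v y ≤
    (flipWeight n i j v : ℝ) * Ψ (v + 1) (Function.update y v (!w v)) +
      (2 * (n : ℝ) - flipWeight n i j v) * Ψ (v + 1) (Function.update y v (w v))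

theorem Inv.arr_one (h : Inv k F s β m) (i : ℕ) (v : Fin n) :
    m.arr 1 (n * i + v) = (m.row n i v).toNat := by
  have := h.b1 (n * i + v)
  have : m.arr 1 (n * i + v) = 0 ∨ m.arr 1 (n * i + v) = 1 := by omega
  rcases this with h | h <;> simp [Mem.row, h]

theorem Inv.arr_two (h : Inv k F s β m) (v : Fin n) :
    m.arr 2 v = (m.asg n v).toNat := by
  have := h.b2 v
  have : m.arr 2 v = 0 ∨ m.arr 2 v = 1 := by omega
  rcases this with h | h <;> simp [Mem.asg, h]

theorem flip_eq (b : Bool) {i j v x : ℕ} (hx : x < 2 * n) :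
    (b.toNat - ((1 - ((v - i) + (i - v))) + (1 - (1 - (v - i))) * (1 - (1 - (j - x))))) +
      (((1 - ((v - i) + (i - v))) + (1 - (1 - (v - i))) * (1 - (1 - (j - x)))) - b.toNat) =
      (if x < flipWeight n i j v then !b else b).toNat := by
  have key : (1 - ((v - i) + (i - v))) + (1 - (1 - (v - i))) * (1 - (1 - (j - x))) =
      if x < flipWeight n i j v then 1 else 0 := by
    unfold flipWeight
    rcases lt_trichotomy v i with h | h | h
    · rw [if_pos h, show v - i = 0 by omega, show 1 - (0 + (i - v)) = 0 by omega]
      simp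
    · subst h
      simp [hx]
    · rw [if_neg (by omega : ¬ v < i), if_neg (by omega : ¬ v = i), show i - v = 0 by omega,
        show 1 - (v - i + 0) = 0 by omega, show 1 - (1 - (v - i)) = 1 by omega]
      split_ifs <;> omega
  rw [key]
  split_ifs <;> cases b <;> simp

/-- `Ψ v` is the payoff once the positions below `v` are written. `IsFillPotential` is the
submartingale inequality for one position, multiplied by the number `2 n` of outcomes of the draw.
-/
theorem fill_wp (hβ : Fits n k s β F) (hI : Inv k F s β m) (hj : m.reg 10 ≤ n)
    {Ψ : ℕ → (Fin n → Bool) → ℝ}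
    (hΨ : IsFillPotential (m.row n (m.reg 8)) (m.reg 9) (m.reg 10) Ψ) :
    Wp fill (opCost β * (6 * inSize k F)) m
      (fun m' => Inv k F s β m' ∧ Same₂ 11 m m') (fun m' => Ψ n (m'.asg n)) (Ψ 0 (m.asg n)) := by
  have hβ1 := hβ.pos
  have hX : 1 ≤ inSize k F := one_le_inSize F
  unfold Fits at hβ
  refine Wp.mono (Wp.forN (N := n) (t := opCost β + opCost β)
    (fun i m' => Inv k F s β m' ∧ Same₂ 11 m m' ∧ m'.reg 11 = i)
    (fun i m' => Ψ i (m'.asg n)) hβ1 hI.bd (by decide) (by decide)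
    (fun i _ m' h => ⟨h.1.bd, h.1.r0, h.2.2⟩) ?_ le_rfl ?_)
    ((loop_time' (a := 2) (Z := 1) hX le_rfl (vars_le_inSize F) (by omega)).trans
      (le_of_eq (by ring)))
    (fun m' h => ⟨h.1, h.2.1⟩) (fun _ _ => le_rfl) le_rfl
  · exact ⟨hI.setReg (by omega) (by simp), (Same.refl _ _).same₂.setReg (by omega), by simp⟩
  · rintro i hi m' ⟨h1, h2, h3⟩
    have hn : (0 : ℝ) < n := by exact_mod_cast (by omega : 0 < n)
    have e8 : m'.reg 8 = m.reg 8 := h2.1 8 (by omega)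
    have e9 : m'.reg 9 = m.reg 9 := h2.1 9 (by omega)
    have e10 : m'.reg 10 = m.reg 10 := h2.1 10 (by omega)
    have hfw : flipWeight n (m.reg 9) (m.reg 10) i ≤ 2 * n := by
      unfold flipWeight; split_ifs <;> omega
    refine Wp.draw_seq h1.bd hβ1 (by decide) (N := 2 * n) (by simp [h1.r0]) (by omega)
      (fun x => if x < flipWeight n (m.reg 9) (m.reg 10) i then
        Ψ (i + 1) (Function.update (m'.asg n) ⟨i, hi⟩ (!m.row n (m.reg 8) ⟨i, hi⟩)) else
        Ψ (i + 1) (Function.update (m'.asg n) ⟨i, hi⟩ (m.row n (m.reg 8) ⟨i, hi⟩))) ?_ ?_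
    · intro x hx
      have g1 := h1.setReg (x := 12) (v := x) (by omega) (by omega)
      set b := m.row n (m.reg 8) ⟨i, hi⟩ with hb
      have e1 : m'.arr 1 (n * m.reg 8 + i) = b.toNat := by
        rw [h1.arr_one (m.reg 8) ⟨i, hi⟩, h2.row]
      have ha : ((m'.setReg 12 x).eval (.reg 11)) = i := by simp [h3]
      have he : ((m'.setReg 12 x).eval (distE (.get 1 (.add (.mul (.reg 0) (.reg 8)) (.reg 11)))
          (.add (.sub (.const 1) (distE (.reg 11) (.reg 9)))
          (.mul (posE (.sub (.reg 11) (.reg 9))) (posE (.sub (.reg 10) (.reg 12))))))) =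
          (if x < flipWeight n (m.reg 9) (m.reg 10) i then !b else b).toNat := by
        simp only [distE, posE, Mem.eval_get, Mem.eval_add, Mem.eval_mul, Mem.eval_reg,
          Mem.eval_sub, Mem.eval_const, Mem.setReg_reg, Mem.setReg_arr]
        norm_num only [if_true, if_false]
        rw [h1.r0, e8, e9, e10, h3, e1]
        exact flip_eq b hx
      refine Wp.put (Mem.cost_lt₂ g1.bd hβ1 _ _ (by decide)) ?_ ?_
      · rw [ha, he]
        have g2 := g1.setArr (a := 2) (i := i) (by omega) (Bool.toNat_le (if x < flipWeight n
          (m.reg 9) (m.reg 10) i then !b else b)) hβ1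
        refine ⟨by simpa using h3, g2.bd, g2.setReg (by omega) (by omega),
          ((h2.setReg (by omega)).setArr).setReg (by omega), by simp⟩
      · rw [ha, he, Mem.asg_setReg]
        have := Mem.asg_setArr (m'.setReg 12 x) ⟨i, hi⟩
          (if x < flipWeight n (m.reg 9) (m.reg 10) i then !b else b)
        rw [this, Mem.asg_setReg]
        split_ifs <;> exact le_rfl
    · rw [sum_range_ite_lt hfw, le_div_iff₀ (by push_cast; positivity)]
      have := hΨ ⟨i, hi⟩ (m'.asg n)
      push_cast
      linarith

/-! ### Distances from the previous solutions -/

theorem toNat_dist (a b : Bool) :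
    (a.toNat - b.toNat) + (b.toNat - a.toNat) = if b ≠ a then 1 else 0 := by
  cases a <;> cases b <;> rfl

/-- The value `n + 1` stands for infinity. In the first round it makes every solution acceptable,
and it is the reason for the hypothesis `θ ≤ n + 1` in later lemmas. -/
theorem minDist_wp (hβ : Fits n k s β F) (hI : Inv k F s β m) (hs : 1 ≤ s) (hc : m.reg 5 ≤ s) :
    Wp minDist (opCost β * (12 * (s * inSize k F))) m
      (fun m' => Inv k F s β m' ∧ Same 11 m m' ∧ ∀ θ, θ ≤ m'.reg 11 ↔ θ ≤ n + 1 ∧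
        ∀ i < m.reg 5, θ ≤ hammingDist (m.row n i) (m.asg n)) 0 0 := by
  have hβ1 := hβ.pos
  have hX : 1 ≤ inSize k F := one_le_inSize F
  have hZ : 1 ≤ s * inSize k F := Nat.one_le_iff_ne_zero.2 (by positivity)
  unfold Fits at hβ
  set c := m.reg 5 with hc_def
  have hI' := hI.setReg (x := 11) (v := n + 1) (by omega) (by omega)
  refine Wp.time_le (Wp.assign_seq hI.bd hβ1 (by decide) (t := c * (opCost β +
    ((n * (opCost β + 2 * opCost β) + 2 * opCost β) + opCost β) + 2 * opCost β) + 2 * opCost β) ?_)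
    ((add_time' (op_time' _ hZ) (loop_time' (a := 7) hs hX hc ?_)).trans (le_of_eq (by ring)))
  swap
  · exact add_time' (op_time' _ hX) (add_time' ((loop_time' (t := opCost β)
      (U := opCost β) (a := 1) (Z := 1) hX le_rfl
      (vars_le_inSize F) (by omega)).trans (by rw [mul_one])) (op_time' _ hX))
  rw [show m.eval (.add (.reg 0) (.const 1)) = n + 1 by simp [hI.r0]]
  refine Wp.mono (Wp.forN (N := c) (fun i m' => Inv k F s β m' ∧ Same 11 m m' ∧ m'.reg 12 = i ∧
      ∀ θ, θ ≤ m'.reg 11 ↔ θ ≤ n + 1 ∧ ∀ i' < i, θ ≤ hammingDist (m.row n i') (m.asg n))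
    (fun _ => 0) hβ1 hI'.bd (by decide) (by decide)
    (fun i _ m' h => ⟨h.1.bd, h.2.1.1 5 (by omega), h.2.2.1⟩) ?_ (le_refl 0) ?_) le_rfl
    (fun m' h => ⟨h.1, h.2.1, h.2.2.2⟩) (fun _ _ => le_rfl) le_rfl
  · exact ⟨hI'.setReg (by omega) (by simp),
      ((Same.refl _ _).setReg (by omega)).setReg (by omega), by simp, by simp⟩
  · rintro i hi m' ⟨h1, h2, h3, h4⟩
    have h1' := h1.setReg (x := 14) (v := 0) (by omega) (by simp)
    refine Wp.assign_seq h1.bd hβ1 (by decide) ?_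
    have hle : ∀ u,
        ((m.arr 2 u - m.arr 1 (n * i + u)) + (m.arr 1 (n * i + u) - m.arr 2 u)) ≤ 1 := by
      intro u
      have := hI.b1 (n * i + u)
      have := hI.b2 u
      omega
    refine Wp.spec_seq (Wp.forN (N := n) (fun v m'' => Inv k F s β m'' ∧ Same 13 m' m'' ∧
      m''.reg 13 = v ∧ m''.reg 14 ≤ v ∧ m''.reg 14 = ∑ u ∈ Finset.range v,
        ((m.arr 2 u - m.arr 1 (n * i + u)) + (m.arr 1 (n * i + u) - m.arr 2 u)))
      (fun _ => 0) hβ1 h1'.bd (by decide) (by decide)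
      (fun i _ m' h => ⟨h.1.bd, h.1.r0, h.2.2.1⟩) ?_ (le_refl 0) ?_) ?_
    · exact ⟨h1'.setReg (by omega) (by simp),
        ((Same.refl _ _).setReg (by omega)).setReg (by omega), by simp, by simp, by simp⟩
    · rintro v hv m'' ⟨g1, g2, g3, g4, g5⟩
      have e12 : m''.reg 12 = i := (g2.1 12 (by omega)).trans h3
      have ha : m''.arr = m.arr := g2.2.trans h2.2
      have he : m''.eval (.add (.reg 14)
          (distE (.get 2 (.reg 13)) (.get 1 (.add (.mul (.reg 0) (.reg 12)) (.reg 13))))) =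
          m''.reg 14 + ((m.arr 2 v - m.arr 1 (n * i + v)) + (m.arr 1 (n * i + v) - m.arr 2 v)) := by
        simp only [distE, Mem.eval_get, Mem.eval_add, Mem.eval_mul, Mem.eval_reg, Mem.eval_sub, g3,
          e12, g1.r0, ha]
      refine Wp.assign_op g1.bd hβ1 (by decide) ?_ le_rfl
      rw [he]
      have := hle v
      have g6 := g1.setReg (x := 14) (v := m''.reg 14 + ((m.arr 2 v - m.arr 1 (n * i + v)) +
        (m.arr 1 (n * i + v) - m.arr 2 v))) (by omega) (by omega)
      refine ⟨by simpa using g3, g6.bd, g6.setReg (by omega) (by omega),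
        (g2.setReg (by omega)).setReg (by omega), by simp, ?_, ?_⟩
      · simp only [Mem.setReg_reg]
        norm_num only [if_true, if_false]
        omega
      · simp only [Mem.setReg_reg]
        norm_num only [if_true, if_false]
        rw [Finset.sum_range_succ, g5]
    · rintro m'' ⟨g1, g2, g3, g4, g5⟩
      have e11 : m''.reg 11 = m'.reg 11 := g2.1 11 (by omega)
      have e14 : m''.reg 14 = hammingDist (m.row n i) (m.asg n) := by
        rw [g5, Finset.sum_range, hammingDist, Finset.card_filter]
        refine Finset.sum_congr rfl fun u _ => ?_
        rw [hI.arr_one, hI.arr_two, toNat_dist]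
      have h11 : m'.reg 11 ≤ n + 1 := ((h4 _).1 le_rfl).1
      refine Wp.assign_op g1.bd hβ1 (by decide) ?_ le_rfl
      simp only [Mem.eval_sub, Mem.eval_reg, e11, e14]
      have g6 := g1.setReg (x := 11) (v := m'.reg 11 - (m'.reg 11 -
        hammingDist (m.row n i) (m.asg n))) (by omega) (by omega)
      refine ⟨?_, g6.bd, g6.setReg (by omega) (by omega),
        ((h2.trans (g2.mono (by omega))).setReg (by omega)).setReg (by omega), by simp, ?_⟩
      · simp only [Mem.setReg_reg]
        norm_num only [if_true, if_false]
        exact (g2.1 12 (by omega)).trans h3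
      · intro θ
        simp only [Mem.setReg_reg]
        norm_num only [if_true, if_false]
        have e : (θ ≤ m'.reg 11 - (m'.reg 11 - hammingDist (m.row n i) (m.asg n))) ↔
            θ ≤ m'.reg 11 ∧ θ ≤ hammingDist (m.row n i) (m.asg n) := by omega
        rw [e, h4, Nat.forall_lt_succ_right, and_assoc]

/-! ### Keeping the best candidate -/

/-- Register `7` holds the quality of the present candidate, and `0` if there is none. The strict
comparison rejects candidates at distance `0`, that is, repetitions of earlier rows. -/
theorem accept_wp (hβ : Fits n k s β F) (hI : Inv k F s β m) :
    Wp accept (opCost β * (8 * inSize k F)) m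
      (fun m' => Inv k F s β m' ∧ (∀ x < 7, m'.reg x = m.reg x) ∧
        ((m.reg 12 = 0 ∧ m.reg 7 < m.reg 11 ∧ m'.reg 7 = m.reg 11 ∧
          m'.row n (m.reg 5) = m.asg n ∧ ∀ i < m.reg 5, m'.row n i = m.row n i) ∨
        ((m.reg 12 ≠ 0 ∨ m.reg 11 ≤ m.reg 7) ∧ m'.reg 7 = m.reg 7 ∧ m'.arr = m.arr))) 0 0 := by
  have hβ1 := hβ.pos
  have hX : 1 ≤ inSize k F := one_le_inSize F
  unfold Fits at hβ
  have hU : 1 ≤ opCost β := by unfold opCost; omega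
  refine Wp.time_le (Wp.ite (t' := opCost β + (opCost β + (n * (opCost β + 2 * opCost β) +
    2 * opCost β))) (m.cost_lt hI.bd hβ1 _ (by decide)) (fun hne => ?_) fun h0 => ?_)
    ((add_time' (op_time' _ hX) (add_time' (op_time' _ hX) (add_time' (op_time' _ hX)
    ((loop_time' (t := opCost β) (U := opCost β) (a := 1) (Z := 1) hX le_rfl
    (vars_le_inSize F) (by omega)).trans
    (by rw [mul_one]))))).trans (le_of_eq (by ring)))
  · exact Wp.skip (by omega) ⟨hI, fun _ _ => rfl, Or.inr ⟨Or.inl hne, rfl, rfl⟩⟩ le_rfl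
  refine Wp.ite (m.cost_lt hI.bd hβ1 _ (by decide)) (fun hne => ?_) fun h1 => ?_
  swap
  · refine Wp.skip (by omega) ⟨hI, fun _ _ => rfl, Or.inr ⟨Or.inr ?_, rfl, rfl⟩⟩ le_rfl
    simp only [Mem.eval_sub, Mem.eval_reg] at h1
    omega
  simp only [Mem.eval_sub, Mem.eval_reg] at hne h0
  have h1 := hI.setReg (x := 7) (v := m.reg 11) (by omega) (hI.bd.1 11)
  refine Wp.assign_seq hI.bd hβ1 (by decide) ?_
  rw [Mem.eval_reg]
  set c := m.reg 5
  refine Wp.mono (Wp.forN (N := n) (fun v m' => Inv k F s β m' ∧ (∀ x < 7, m'.reg x = m.reg x) ∧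
      m'.reg 7 = m.reg 11 ∧ m'.reg 13 = v ∧ m'.arr 2 = m.arr 2 ∧
      (∀ u < v, m'.arr 1 (n * c + u) = m.arr 2 u) ∧ ∀ p < n * c, m'.arr 1 p = m.arr 1 p)
    (fun _ => 0) hβ1 h1.bd (by decide) (by decide)
    (fun i _ m' h => ⟨h.1.bd, h.1.r0, h.2.2.2.1⟩) ?_ (le_refl 0) ?_) le_rfl
    ?_ (fun _ _ => le_rfl) le_rfl
  · refine ⟨h1.setReg (by omega) (by simp), fun x hx => ?_, by simp, by simp, rfl, by simp,
      fun _ _ => rfl⟩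
    rw [Mem.setReg_reg, if_neg (by omega), Mem.setReg_reg, if_neg (by omega)]
  · rintro v hv m' ⟨g1, g2, g3, g4, g5, g6, g7⟩
    have e1 : m'.eval (.add (.mul (.reg 0) (.reg 5)) (.reg 13)) = n * c + v := by
      simp only [Mem.eval_add, Mem.eval_mul, Mem.eval_reg, g1.r0, g4, g2 5 (by omega)]; rfl
    have e2 : m'.eval (.get 2 (.reg 13)) = m.arr 2 v := by
      simp only [Mem.eval_get, Mem.eval_reg, g4, g5]
    refine Wp.put (Mem.cost_lt₂ g1.bd hβ1 _ _ (by decide)) ?_ le_rfl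
    rw [e1, e2]
    have g8 := g1.setArr (a := 1) (i := n * c + v) (by omega) (hI.b2 v) hβ1
    refine ⟨g4, g8.bd, g8.setReg (by omega) (by omega), fun x hx => ?_, by simpa using g3,
      by simp, ?_, fun u hu => ?_, fun p hp => ?_⟩
    · rw [Mem.setReg_reg, if_neg (by omega)]; exact g2 x hx
    · rw [Mem.setReg_arr, Mem.setArr_arr_ne _ _ _ _ _ (by omega), g5]
    · rw [Mem.setReg_arr, Mem.setArr_arr]
      split_ifs with h
      · rw [show u = v by omega]
      · exact g6 u (by omega)
    · rw [Mem.setReg_arr, Mem.setArr_arr, if_neg (by omega), g7 p hp]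
  · rintro m' ⟨g1, g2, g3, g4, g5, g6, g7⟩
    refine ⟨g1, g2, Or.inl ⟨h0, by omega, g3, ?_, fun i hi => ?_⟩⟩
    · funext u
      simp only [Mem.row, Mem.asg, g6 u u.2]
    · funext u
      have : n * i + u < n * c := by
        have h2 : n * (i + 1) ≤ n * c := Nat.mul_le_mul_left _ hi
        have := u.2
        rw [mul_add] at h2
        omega
      simp only [Mem.row, g7 _ this]

end

/-! ### Trials and rounds -/

section
variable {n k s β : ℕ} {F : CNF n} {m : Mem}

/-- The invariant of a round that has started in the memory `m₀` with `c` rows. -/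
structure RoundInv {n : ℕ} (k : ℕ) (F : CNF n) (s β c : ℕ) (m₀ m : Mem) : Prop where
  inv : Inv k F s β m
  r4 : m.reg 4 = m₀.reg 4
  r5 : m.reg 5 = c
  rows : ∀ i < c, m.row n i = m₀.row n i
  best : m.reg 7 ≠ 0 → Satisfies (m.row n c) F ∧
    ∀ i < c, m.reg 7 ≤ hammingDist (m.row n i) (m.row n c)

/-- Filling according to `w, i, j` and walking leads with probability at least `q` to a solution at
distance at least `θ` from the first `c` rows. -/
def Reachable {n : ℕ} (k : ℕ) (F : CNF n) (rows : ℕ → Fin n → Bool) (c θ : ℕ) (w : Fin n → Bool)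
    (i j : ℕ) (q : ℝ) : Prop :=
  ∃ (z : Fin n → Bool) (A : (Fin n → Bool) → Prop)
    (Ψ : ℕ → (Fin n → Bool) → ℝ),
    (∀ y, A y → Satisfies z F) ∧
    (∀ y v, A y → y v ≠ z v → A (Function.update y v (z v))) ∧
    (∀ y, A y → Satisfies y F → ∀ i < c, θ ≤ hammingDist (rows i) y) ∧
    IsFillPotential w i j Ψ ∧
    (∀ y, Ψ n y ≤ open Classical in if A y then pot k z y else 0) ∧ ∀ y, q ≤ Ψ 0 y

/-- With `A` empty nothing is promised. This covers the trials whose parameters are guessed wrongly,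
so that the invariants and time bounds apply to them too. -/
theorem Reachable.trivial (k : ℕ) (F : CNF n) (rows : ℕ → Fin n → Bool) (c θ : ℕ)
    (w : Fin n → Bool) (i j : ℕ) : Reachable k F rows c θ w i j 0 :=
  ⟨fun _ => false, fun _ => False, fun _ _ => 0, by simp, by simp, by simp,
    by simp [IsFillPotential], by simp, by simp⟩

/-- The payoffs are chained backwards: `θ ≤ reg 7` holds if the walk ends at a solution in `A`, the
walk achieves this with expectation the potential on `A`, and `Ψ` carries this back to the start of
the filling. -/
theorem search_wp (hk : 1 ≤ k) (hF : IsKCNF k F) (hβ : Fits n k s β F) {c θ : ℕ} {m₀ : Mem}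
    (hI : RoundInv k F s β c m₀ m) (hc : c < s) (hθ : θ ≤ n + 1) (h10 : m.reg 10 ≤ n) {q : ℝ}
    (hq : Reachable k F (m.row n) c θ (m.row n (m.reg 8)) (m.reg 9) (m.reg 10) q) :
    Wp (.seq fill (.seq (forN 11 (.reg 0) walkStep) (.seq minDist (.seq findUnsat accept))))
      (opCost β * (62 * (s * inSize k F ^ 3))) m
      (fun m' => RoundInv k F s β c m₀ m' ∧ m'.reg 6 = m.reg 6 ∧ m.reg 7 ≤ m'.reg 7)
      (fun m' => if θ ≤ m'.reg 7 then 1 else 0) q := by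
  classical
  obtain ⟨z, A, Ψ, hz, hA, hAθ, hΨ, hΨn, hΨ0⟩ := hq
  have hX : 1 ≤ inSize k F := one_le_inSize F
  have hs : 1 ≤ s := by omega
  have e1 : inSize k F ≤ s * inSize k F ^ 3 :=
    (Nat.le_self_pow (by norm_num) _).trans (Nat.le_mul_of_pos_left _ hs)
  have e2 : inSize k F ^ 2 ≤ s * inSize k F ^ 3 :=
    (Nat.pow_le_pow_right hX (by norm_num)).trans (Nat.le_mul_of_pos_left _ hs)
  have e3 : inSize k F ^ 3 ≤ s * inSize k F ^ 3 := Nat.le_mul_of_pos_left _ hs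
  have e4 : s * inSize k F ≤ s * inSize k F ^ 3 :=
    Nat.mul_le_mul_left _ (Nat.le_self_pow (by norm_num) _)
  have step : ∀ {a b : ℕ}, b ≤ s * inSize k F ^ 3 →
      opCost β * (a * b) ≤ opCost β * (a * (s * inSize k F ^ 3)) := fun h =>
    Nat.mul_le_mul_left _ (Nat.mul_le_mul_left _ h)
  refine Wp.time_le (Wp.seq (fill_wp hβ hI.inv h10 hΨ) (t' := opCost β * (22 * inSize k F ^ 3) +
    (opCost β * (12 * (s * inSize k F)) + (opCost β * (14 * inSize k F ^ 2) +
    opCost β * (8 * inSize k F)))) ?_ |>.mono le_rfl (fun _ => id) (fun _ _ => le_rfl) (hΨ0 _))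
    ((add_time' (step e1) (add_time' (step e3) (add_time' (step e4) (add_time' (step e2)
    (step e1))))).trans (le_of_eq (by ring)))
  rintro m₁ ⟨g1, g2⟩
  refine Wp.seq (Wp.mono (walk_wp hk hF hβ g1 z A hz hA) le_rfl (fun _ => id)
    (fun _ _ => le_rfl) (hΨn _)) ?_
  rintro m₂ ⟨h1, h2⟩
  have S := g2.trans h2
  have h5 : m₂.reg 5 = c := (S.1 5 (by omega)).trans hI.r5
  refine Wp.spec_seq (minDist_wp hβ h1 hs (by omega)) ?_
  rintro m₃ ⟨i1, i2, i3⟩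
  refine Wp.spec_seq (Wp.time_le (findUnsat_wp hF hβ i1) (findUnsat_time F _)) ?_
  rintro m₄ ⟨j1, j2, j3⟩
  have a3 : m₃.asg n = m₂.asg n := i2.asg
  have a4 : m₄.asg n = m₂.asg n := j2.asg.trans a3
  have s4 : Same 11 m₂ m₄ := i2.trans (j2.mono (by omega))
  have r11 : m₄.reg 11 = m₃.reg 11 := j2.1 11 (by omega)
  have r7 : m₄.reg 7 = m.reg 7 := (s4.1 7 (by omega)).trans (S.1 7 (by omega))
  have r5 : m₄.reg 5 = c := (s4.1 5 (by omega)).trans h5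
  have rw4 : ∀ i, m₄.row n i = m.row n i := fun i => s4.row.trans S.row
  have hsat : m₄.reg 12 = 0 → Satisfies (m₂.asg n) F := by
    rintro h0
    rcases j3 with h | h
    · rw [← a3]; exact h.2
    · exact absurd h0 h.1
  have hmin : ∀ θ, θ ≤ m₄.reg 11 ↔ θ ≤ n + 1 ∧ ∀ i < c, θ ≤ hammingDist (m.row n i) (m₂.asg n) := by
    intro θ
    rw [r11, i3, h5]
    simp only [S.row]
  refine Wp.mono (Wp.of_spec (v := if A (m₂.asg n) ∧ Satisfies (m₂.asg n) F then 1 else 0)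
    (g := fun m' => if θ ≤ m'.reg 7 then (1 : ℝ) else 0) (accept_wp hβ j1) ?_) le_rfl ?_
    (fun _ _ => le_rfl) le_rfl
  · rintro m₅ ⟨k1, k2, k3⟩
    by_cases hAS : A (m₂.asg n) ∧ Satisfies (m₂.asg n) F
    · have h0 : m₄.reg 12 = 0 := by
        rcases j3 with h | ⟨-, C, hC, hCf⟩
        · exact h.1
        · obtain ⟨l, hl, hl'⟩ := hAS.2 C (List.mem_of_getElem? hC)
          exact absurd hl' (by rw [← a3]; exact hCf l hl)
      have hθ' : θ ≤ m₄.reg 11 := (hmin θ).2 ⟨hθ, hAθ _ hAS.1 hAS.2⟩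
      rw [if_pos hAS, if_pos]
      rcases k3 with k3 | k3
      · omega
      · rcases k3.1 with h | h <;> omega
    · rw [if_neg hAS]
      split_ifs
      · exact zero_le_one
      · exact le_rfl
  · rintro m₅ ⟨k1, k2, k3⟩
    have q4 : m₅.reg 4 = m₀.reg 4 := (k2 4 (by omega)).trans ((s4.1 4 (by omega)).trans
      ((S.1 4 (by omega)).trans hI.r4))
    have q5 : m₅.reg 5 = c := (k2 5 (by omega)).trans r5
    have q6 : m₅.reg 6 = m.reg 6 := (k2 6 (by omega)).trans ((s4.1 6 (by omega)).trans
      (S.1 6 (by omega)))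
    rw [r5, r7] at k3
    rcases k3 with ⟨b1, b2, b3, b4, b5⟩ | ⟨b1, b2, b3⟩
    · refine ⟨⟨k1, q4, q5, fun i hi => (b5 i hi).trans ((rw4 i).trans (hI.rows i hi)),
        fun _ => ⟨?_, fun i hi => ?_⟩⟩, q6, by omega⟩
      · rw [b4, a4]; exact hsat b1
      · rw [b3, b4, a4, b5 i hi, rw4]
        exact ((hmin _).1 le_rfl).2 i hi
    · have hrow : ∀ i, m₅.row n i = m.row n i := fun i => by
        rw [← rw4]; unfold Mem.row; rw [b3]
      refine ⟨⟨k1, q4, q5, fun i hi => (hrow i).trans (hI.rows i hi), ?_⟩, q6, by omega⟩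
      simp only [hrow, b2]
      exact hI.best

theorem RoundInv.setReg {c : ℕ} {m₀ : Mem} (h : RoundInv k F s β c m₀ m) {x v : ℕ} (hx : 6 ≤ x)
    (hx' : x ≠ 7) (hv : v < 2 ^ β) : RoundInv k F s β c m₀ (m.setReg x v) := by
  obtain ⟨h1, h2, h3, h4, h5⟩ := h
  refine ⟨h1.setReg (by omega) hv, ?_, ?_, h4, ?_⟩
  · rw [Mem.setReg_reg, if_neg (by omega), h2]
  · rw [Mem.setReg_reg, if_neg (by omega), h3]
  · rw [Mem.setReg_reg, if_neg (by omega)]; exact h5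

theorem trial_wp (hk : 1 ≤ k) (hF : IsKCNF k F) (hβ : Fits n k s β F) {c θ : ℕ} {m₀ : Mem}
    (hI : RoundInv k F s β c m₀ m) (hc : c < s) (hθ : θ ≤ n + 1) {q : ℝ}
    (hq : ∃ idx ≤ c, ∃ i ≤ n, ∃ j ≤ n, Reachable k F (m.row n) c θ (m.row n idx) i j q) :
    Wp trial (opCost β * (65 * (s * inSize k F ^ 3))) m
      (fun m' => RoundInv k F s β c m₀ m' ∧ m'.reg 6 = m.reg 6 ∧ m.reg 7 ≤ m'.reg 7)
      (fun m' => if θ ≤ m'.reg 7 then 1 else 0) (q / (n + 1) / (n + 1) / (c + 1)) := by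
  have hβ1 := hβ.pos
  have hfit := hβ
  unfold Fits at hfit
  have hX : 1 ≤ inSize k F := one_le_inSize F
  have hZ : 1 ≤ s * inSize k F ^ 3 :=
    Nat.one_le_iff_ne_zero.2 (mul_ne_zero (by omega) (by positivity))
  obtain ⟨idx, hidx, i, hi, j, hj, hq⟩ := hq
  refine Wp.time_le (t := opCost β + (opCost β + (opCost β +
    opCost β * (62 * (s * inSize k F ^ 3))))) ?_ ((add_time' (op_time' _ hZ) (add_time'
    (op_time' _ hZ) (add_time' (op_time' _ hZ) le_rfl))).trans (le_of_eq (by ring)))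
  refine Wp.draw_single_seq hI.inv.bd hβ1 (by decide) (N := c + 1) (by simp [hI.r5])
    (y₀ := idx) (by omega) (w := q / (n + 1) / (n + 1)) ?_ (le_of_eq (by push_cast; rfl))
  intro x hx
  have h1 := hI.setReg (x := 8) (v := x) (by omega) (by omega) (by omega)
  refine Wp.draw_single_seq h1.inv.bd hβ1 (by decide) (N := n + 1) (by simp [hI.inv.r0])
    (y₀ := i) (by omega) (w := if x = idx then q / (n + 1) else 0) ?_
    (le_of_eq (by split_ifs <;> push_cast <;> simp))
  intro y hy
  have h2 := h1.setReg (x := 9) (v := y) (by omega) (by omega) (by omega)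
  refine Wp.draw_single_seq h2.inv.bd hβ1 (by decide) (N := n + 1) (by simp [hI.inv.r0])
    (y₀ := j) (by omega) (w := if x = idx ∧ y = i then q else 0) ?_
    (le_of_eq (by split_ifs <;> first | (push_cast; simp; done) | tauto))
  intro u hu
  have h3 := h2.setReg (x := 10) (v := u) (by omega) (by omega) (by omega)
  refine Wp.mono (search_wp hk hF hβ h3 hc hθ (by simp; omega)
    (q := if x = idx ∧ y = i ∧ u = j then q else 0) ?_) le_rfl
    ?_ (fun _ _ => le_rfl) (le_of_eq (by split_ifs <;> first | rfl | tauto))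
  · split_ifs with h
    · obtain ⟨rfl, rfl, rfl⟩ := h
      simp only [Mem.setReg_reg]
      norm_num only [if_true, if_false]
      exact hq
    · exact Reachable.trivial _ _ _ _ _ _ _ _
  · rintro m' ⟨a1, a2, a3⟩
    exact ⟨a1, by simpa using a2, by simpa using a3⟩

/-- Register `7` never decreases after its reset, so one good trial out of `T` suffices. Good
parameters are required for every intermediate memory because row `c` changes between trials and may
itself be the base row. -/
theorem round_wp (hk : 1 ≤ k) (hF : IsKCNF k F) (hβ : Fits n k s β F) {c θ T : ℕ}
    (hI : Inv k F s β m) (h4 : m.reg 4 = T) (h5 : m.reg 5 = c) (hT : 1 ≤ T)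
    (hc : c < s) (hθ : θ ≤ n + 1) {q : ℝ} (hq0 : 0 ≤ q)
    (hq1 : q / (n + 1) / (n + 1) / (c + 1) ≤ 1)
    (hq : ∀ m', RoundInv k F s β c m m' →
      ∃ idx ≤ c, ∃ i ≤ n, ∃ j ≤ n, Reachable k F (m'.row n) c θ (m'.row n idx) i j q) :
    Wp round (opCost β * (70 * (T * (s * inSize k F ^ 3)))) m
      (fun m' => RoundInv k F s β c m m') (fun m' => if θ ≤ m'.reg 7 then 1 else 0)
      (1 - (1 - q / (n + 1) / (n + 1) / (c + 1)) ^ T) := by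
  have hβ1 := hβ.pos
  set p := q / (n + 1) / (n + 1) / (c + 1) with hp
  have hp0 : 0 ≤ p := by positivity
  have hX : 1 ≤ inSize k F := one_le_inSize F
  have hZ : 1 ≤ s * inSize k F ^ 3 :=
    Nat.one_le_iff_ne_zero.2 (mul_ne_zero (by omega) (by positivity))
  have hM : 1 ≤ T * (s * inSize k F ^ 3) := Nat.one_le_iff_ne_zero.2 (by positivity)
  have hTβ : T < 2 ^ β := h4 ▸ hI.bd.1 4
  have h1 := hI.setReg (x := 7) (v := 0) (by omega) (by simp)
  refine Wp.time_le (Wp.assign_seq hI.bd hβ1 (by decide)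
    (t := T * (opCost β * (65 * (s * inSize k F ^ 3)) + 2 * opCost β) + 2 * opCost β) ?_)
    ((add_time' (op_time' _ hM) (loop_time' hT hZ le_rfl le_rfl)).trans (le_of_eq (by ring)))
  refine Wp.mono (Wp.forN (N := T) (fun t m' => RoundInv k F s β c m m' ∧ m'.reg 6 = t)
    (fun t m' => if θ ≤ m'.reg 7 then (1 : ℝ) else 1 - (1 - p) ^ (T - t))
    hβ1 h1.bd (by decide) (by decide)
    (fun i _ m' h => ⟨h.1.inv.bd, by simp [h.1.r4, h4], h.2⟩) ?_ le_rfl ?_) le_rfl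
    (fun m' h => h.1) (fun m' _ => le_of_eq (by simp)) ?_
  · refine ⟨⟨h1.setReg (by omega) (by simp), by simp, by simpa using h5, fun _ _ => rfl, by simp⟩,
      by simp⟩
  · rintro t ht m' ⟨g1, g2⟩
    have hR : ∀ m'' : Mem, RoundInv k F s β c m m'' ∧ m''.reg 6 = m'.reg 6 ∧
        m'.reg 7 ≤ m''.reg 7 → m''.reg 6 = t ∧ Bd β m'' ∧
        RoundInv k F s β c m (m''.setReg 6 (t + 1)) ∧ (m''.setReg 6 (t + 1)).reg 6 = t + 1 := by
      rintro m'' ⟨a1, a2, a3⟩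
      exact ⟨by omega, a1.inv.bd, a1.setReg (by omega) (by omega) (by omega), by simp⟩
    have hpow : 0 ≤ (1 - p) ^ (T - (t + 1)) := pow_nonneg (by linarith) _
    have hpow1 : (1 - p) ^ (T - (t + 1)) ≤ 1 := pow_le_one₀ (by linarith) (by linarith)
    have W := trial_wp hk hF hβ g1 hc hθ (hq m' g1)
    by_cases hθm : θ ≤ m'.reg 7
    · refine Wp.mono (Wp.of_spec (g := fun m'' => if θ ≤ m''.reg 7 then (1 : ℝ) else 0)
        (v := 1) W ?_) le_rfl hR ?_ (le_of_eq (by simp [hθm]))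
      · rintro m'' ⟨-, -, a3⟩
        rw [if_pos (hθm.trans a3)]
      · rintro m'' ⟨-, -, a3⟩
        rw [if_pos (hθm.trans a3), Mem.setReg_reg, if_neg (by omega : ¬ 7 = 6),
          if_pos (hθm.trans a3)]
    -- Without success so far, the payoff after this trial is `1` if it succeeds and `a` otherwise;
    -- that is `a + (1 - a)` times the indicator of success.
    · refine Wp.mono (Wp.affine (a := 1 - (1 - p) ^ (T - (t + 1)))
        (b := (1 - p) ^ (T - (t + 1))) W (by linarith) hpow ?_ hp0) le_rfl hR ?_ ?_
      · intro m''; split_ifs <;> norm_num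
      · intro m'' _
        simp only [Mem.setReg_reg]
        norm_num only [if_true, if_false]
        split_ifs <;> linarith
      · rw [if_neg hθm, show T - t = T - (t + 1) + 1 by omega, pow_succ]
        exact le_of_eq (by ring)
  · simp only [Mem.setReg_reg, Mem.eval_const]
    norm_num only [if_true, if_false]
    rw [Nat.sub_zero]
    split_ifs
    · linarith [pow_nonneg (show 0 ≤ 1 - p by linarith) T]
    · exact le_rfl

end

section
variable {n k s : ℕ} {F : CNF n}

/-! ### The two regimes of the search -/

/-- If `w = z`, the index is `n` and the second condition is void. Points that agree with `z` up to
and including an index `i < n` differ from `w`. -/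
theorem exists_first_diff (w z : Fin n → Bool) :
    ∃ i ≤ n, (∀ u : Fin n, (u : ℕ) < i → w u = z u) ∧ ∀ u : Fin n, (u : ℕ) = i → w u ≠ z u := by
  classical
  by_cases h : ∃ i, ∃ hi : i < n, w ⟨i, hi⟩ ≠ z ⟨i, hi⟩
  · obtain ⟨hi, hne⟩ := Nat.find_spec h
    refine ⟨Nat.find h, hi.le, fun u hu => ?_, fun u hu => ?_⟩
    · by_contra hc
      exact Nat.find_min h hu ⟨u.2, hc⟩
    · have : u = ⟨Nat.find h, hi⟩ := Fin.ext hu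
      rw [this]; exact hne
  · push Not at h
    exact ⟨n, le_rfl, fun u _ => h u u.2, fun u hu => absurd u.2 (by omega)⟩

theorem update_agree {P : ℕ → Prop} {y z : Fin n → Bool} {v : Fin n} {b : Bool} :
    (∀ u : Fin n, (u : ℕ) < v + 1 → P u → Function.update y v b u = z u) ↔
      (∀ u : Fin n, (u : ℕ) < v → P u → y u = z u) ∧ (P v → b = z v) := by
  constructor
  · intro h
    refine ⟨fun u hu hP => ?_, fun hP => by simpa using h v (by omega) hP⟩
    have := h u (by omega) hP
    rwa [Function.update_of_ne (by rintro rfl; omega)] at this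
  · rintro ⟨h1, h2⟩ u hu hP
    by_cases huv : u = v
    · subst huv; simpa using h2 hP
    · rw [Function.update_of_ne huv]
      have : (u : ℕ) ≠ v := fun h => huv (Fin.ext h)
      exact h1 u (by omega) hP

/-- The number of disagreements of `y` and `z` before position `v`. -/
def diffBefore (z y : Fin n → Bool) (v : ℕ) : ℕ :=
  (Finset.univ.filter fun u : Fin n => (u : ℕ) < v ∧ y u ≠ z u).card

theorem diffBefore_update (z y : Fin n → Bool) (v : Fin n) (b : Bool) :
    diffBefore z (Function.update y v b) (v + 1) =
      diffBefore z y v + if b = z v then 0 else 1 := by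
  unfold diffBefore
  have h1 : ∀ u : Fin n, (u : ℕ) < v → u ≠ v := by rintro u hu rfl; omega
  split_ifs with h
  · rw [add_zero]
    congr 1
    ext u
    by_cases huv : u = v
    · subst huv; simp [h]
    · have : (u : ℕ) ≠ v := fun h => huv (Fin.ext h)
      simp only [Finset.mem_filter, Finset.mem_univ, true_and, Function.update_of_ne huv]
      rw [show (u : ℕ) < v + 1 ↔ (u : ℕ) < v by omega]
  · rw [← Finset.card_insert_of_notMem (a := v) (by simp)]
    congr 1
    ext u
    by_cases huv : u = v
    · subst huv; simp [h]
    · have : (u : ℕ) ≠ v := fun h => huv (Fin.ext h)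
      simp only [Finset.mem_filter, Finset.mem_univ, true_and, Function.update_of_ne huv,
        Finset.mem_insert, huv, false_or]
      rw [show (u : ℕ) < v + 1 ↔ (u : ℕ) < v by omega]

/-- The probability that a random point has exactly `e` prescribed disagreements weighted with the
success probability of the walk, minus a penalty for large distances. -/
noncomputable def walkBound (n k r e : ℕ) : ℝ :=
  (1 / (k : ℝ)) ^ e * ((1 + 1 / (k : ℝ)) / 2) ^ r *
    (1 - (k : ℝ) / n * (e + r / ((k : ℝ) + 1)))

/-- `walkBound n k r e` is the expectation of `(1/k)^d * (1 - k d / n)`, where `d` is `e` plus the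
number of disagreements among `r` fair bits: under the weight `(1/k)^d` a bit disagrees with
probability `1/(k+1)`. Conditioning on one bit gives the identity. -/
theorem walkBound_succ (hn : 1 ≤ n) (hk : 1 ≤ k) (r e : ℕ) :
    2 * walkBound n k (r + 1) e = walkBound n k r e + walkBound n k r (e + 1) := by
  have hn' : (0 : ℝ) < n := by exact_mod_cast hn
  have hk' : (0 : ℝ) < k := by exact_mod_cast hk
  unfold walkBound
  rw [pow_succ, pow_succ]
  push_cast
  generalize (1 / (k : ℝ)) ^ e = a
  generalize ((1 + 1 / (k : ℝ)) / 2) ^ r = b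
  field_simp
  ring

/-- Forcing a bit to agree with `z` is no worse than drawing it at random, so the fixed prefix costs
nothing. -/
theorem walkBound_zero_succ_le (hn : 1 ≤ n) (hk : 1 ≤ k) {r : ℕ} (hr : r + 1 ≤ n) :
    walkBound n k (r + 1) 0 ≤ walkBound n k r 0 := by
  have hn' : (0 : ℝ) < n := by exact_mod_cast hn
  have hk' : (1 : ℝ) ≤ k := by exact_mod_cast hk
  have hr' : (r : ℝ) + 1 ≤ n := by exact_mod_cast hr
  have h1 : (1 + 1 / (k : ℝ)) / 2 ≤ 1 := by
    have : 1 / (k : ℝ) ≤ 1 := by rw [div_le_one (by linarith)]; exact hk'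
    linarith
  have h2 : (k : ℝ) / n * (0 + ((r + 1 : ℕ) : ℝ) / (k + 1)) ≤ 1 := by
    push_cast
    rw [zero_add, div_mul_div_comm, div_le_one (by positivity)]
    nlinarith
  have h3 : (k : ℝ) / n * (0 + (r : ℝ) / (k + 1)) ≤
      (k : ℝ) / n * (0 + ((r + 1 : ℕ) : ℝ) / (k + 1)) := by
    gcongr; simp
  unfold walkBound
  simp only [pow_zero, one_mul, Nat.cast_zero]
  rw [pow_succ]
  have h4 : 0 ≤ ((1 + 1 / (k : ℝ)) / 2) ^ r := by positivity
  apply mul_le_mul _ (by linarith) (by linarith) h4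
  exact mul_le_of_le_one_right h4 h1

-- The parameter `n` makes the bits after position `i` fair. The penalty implements Markov's
-- inequality: `1 - k d / n` is at most the indicator of `k d ≤ n`, and with all `n` bits open it
-- averages to `1 - k/(k+1) = 1/(k+1)`. Moves towards `z` preserve both the prefix and the distance
-- bound.
open Classical in
theorem reachable_walk (hn : 1 ≤ n) (hk : 1 ≤ k) (rows : ℕ → Fin n → Bool) (c θ : ℕ)
    {w z : Fin n → Bool} {i : ℕ} (hz : Satisfies z F)
    (hi : ∀ u : Fin n, (u : ℕ) < i → w u = z u) (hi' : ∀ u : Fin n, (u : ℕ) = i → w u ≠ z u)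
    (h : ∀ y, (∀ u : Fin n, (u : ℕ) ≤ i → y u = z u) → k * hammingDist y z ≤ n →
      Satisfies y F → ∀ i' < c, θ ≤ hammingDist (rows i') y) :
    Reachable k F rows c θ w i n (((1 + 1 / (k : ℝ)) / 2) ^ n / (k + 1)) := by
  have hn' : (0 : ℝ) < n := by exact_mod_cast hn
  have hk' : (0 : ℝ) < k := by exact_mod_cast hk
  refine ⟨z, fun y => (∀ u : Fin n, (u : ℕ) ≤ i → y u = z u) ∧ k * hammingDist y z ≤ n,
    fun v y => if ∀ u : Fin n, (u : ℕ) < v → (u : ℕ) ≤ i → y u = z u then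
      walkBound n k (n - v) (diffBefore z y v) else 0, fun _ _ => hz, ?_, fun y hy => h y hy.1 hy.2,
    ?_, ?_, ?_⟩
  · rintro y v ⟨h1, h2⟩ hne
    refine ⟨fun u hu => ?_, ?_⟩
    · by_cases huv : u = v
      · subst huv; simp
      · rw [Function.update_of_ne huv]; exact h1 u hu
    · have := hammingDist_update hne
      exact (Nat.mul_le_mul_left k (by omega)).trans h2
  · intro v y
    dsimp only
    simp only [update_agree (P := fun u => u ≤ i), diffBefore_update]
    by_cases hag : ∀ u : Fin n, (u : ℕ) < v → (u : ℕ) ≤ i → y u = z u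
    swap
    · rw [if_neg hag, if_neg fun h => hag h.1, if_neg fun h => hag h.1]; simp
    rw [if_pos hag]
    simp only [and_iff_right hag]
    have hr : n - (v : ℕ) = n - (v + 1) + 1 := by omega
    have hd : (v : ℕ) ≤ i → diffBefore z y v = 0 := by
      intro hv
      rw [diffBefore, Finset.card_eq_zero, Finset.filter_eq_empty_iff]
      rintro u - ⟨h1, h2⟩
      exact h2 (hag u h1 (by omega))
    rw [hr]
    unfold flipWeight
    rcases lt_trichotomy (v : ℕ) i with hv | hv | hv
    · rw [if_pos hv, hd hv.le, if_pos (fun _ => hi v hv), if_pos (hi v hv)]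
      have := walkBound_zero_succ_le hn hk (r := n - (v + 1)) (by omega)
      simp only [Nat.cast_zero, zero_mul, sub_zero, zero_add]
      gcongr
    · have hw := hi' v hv
      have hw' : (!w v) = z v := by
        cases hwv : w v <;> cases hzv : z v <;> simp_all
      rw [if_neg (by omega), if_pos hv, hd hv.le, if_pos (fun _ => hw'), if_pos hw']
      have := walkBound_zero_succ_le hn hk (r := n - (v + 1)) (by omega)
      push_cast
      rw [sub_self, zero_mul, add_zero]
      gcongr
    · have hvi : ¬ (v : ℕ) ≤ i := by omega
      rw [if_neg (by omega : ¬ (v : ℕ) < i), if_neg (by omega : ¬ (v : ℕ) = i),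
        if_pos (fun h => absurd h hvi : (v : ℕ) ≤ i → (!w v) = z v),
        if_pos (fun h => absurd h hvi : (v : ℕ) ≤ i → w v = z v)]
      have := walkBound_succ hn hk (n - (v + 1)) (diffBefore z y v)
      by_cases hw : w v = z v
      · have hw' : ¬ (!w v) = z v := by rw [← hw]; simp
        rw [if_pos hw, if_neg hw', add_zero]
        have e : 2 * (n : ℝ) * walkBound n k (n - (v + 1) + 1) (diffBefore z y v) =
          n * (2 * walkBound n k (n - (v + 1) + 1) (diffBefore z y v)) := by ring
        rw [e, this]
        exact le_of_eq (by ring)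
      · have hw' : (!w v) = z v := by
          cases hwv : w v <;> cases hzv : z v <;> simp_all
        rw [if_neg hw, if_pos hw', add_zero]
        have e : 2 * (n : ℝ) * walkBound n k (n - (v + 1) + 1) (diffBefore z y v) =
          n * (2 * walkBound n k (n - (v + 1) + 1) (diffBefore z y v)) := by ring
        rw [e, this]
        exact le_of_eq (by ring)
  · intro y
    have hd : diffBefore z y n = hammingDist y z := by
      simp [diffBefore, hammingDist]
    simp only [Fin.is_lt, true_implies, Nat.sub_self, hd]
    by_cases hag : ∀ u : Fin n, (u : ℕ) ≤ i → y u = z u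
    swap
    · rw [if_neg hag, if_neg fun h => hag h.1]
    rw [if_pos hag]
    simp only [and_iff_right hag]
    unfold walkBound pot
    have h0 : 0 ≤ (1 / (k : ℝ)) ^ hammingDist y z := by positivity
    have e : (k : ℝ) / n * hammingDist y z = (k * hammingDist y z : ℕ) / n := by
      push_cast; ring
    simp only [pow_zero, mul_one, Nat.cast_zero, zero_div, add_zero, e]
    split_ifs with hle
    · refine mul_le_of_le_one_right h0 ?_
      have : (0 : ℝ) ≤ (k * hammingDist y z : ℕ) / n := by positivity
      linarith
    · refine mul_nonpos_of_nonneg_of_nonpos h0 ?_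
      have : (1 : ℝ) ≤ (k * hammingDist y z : ℕ) / n := by
        rw [one_le_div hn']; exact_mod_cast (by omega)
      linarith
  · intro y
    have hd : diffBefore z y 0 = 0 := by simp [diffBefore]
    simp only [Nat.not_lt_zero, false_implies, implies_true, if_true, hd, Nat.sub_zero]
    unfold walkBound
    apply le_of_eq
    simp only [pow_zero, one_mul, Nat.cast_zero, zero_add]
    field_simp
    ring

-- Here the filling itself must produce `z`, so `A` is `{z}`, where the potential is `1`. The
-- parameter `2 D` gives the flip rate `D/n`, and `P v` is the probability that the positions from
-- `v` on come out right at this rate; positions where the outcome is forced only help.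
open Classical in
theorem reachable_ball (hn : 1 ≤ n) (rows : ℕ → Fin n → Bool) (c θ : ℕ)
    {w z : Fin n → Bool} {i : ℕ} (hz : Satisfies z F)
    (hi : ∀ u : Fin n, (u : ℕ) < i → w u = z u) (hi' : ∀ u : Fin n, (u : ℕ) = i → w u ≠ z u)
    (h : ∀ i' < c, θ ≤ hammingDist (rows i') z) :
    Reachable k F rows c θ w i (2 * hammingDist w z)
      (((hammingDist w z : ℝ) / n) ^ hammingDist w z *
        (1 - (hammingDist w z : ℝ) / n) ^ (n - hammingDist w z)) := by
  have hn' : (0 : ℝ) < n := by exact_mod_cast hn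
  set D := hammingDist w z with hD
  have hDn : D ≤ n := by simpa using hammingDist_le_card_fintype (x := w) (y := z)
  have hDn' : (D : ℝ) ≤ n := by exact_mod_cast hDn
  set r : Fin n → ℝ := fun u => if w u ≠ z u then (D : ℝ) / n else 1 - (D : ℝ) / n with hr
  have hd1 : (D : ℝ) / n ≤ 1 := by rw [div_le_one hn']; exact hDn'
  have hd0 : 0 ≤ (D : ℝ) / n := by positivity
  have hr0 : ∀ u, 0 ≤ r u := by intro u; simp only [hr]; split_ifs <;> linarith
  have hr1 : ∀ u, r u ≤ 1 := by intro u; simp only [hr]; split_ifs <;> linarith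
  set P : ℕ → ℝ := fun v => ∏ u ∈ Finset.univ.filter (fun u : Fin n => v ≤ (u : ℕ)), r u with hP
  have hP0 : ∀ v, 0 ≤ P v := fun v => Finset.prod_nonneg fun u _ => hr0 u
  have hPs : ∀ v : Fin n, P v = r v * P (v + 1) := by
    intro v
    simp only [hP]
    rw [← Finset.prod_insert (by simp)]
    congr 1
    ext u
    simp only [Finset.mem_filter, Finset.mem_univ, true_and, Finset.mem_insert, Fin.ext_iff]
    omega
  refine ⟨z, fun y => y = z,
    fun v y => if ∀ u : Fin n, (u : ℕ) < v → True → y u = z u then P v else 0,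
    fun _ _ => hz, ?_, ?_, ?_, ?_, ?_⟩
  · rintro y v rfl hne; exact absurd rfl hne
  · rintro y rfl -; exact h
  · intro v y
    dsimp only
    simp only [update_agree (P := fun _ => True)]
    by_cases hag : ∀ u : Fin n, (u : ℕ) < v → True → y u = z u
    swap
    · rw [if_neg hag, if_neg fun h => hag h.1, if_neg fun h => hag h.1]; simp
    rw [if_pos hag]
    simp only [and_iff_right hag]
    simp only [true_implies]
    have hp := hP0 (v + 1)
    have hle : P v ≤ P (v + 1) := by
      rw [hPs]; exact mul_le_of_le_one_left hp (hr1 v)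
    unfold flipWeight
    rcases lt_trichotomy (v : ℕ) i with hv | hv | hv
    · rw [if_pos hv, if_pos (hi v hv)]
      simp only [Nat.cast_zero, zero_mul, sub_zero, zero_add]
      gcongr
    · have hw := hi' v hv
      have hw' : (!w v) = z v := by
        cases hwv : w v <;> cases hzv : z v <;> simp_all
      rw [if_neg (by omega), if_pos hv, if_pos hw']
      push_cast
      rw [sub_self, zero_mul, add_zero]
      gcongr
    · rw [if_neg (by omega), if_neg (by omega), hPs]
      push_cast
      by_cases hw : w v = z v
      · have hw' : ¬ (!w v) = z v := by rw [← hw]; simp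
        rw [if_pos hw, if_neg hw', show r v = 1 - (D : ℝ) / n by simp [hr, hw]]
        apply le_of_eq; field_simp; ring
      · have hw' : (!w v) = z v := by
          cases hwv : w v <;> cases hzv : z v <;> simp_all
        rw [if_neg hw, if_pos hw', show r v = (D : ℝ) / n by simp [hr, hw]]
        apply le_of_eq; field_simp; ring
  · intro y
    have hPn : P n = 1 := by
      simp only [hP]
      rw [Finset.filter_false_of_mem (fun u _ => by have := u.2; omega), Finset.prod_empty]
    simp only [Fin.is_lt, true_implies, hPn]
    split_ifs with h1 h2 h2
    · subst h2; simp [pot]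
    · exact absurd (funext h1) h2
    · exact pot_nonneg _ _
    · exact le_rfl
  · intro y
    simp only [Nat.not_lt_zero, false_implies, implies_true, if_true]
    apply le_of_eq
    simp only [hP, hr]
    simp only [Nat.zero_le, Finset.filter_true, Finset.prod_ite, Finset.prod_const]
    congr 2
    have := Finset.card_filter_add_card_filter_not (s := (Finset.univ : Finset (Fin n)))
      (fun u => w u ≠ z u)
    rw [Finset.card_univ, Fintype.card_fin] at this
    unfold hammingDist at hD
    omega

end

/-! ### The approximation ratio and good parameters for a trial -/

section
variable {n k s : ℕ} {F : CNF n}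

/-- The approximation ratio. -/
noncomputable def ratio (k : ℕ) : ℝ :=
  1 / 2 * (1 - 1 / ((k : ℝ) * binHInv (1 - 1 / (k : ℝ))))

/-- The distance guaranteed for the computed solutions. -/
noncomputable def target {n : ℕ} (k : ℕ) (F : CNF n) (s : ℕ) : ℕ :=
  max 1 ⌈ratio k * optMin F s⌉₊

/-- A lower bound for the success probability of a trial with the right parameters. -/
noncomputable def succProb (n k : ℕ) : ℝ := (2 : ℝ) ^ ((n : ℝ) / k - n) / (k + 1)

theorem binHInv_spec (hk : 2 ≤ k) : 0 < binHInv (1 - 1 / (k : ℝ)) ∧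
    binHInv (1 - 1 / (k : ℝ)) ≤ 1 / 2 ∧ binH (binHInv (1 - 1 / (k : ℝ))) = 1 - 1 / (k : ℝ) := by
  have hk' : (2 : ℝ) ≤ k := by exact_mod_cast hk
  have h1 : 1 / (k : ℝ) ≤ 1 / 2 := one_div_le_one_div_of_le (by norm_num) hk'
  have h2 : 0 ≤ 1 / (k : ℝ) := by positivity
  obtain ⟨⟨h3, h4⟩, h5⟩ :=
    (binHInv_eq_iff (y := 1 - 1 / (k : ℝ)) ⟨by linarith, by linarith⟩ _).1 rfl
  refine ⟨lt_of_le_of_ne h3 fun h => ?_, h4, h5⟩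
  rw [← h] at h5
  simp only [binH, Real.binEntropy_zero, zero_div] at h5
  linarith

theorem ratio_le (hk : 2 ≤ k) : ratio k ≤ 1 / 2 := by
  have := (binHInv_spec hk).1
  have h : 0 ≤ 1 / ((k : ℝ) * binHInv (1 - 1 / (k : ℝ))) := by positivity
  unfold ratio
  linarith

/-- Bernoulli's inequality `(1 + 1)^(1/k) ≤ 1 + 1/k`, raised to the power `n`. -/
theorem succProb_le_walk (hk : 1 ≤ k) :
    succProb n k ≤ ((1 + 1 / (k : ℝ)) / 2) ^ n / (k + 1) := by
  have hk' : (1 : ℝ) ≤ k := by exact_mod_cast hk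
  unfold succProb
  refine div_le_div_of_nonneg_right ?_ (by positivity)
  have h1 : (2 : ℝ) ^ (1 / (k : ℝ)) ≤ 1 + 1 / (k : ℝ) := by
    have := rpow_one_add_le_one_add_mul_self (s := 1) (by norm_num) (p := 1 / (k : ℝ))
      (by positivity) (by rw [div_le_one (by linarith)]; exact hk')
    norm_num at this ⊢
    exact this
  rw [Real.rpow_sub (by norm_num), div_pow, Real.rpow_natCast]
  gcongr
  rw [show (n : ℝ) / k = 1 / k * n by ring, Real.rpow_mul (by norm_num), Real.rpow_natCast]
  gcongr

/-- With `p = D/n` the right-hand side is `2^(-n H(p))`, and the entropy is increasing on `[0,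
1/2]`. -/
theorem succProb_le_ball (hk : 2 ≤ k) {D : ℕ} (hD : 0 < D)
    (hDn : (D : ℝ) ≤ binHInv (1 - 1 / (k : ℝ)) * n) :
    succProb n k ≤ ((D : ℝ) / n) ^ D * (1 - (D : ℝ) / n) ^ (n - D) := by
  obtain ⟨h0, h1, h2⟩ := binHInv_spec hk
  have hD' : (0 : ℝ) < D := by exact_mod_cast hD
  have hn : (0 : ℝ) < n := by
    rcases Nat.eq_zero_or_pos n with h | h
    · subst h; simp at hDn; omega
    · exact_mod_cast h
  have hk' : (0 : ℝ) < k := by exact_mod_cast (by omega : 0 < k)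
  set p := (D : ℝ) / n with hp
  have hp0 : 0 < p := by positivity
  have hpn : p ≤ binHInv (1 - 1 / (k : ℝ)) := by rw [hp, div_le_iff₀ hn]; exact hDn
  have hp1 : 0 < 1 - p := by linarith
  have hDle : D ≤ n := by
    have : (D : ℝ) ≤ n := by nlinarith
    exact_mod_cast this
  have hl : 0 < Real.log 2 := Real.log_pos one_lt_two
  have hent : Real.binEntropy p ≤ (1 - 1 / (k : ℝ)) * Real.log 2 := by
    have := Real.binEntropy_strictMonoOn.monotoneOn (a := p)
      (b := binHInv (1 - 1 / (k : ℝ))) ⟨hp0.le, by rw [← one_div]; linarith⟩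
      ⟨h0.le, by rw [← one_div]; exact h1⟩ hpn
    rw [binH, div_eq_iff hl.ne'] at h2
    rwa [h2] at this
  calc succProb n k ≤ (2 : ℝ) ^ ((n : ℝ) / k - n) := by
        unfold succProb
        exact div_le_self (by positivity) (by linarith)
    _ = Real.exp (-(n * ((1 - 1 / (k : ℝ)) * Real.log 2))) := by
        rw [Real.rpow_def_of_pos (by norm_num)]
        congr 1
        field_simp
        ring
    _ ≤ Real.exp (-(n * Real.binEntropy p)) := by gcongr
    _ = Real.exp (D * Real.log p + (n - D : ℕ) * Real.log (1 - p)) := by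
        congr 1
        rw [Real.binEntropy, Real.log_inv, Real.log_inv, Nat.cast_sub hDle]
        have : (D : ℝ) = n * p := by rw [hp]; field_simp
        rw [this]; ring
    _ = p ^ D * (1 - p) ^ (n - D) := by
        rw [Real.exp_add, Real.exp_nat_mul, Real.exp_nat_mul, Real.exp_log hp0, Real.exp_log hp1]

theorem mem_solutions {z : Fin n → Bool} : z ∈ solutions F ↔ Satisfies z F := by
  simp [solutions]

/-- If every point of an optimal set were at distance less than half the optimum from some row, two
points would share a row and be too close to each other. -/
theorem exists_far_solution (hs : 2 ≤ s) (hF : s ≤ (solutions F).card) {c : ℕ} (hc : c < s)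
    (rows : ℕ → Fin n → Bool) : 1 ≤ optMin F s ∧
    ∃ z, Satisfies z F ∧ ∀ i < c, optMin F s ≤ 2 * hammingDist (rows i) z := by
  obtain ⟨O, hO, hOr⟩ := Finset.exists_mem_eq_sup _ (Finset.powersetCard_nonempty.2 hF)
    (minPD (n := n))
  rw [Finset.mem_powersetCard] at hO
  have hr : optMin F s = minPD O := hOr
  have hpd : ∀ a ∈ O, ∀ b ∈ O, a ≠ b → minPD O ≤ hammingDist a b := fun a ha b hb hab =>
    Nat.sInf_le ⟨a, ha, b, hb, hab, rfl⟩
  refine ⟨?_, ?_⟩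
  · obtain ⟨a, ha, b, hb, hab⟩ := Finset.one_lt_card.1 (by omega : 1 < O.card)
    obtain ⟨a', -, b', -, hab', h⟩ := Nat.sInf_mem
      (⟨_, a, ha, b, hb, hab, rfl⟩ :
        {d : ℕ | ∃ z ∈ O, ∃ w ∈ O, z ≠ w ∧ hammingDist z w = d}.Nonempty)
    rw [hr, minPD, ← h]
    exact hammingDist_pos.2 hab'
  · by_contra hcon
    push Not at hcon
    have H : ∀ z, ∃ i, z ∈ O → i < c ∧ 2 * hammingDist (rows i) z < optMin F s := by
      intro z
      by_cases hz : z ∈ O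
      · obtain ⟨i, hi, h⟩ := hcon z (mem_solutions.1 (hO.1 hz))
        exact ⟨i, fun _ => ⟨hi, h⟩⟩
      · exact ⟨0, fun h => absurd h hz⟩
    choose f hf using H
    obtain ⟨a, ha, b, hb, hab, hfab⟩ := Finset.exists_ne_map_eq_of_card_lt_of_maps_to
      (s := O) (t := Finset.range c) (f := f) (by rw [Finset.card_range]; omega)
      (fun a ha => Finset.mem_coe.2 (Finset.mem_range.2 (hf a ha).1))
    have h1 := (hf a ha).2
    have h2 := (hf b hb).2
    rw [← hfab] at h2
    have h3 := hammingDist_triangle a (rows (f a)) b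
    rw [hammingDist_comm a (rows (f a))] at h3
    have h4 := hpd a ha b hb hab
    omega

theorem Reachable.mono {rows : ℕ → Fin n → Bool} {c θ : ℕ} {w : Fin n → Bool} {i j : ℕ}
    {q q' : ℝ} (h : Reachable k F rows c θ w i j q) (hq : q' ≤ q) :
    Reachable k F rows c θ w i j q' := by
  obtain ⟨z, A, Ψ, h1, h2, h3, h4, h5, h6⟩ := h
  exact ⟨z, A, Ψ, h1, h2, h3, h4, h5, fun y => hq.trans (h6 y)⟩

/-- The dichotomy is whether some row lies within `H n` of the far solution `z`: then `z` is sampled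
directly, and otherwise a solution near `z` is good enough. -/
theorem exists_reachable (hn : 1 ≤ n) (hk : 2 ≤ k) (hF : s ≤ (solutions F).card) {c : ℕ}
    (hc : c < s) (rows : ℕ → Fin n → Bool) :
    ∃ idx ≤ c, ∃ i ≤ n, ∃ j ≤ n,
      Reachable k F rows c (target k F s) (rows idx) i j (succProb n k) := by
  rcases Nat.eq_zero_or_pos c with rfl | hc0
  · obtain ⟨z, hz⟩ := Finset.card_pos.1 (by omega : 0 < (solutions F).card)
    obtain ⟨i, hin, hi, hi'⟩ := exists_first_diff (rows 0) z
    exact ⟨0, le_rfl, i, hin, n, le_rfl, (reachable_walk hn (by omega) rows 0 _ (mem_solutions.1 hz)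
      hi hi' (by simp)).mono (succProb_le_walk (by omega))⟩
  obtain ⟨hr1, z, hz, hfar⟩ := exists_far_solution (by omega) hF hc rows
  have hdist : ∀ i < c, 1 ≤ hammingDist (rows i) z := fun i hi => by have := hfar i hi; omega
  have hn' : (0 : ℝ) < n := by exact_mod_cast hn
  have hk' : (0 : ℝ) < k := by exact_mod_cast (by omega : 0 < k)
  obtain ⟨h0, h1, h2⟩ := binHInv_spec hk
  have hratio := ratio_le hk
  set H := binHInv (1 - 1 / (k : ℝ)) with hH
  have hr : (0 : ℝ) ≤ optMin F s := by positivity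
  by_cases hclose : ∃ idx < c, (hammingDist (rows idx) z : ℝ) ≤ H * n
  · obtain ⟨idx, hidx, hD⟩ := hclose
    obtain ⟨i, hin, hi, hi'⟩ := exists_first_diff (rows idx) z
    refine ⟨idx, hidx.le, i, hin, 2 * hammingDist (rows idx) z, ?_,
      (reachable_ball hn rows c _ hz hi hi' fun i' hi' => ?_).mono
        (succProb_le_ball hk (hdist idx hidx) hD)⟩
    -- The parameter is in range because `H ≤ 1/2`.
    · have : 2 * (hammingDist (rows idx) z : ℝ) ≤ n := by nlinarith
      exact_mod_cast this
    · refine max_le (hdist i' hi') (Nat.ceil_le.2 ?_)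
      have : (optMin F s : ℝ) ≤ 2 * hammingDist (rows i') z := by exact_mod_cast hfar i' hi'
      nlinarith
  push Not at hclose
  choose fd hfdn hfd hfd' using fun i => exists_first_diff (rows i) z
  -- The row that follows `z` longest: the prefix fixed for it contains the first disagreement of
  -- every other row with `z`.
  obtain ⟨idx, hidx, hmax⟩ := Finset.exists_max_image (Finset.range c) fd
    ⟨0, Finset.mem_range.2 hc0⟩
  rw [Finset.mem_range] at hidx
  refine ⟨idx, hidx.le, fd idx, hfdn idx, n, le_rfl, (reachable_walk hn (by omega) rows c _ hz
    (hfd idx) (hfd' idx) ?_).mono (succProb_le_walk (by omega))⟩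
  intro y hag hyd hys i hi
  refine max_le ?_ (Nat.ceil_le.2 ?_)
  · refine hammingDist_pos.2 fun hy => ?_
    have hlt : fd i < n := by
      by_contra hge
      have : rows i = z := funext fun u => hfd i u (by have := u.2; omega)
      have h3 := hdist i hi
      rw [this, hammingDist_self] at h3
      omega
    have h3 := hfd' i ⟨fd i, hlt⟩ rfl
    rw [hy] at h3
    exact h3 (hag _ (hmax i (Finset.mem_range.2 hi)))
  -- For a nonpositive ratio the distance bound is void.
  · rcases le_or_gt (ratio k) 0 with hneg | hpos
    · exact (mul_nonpos_of_nonpos_of_nonneg hneg hr).trans (by positivity)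
    · have hfar' : (optMin F s : ℝ) ≤ 2 * hammingDist (rows i) z := by exact_mod_cast hfar i hi
      have htri : (hammingDist (rows i) z : ℝ) ≤ hammingDist (rows i) y + hammingDist y z := by
        exact_mod_cast hammingDist_triangle _ _ _
      have hyd' : (k : ℝ) * hammingDist y z ≤ n := by exact_mod_cast hyd
      have hD := hclose i hi
      set D := (hammingDist (rows i) z : ℝ)
      have e : 2 * ratio k = 1 - 1 / (k * H) := by unfold ratio; ring
      -- From `H n < D` and `k * hammingDist y z ≤ n`.
      have h3 : (hammingDist y z : ℝ) ≤ 1 / (k * H) * D := by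
        rw [one_div_mul_eq_div, le_div_iff₀ (by positivity)]
        nlinarith
      calc ratio k * optMin F s ≤ ratio k * (2 * D) := by gcongr
        _ = (1 - 1 / (k * H)) * D := by rw [← e]; ring
        _ ≤ hammingDist (rows i) y := by linarith

theorem target_le (hn : 1 ≤ n) (hk : 2 ≤ k) : target k F s ≤ n + 1 := by
  refine max_le (by omega) (Nat.ceil_le.2 ?_)
  have h1 : optMin F s ≤ n := by
    refine Finset.sup_le fun S _ => ?_
    rcases Set.eq_empty_or_nonempty {d : ℕ | ∃ z ∈ S, ∃ w ∈ S, z ≠ w ∧ hammingDist z w = d}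
      with h | h
    · rw [minPD, h, Nat.sInf_empty]; omega
    · obtain ⟨a, -, b, -, -, hd⟩ := Nat.sInf_mem h
      rw [minPD, ← hd]
      simpa using hammingDist_le_card_fintype (x := a) (y := b)
  have h2 : (optMin F s : ℝ) ≤ n := by exact_mod_cast h1
  have h3 : (0 : ℝ) ≤ optMin F s := by positivity
  have := ratio_le hk
  push_cast
  nlinarith

/-- Since `target` is at least `1`, the rows are distinct and the output has exactly `s` elements.
For `s = 1` the optimum is `0` by the convention for `minPD`. -/
theorem approx_of_rows {m : Mem} (hs : 1 ≤ s)
    (h1 : ∀ i < s, Satisfies (m.row n i) F)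
    (h2 : ∀ j < s, ∀ i < j, target k F s ≤ hammingDist (m.row n i) (m.row n j)) (t : ℕ) :
    ApproxOptMin F s (ratio k) ((m.state t).output n s) := by
  have hrow : (m.state t).outAssignment n = m.row n := rfl
  unfold State.output
  rw [hrow]
  have hne : ∀ i < s, ∀ j < s, i ≠ j →
      target k F s ≤ hammingDist (m.row n i) (m.row n j) := by
    intro i hi j hj hij
    rcases lt_or_gt_of_ne hij with h | h
    · exact h2 j hj i h
    · rw [hammingDist_comm]; exact h2 i hi j h
  have hinj : Set.InjOn (m.row n) (Finset.range s) := by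
    intro i hi j hj hij
    by_contra hc
    have := hne i (by simpa using hi) j (by simpa using hj) hc
    rw [hij, hammingDist_self] at this
    have h3 : 1 ≤ target k F s := le_max_left _ _
    omega
  refine ⟨?_, ?_, ?_⟩
  · intro z hz
    obtain ⟨i, hi, rfl⟩ := Finset.mem_image.1 hz
    exact mem_solutions.2 (h1 i (Finset.mem_range.1 hi))
  · rw [Finset.card_image_of_injOn hinj, Finset.card_range]
  · have htar : ratio k * optMin F s ≤ target k F s :=
      (Nat.le_ceil _).trans (by exact_mod_cast le_max_right _ _)
    rcases (by omega : s = 1 ∨ 2 ≤ s) with rfl | hs2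
    · have : optMin F 1 = 0 := by
        refine Nat.le_zero.1 (Finset.sup_le fun S hS => ?_)
        obtain ⟨a, rfl⟩ := Finset.card_eq_one.1 (Finset.mem_powersetCard.1 hS).2
        simp [minPD]
      rw [this]; simp
    · refine htar.trans ?_
      have hne' : {d : ℕ | ∃ z ∈ (Finset.range s).image (m.row n), ∃ w ∈ (Finset.range s).image
          (m.row n), z ≠ w ∧ hammingDist z w = d}.Nonempty := by
        refine ⟨_, m.row n 0, Finset.mem_image_of_mem _ (by simp; omega), m.row n 1,
          Finset.mem_image_of_mem _ (by simp; omega), fun h => ?_, rfl⟩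
        have := hinj (by simp; omega) (by simp; omega) h
        omega
      obtain ⟨a, ha, b, hb, hab, hd⟩ := Nat.sInf_mem hne'
      unfold minPD
      rw [← hd]
      obtain ⟨i, hi, rfl⟩ := Finset.mem_image.1 ha
      obtain ⟨j, hj, rfl⟩ := Finset.mem_image.1 hb
      exact_mod_cast hne i (by simpa using hi) j (by simpa using hj) (fun h => hab (by rw [h]))

end

section
variable {n k s β : ℕ} {F : CNF n} {m : Mem}

/-! ### The whole algorithm -/

theorem pow2_wp (hm : Bd β m) (hβ : 1 ≤ β) {e : NExp} (hcw : e.cw ≤ 100) (hvw : e.vw ≤ 50) {N : ℕ}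
    (he : ∀ m' : Mem, (∀ x < 4, m'.reg x = m.reg x) → m'.arr = m.arr → m'.eval e = N)
    (hN : N < β) :
    Wp (pow2 e) (opCost β + (N * (opCost β + 2 * opCost β) + 2 * opCost β)) m
      (fun m' => m'.arr = m.arr ∧
        ∀ x, m'.reg x = if x = 5 then N else if x = 4 then 2 ^ N else m.reg x) 0 0 := by
  have h1 : 1 < 2 ^ β := Nat.one_lt_two_pow (by omega)
  have h2 : ∀ {i}, i ≤ N → i < 2 ^ β := fun h => (by omega : _ < β).trans Nat.lt_two_pow_self
  have h3 : ∀ {i}, i ≤ N → 2 ^ i < 2 ^ β := fun h => Nat.pow_lt_pow_right (by omega) (by omega)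
  refine Wp.assign_seq hm hβ (by decide) ?_
  refine Wp.mono (Wp.forN (N := N) (fun i m' => Bd β m' ∧ m'.arr = m.arr ∧
    ∀ x, m'.reg x = if x = 5 then i else if x = 4 then 2 ^ i else m.reg x) (fun _ => 0) hβ
    (hm.setReg h1) hcw hvw ?_ ?_ (le_refl 0) ?_) le_rfl (fun m' h => h.2) (fun _ _ => le_rfl) le_rfl
  · rintro i - m' ⟨g1, g2, g3⟩
    refine ⟨g1, he m' (fun x hx => ?_) g2, by simp [g3]⟩
    rw [g3, if_neg (by omega), if_neg (by omega)]
  · refine ⟨(hm.setReg h1).setReg (by simp), rfl, fun x => ?_⟩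
    simp
  · rintro i hi m' ⟨g1, g2, g3⟩
    have e4 : m'.reg 4 = 2 ^ i := by simp [g3]
    have e5 : m'.reg 5 = i := by simp [g3]
    have hd : 2 ^ i + 2 ^ i = 2 ^ (i + 1) := by rw [pow_succ]; ring
    refine Wp.assign_op g1 hβ (by decide) ?_ le_rfl
    simp only [Mem.eval_add, Mem.eval_reg, e4, hd]
    refine ⟨by simpa using e5, g1.setReg (h3 hi), (g1.setReg (h3 hi)).setReg (h2 hi), g2,
      fun x => ?_⟩
    simp only [Mem.setReg_reg]
    split_ifs with a1 a2
    · rfl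
    · rfl
    · rw [g3, if_neg a1, if_neg a2]

/-- The first `c` rows are solutions at mutual distance at least `θ`. -/
def Good {n : ℕ} (F : CNF n) (θ c : ℕ) (m : Mem) : Prop :=
  (∀ i < c, Satisfies (m.row n i) F) ∧
    ∀ j < c, ∀ i < j, θ ≤ hammingDist (m.row n i) (m.row n j)

theorem Good.succ {θ c : ℕ} {m m' : Mem} (h : Good F θ c m) (hI : RoundInv k F s β c m m')
    (hθ : 1 ≤ θ) (h7 : θ ≤ m'.reg 7) : Good F θ (c + 1) m' := by
  obtain ⟨h1, h2⟩ := hI.best (by omega)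
  refine ⟨fun i hi => ?_, fun j hj i hi => ?_⟩
  · rcases Nat.lt_succ_iff_lt_or_eq.1 hi with h' | rfl
    · rw [hI.rows i h']; exact h.1 i h'
    · exact h1
  · rcases Nat.lt_succ_iff_lt_or_eq.1 hj with h' | rfl
    · rw [hI.rows i (by omega), hI.rows j h']; exact h.2 j h' i hi
    · exact h7.trans (h2 i hi)

-- The payoff after `c` rounds is `(1 - η)^(s - c)` if all of them were good, and `0` otherwise. The
-- guess among `c + 1` rows is bounded by one among `s`, to have the same `η` in all rounds.
open Classical in
theorem rounds_wp (hk : 1 ≤ k) (hs : 1 ≤ s) (hF : IsKCNF k F) (hβ : Fits n k s β F) {θ T : ℕ}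
    (hI : Inv k F s β m) (h4 : m.reg 4 = T) (hT : 1 ≤ T) (hθ1 : 1 ≤ θ) (hθ : θ ≤ n + 1) {q : ℝ}
    (hq0 : 0 ≤ q) (hq1 : q ≤ 1)
    (hq : ∀ c < s, ∀ rows : ℕ → Fin n → Bool,
      ∃ idx ≤ c, ∃ i ≤ n, ∃ j ≤ n, Reachable k F rows c θ (rows idx) i j q) :
    Wp (forN 5 (.reg 2) round) (opCost β * (74 * (s * (T * (s * inSize k F ^ 3))))) m
      (fun _ => True) (fun m' => if Good F θ s m' then 1 else 0)
      ((1 - (1 - q / (n + 1) / (n + 1) / s) ^ T) ^ s) := by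
  have hβ1 := hβ.pos
  have hfit := hβ
  unfold Fits at hfit
  have hX : 1 ≤ inSize k F := one_le_inSize F
  have hZ : 1 ≤ T * (s * inSize k F ^ 3) := Nat.one_le_iff_ne_zero.2 (by positivity)
  have hs' : (0 : ℝ) < s := by exact_mod_cast hs
  have hdiv : ∀ x : ℝ, 1 ≤ x → q / (n + 1) / (n + 1) / x ≤ 1 := by
    intro x hx
    have h1 : (1 : ℝ) ≤ n + 1 := by simp
    have h2 : q / (n + 1) ≤ 1 := (div_le_self hq0 h1).trans hq1
    have h3 : q / (n + 1) / (n + 1) ≤ 1 := (div_le_self (by positivity) h1).trans h2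
    exact (div_le_self (by positivity) hx).trans h3
  set p := q / (n + 1) / (n + 1) / s with hp
  have hp0 : 0 ≤ p := by positivity
  have hp1 : p ≤ 1 := hdiv s (by exact_mod_cast hs)
  set η := (1 - p) ^ T with hη
  have hη1 : η ≤ 1 := pow_le_one₀ (by linarith) (by linarith)
  refine Wp.mono (Wp.forN (N := s) (t := opCost β * (70 * (T * (s * inSize k F ^ 3))))
    (fun c m' => Inv k F s β m' ∧ m'.reg 4 = T ∧ m'.reg 5 = c)
    (fun c m' => if Good F θ c m' then (1 - η) ^ (s - c) else 0) hβ1 hI.bd (by decide) (by decide)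
    (fun i _ m' h => ⟨h.1.bd, h.1.r2, h.2.2⟩) ?_ le_rfl ?_) (loop_time' hs hZ le_rfl le_rfl)
    (fun _ _ => trivial) (fun m' _ => le_of_eq (by simp)) (le_of_eq ?_)
  · exact ⟨hI.setReg (by omega) (by simp), by simpa using h4, by simp⟩
  · rintro c hc m' ⟨g1, g2, g3⟩
    have hc' : (c : ℝ) + 1 ≤ s := by exact_mod_cast hc
    have W := round_wp hk hF hβ g1 g2 g3 hT hc hθ hq0 (hdiv _ (by simp))
      (fun m'' _ => hq c hc (m''.row n))
    have hR : ∀ m'', RoundInv k F s β c m' m'' → m''.reg 5 = c ∧ Bd β m'' ∧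
        Inv k F s β (m''.setReg 5 (c + 1)) ∧ (m''.setReg 5 (c + 1)).reg 4 = T ∧
        (m''.setReg 5 (c + 1)).reg 5 = c + 1 := fun m'' h =>
      ⟨h.r5, h.inv.bd, h.inv.setReg (by omega) (by omega), by simp [h.r4, g2], by simp⟩
    have hb : 0 ≤ (1 - η) ^ (s - (c + 1)) := pow_nonneg (by linarith) _
    have hgood : ∀ m'' : Mem, Good F θ (c + 1) (m''.setReg 5 (c + 1)) ↔ Good F θ (c + 1) m'' :=
      fun _ => Iff.rfl
    by_cases hG : Good F θ c m'
    · have hle : (1 - q / (n + 1) / (n + 1) / (c + 1)) ^ T ≤ η := by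
        have h1 := hdiv (c + 1) (by simp)
        have h2 : p ≤ q / (n + 1) / (n + 1) / (c + 1) := by
          rw [hp]; gcongr
        exact pow_le_pow_left₀ (by linarith) (by linarith) _
      refine Wp.mono (Wp.affine (a := 0) (b := (1 - η) ^ (s - (c + 1))) W le_rfl hb ?_ ?_) le_rfl
        hR ?_ ?_
      · intro m''; split_ifs <;> norm_num
      · linarith
      · intro m'' hm''
        rw [hgood, zero_add]
        split_ifs with a1 a2 a2
        · rw [mul_one]
        · exact absurd (hG.succ hm'' hθ1 a1) a2
        · rw [mul_zero]; exact hb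
        · rw [mul_zero]
      · rw [if_pos hG, show s - c = s - (c + 1) + 1 by omega, pow_succ, zero_add]
        gcongr
    · refine Wp.mono (Wp.of_spec (g := fun m'' => if Good F θ (c + 1) m'' then
        (1 - η) ^ (s - (c + 1)) else 0) (v := 0) W ?_) le_rfl hR (fun _ _ => le_rfl) (by simp [hG])
      intro m'' _
      split_ifs
      · exact hb
      · exact le_rfl
  · simp [Good]

/-- The number of trials in every round. -/
def numTrials (n k s : ℕ) : ℕ :=
  2 * (k + 1) * (s * ((n + 1) * ((n + 1) * (n + 1)))) * 2 ^ (n - n / k)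

theorem numTrials_le (F : CNF n) :
    numTrials n k s ≤ 2 * inSize k F * (s * (inSize k F * (inSize k F * inSize k F))) *
      2 ^ (n - n / k) := by
  unfold numTrials
  have h1 : k + 1 ≤ inSize k F := by unfold inSize; omega
  have h2 : n + 1 ≤ inSize k F := by unfold inSize; omega
  gcongr

theorem numTrials_lt (F : CNF n) (hs : s ≤ 2 ^ n) : numTrials n k s < 2 ^ (10 * inSize k F) := by
  have h1 : ∀ a, a + 1 ≤ 2 ^ a := fun a => Nat.lt_two_pow_self
  calc numTrials n k s ≤ 2 * 2 ^ k * (2 ^ n * (2 ^ n * (2 ^ n * 2 ^ n))) * 2 ^ n := by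
        unfold numTrials
        have := h1 k
        have := h1 n
        have : 2 ^ (n - n / k) ≤ 2 ^ n := Nat.pow_le_pow_right (by norm_num) (Nat.sub_le _ _)
        gcongr
    _ = 2 ^ (1 + k + 5 * n) := by ring
    _ < 2 ^ (10 * inSize k F) := Nat.pow_lt_pow_right (by norm_num) (by unfold inSize; omega)

theorem fits (F : CNF n) (hs : s ≤ 2 ^ n) : Fits n k s (10 * inSize k F) F := by
  unfold Fits
  have h1 : ∀ a, a < 2 ^ a := fun a => Nat.lt_two_pow_self
  have h2 : 2 ^ n ≤ 2 ^ inSize k F := Nat.pow_le_pow_right (by norm_num) (vars_le_inSize F)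
  have h3 := h1 (inSize k F)
  have h4 : 2 ^ inSize k F * 2 ^ 5 ≤ 2 ^ (10 * inSize k F) := by
    rw [← pow_add]
    exact Nat.pow_le_pow_right (by norm_num) (by have := one_le_inSize (k := k) F; omega)
  have h5 : 2 * n + F.length + k + 10 ≤ 12 * inSize k F := by unfold inSize; omega
  omega

/-- The dominant term is a product: `X` for the cost of an instruction, `s` rounds, about `X^4 s
2^(n - n/k)` trials in each, and `s X^3` instructions per trial. -/
theorem algorithm_time (F : CNF n) (hs : 1 ≤ s) :
    let X := inSize k F
    opCost (10 * X + s) * (1 * X) + (opCost (10 * X + s) * (6 * X) + (opCost (10 * X + s) +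
      (opCost (10 * X) * (6 * X) + (opCost (10 * X) +
        opCost (10 * X) * (74 * (s * (numTrials n k s * (s * X ^ 3)))))))) ≤
      400000 * X ^ 8 * (s ^ 3 * 2 ^ (n - n / k)) := by
  intro X
  have hX : 1 ≤ X := one_le_inSize F
  have hTle : numTrials n k s ≤ 2 * X * (s * (X * (X * X))) * 2 ^ (n - n / k) := numTrials_le F
  have hP1 : 1 ≤ 2 ^ (n - n / k) := Nat.one_le_two_pow
  generalize 2 ^ (n - n / k) = P at *
  generalize numTrials n k s = T at *
  clear_value X
  have e1 : opCost (10 * X + s) ≤ 4000 * (X * s) := by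
    unfold opCost
    have : X ≤ X * s := Nat.le_mul_of_pos_right _ hs
    have : s ≤ X * s := Nat.le_mul_of_pos_left _ hX
    omega
  have e2 : opCost (10 * X) = 2000 * X := by unfold opCost; omega
  have e3 : ∀ {a b : ℕ}, 1 ≤ a → a ≤ 8 → b ≤ 3 → X ^ a * s ^ b ≤ X ^ 8 * (s ^ 3 * P) := by
    intro a b _ ha hb
    calc X ^ a * s ^ b ≤ X ^ 8 * s ^ 3 := by
          gcongr
      _ ≤ X ^ 8 * (s ^ 3 * P) := by gcongr; exact Nat.le_mul_of_pos_right _ hP1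
  set Z := X ^ 8 * (s ^ 3 * P) with hZ
  have f1 : X * (X * s) ≤ Z := by
    have := e3 (a := 2) (b := 1) (by omega) (by omega) (by omega)
    calc X * (X * s) = X ^ 2 * s ^ 1 := by ring
      _ ≤ Z := this
  have f2 : X * s ≤ Z := by
    have := e3 (a := 1) (b := 1) (by omega) (by omega) (by omega)
    simpa using this
  have f3 : X * X ≤ Z := by
    have := e3 (a := 2) (b := 0) (by omega) (by omega) (by omega)
    calc X * X = X ^ 2 * s ^ 0 := by ring
      _ ≤ Z := this
  have f4 : X ≤ Z := by
    have := e3 (a := 1) (b := 0) (by omega) (by omega) (by omega)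
    simpa using this
  have f5 : X * (s * (T * (s * X ^ 3))) ≤ 2 * Z := by
    calc X * (s * (T * (s * X ^ 3))) ≤
        X * (s * (2 * X * (s * (X * (X * X))) * P * (s * X ^ 3))) := by gcongr
      _ = 2 * Z := by rw [hZ]; ring
  calc _ ≤ 4000 * (X * s) * (1 * X) + (4000 * (X * s) * (6 * X) + (4000 * (X * s) +
      (2000 * X * (6 * X) + (2000 * X + 2000 * X * (74 * (s * (T * (s * X ^ 3)))))))) := by
        rw [e2]; gcongr
    _ = 28000 * (X * (X * s)) + 4000 * (X * s) + 12000 * (X * X) + 2000 * X +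
        148000 * (X * (s * (T * (s * X ^ 3)))) := by ring
    _ ≤ 28000 * Z + 4000 * Z + 12000 * Z + 2000 * Z + 148000 * (2 * Z) := by gcongr
    _ ≤ 400000 * Z := by omega
    _ = 400000 * X ^ 8 * (s ^ 3 * P) := by rw [hZ]; ring

/-- The initial memory. -/
def initMem {n : ℕ} (k : ℕ) (F : CNF n) (s : ℕ) : Mem := (input k F s).mem

theorem initMem_reg (x : ℕ) : (initMem k F s).reg x =
    if x = 0 then n else if x = 1 then F.length else if x = 2 then s else 0 := rfl

theorem initMem_arr (a p : ℕ) : (initMem k F s).arr a p =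
    if a = 0 then litCode (F[p / k]?.bind fun C => C[p % k]?) else 0 := rfl

-- Keeping `q` and `v` general allows `q = v = 0`, which yields the time bound alone for formulas
-- without enough solutions.
open Classical in
theorem algorithm_wp (hk : 1 ≤ k) (hs : 1 ≤ s) (hF : IsKCNF k F) {θ : ℕ} (hθ1 : 1 ≤ θ)
    (hθ : θ ≤ n + 1) {q v : ℝ} (hq0 : 0 ≤ q) (hq1 : q ≤ 1)
    (hq : ∀ c < s, ∀ rows : ℕ → Fin n → Bool,
      ∃ idx ≤ c, ∃ i ≤ n, ∃ j ≤ n, Reachable k F rows c θ (rows idx) i j q)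
    (hv : 2 ^ n < s → v ≤ 0)
    (hv' : v ≤ (1 - (1 - q / (n + 1) / (n + 1) / s) ^ numTrials n k s) ^ s) :
    Wp (algorithm k) (400000 * inSize k F ^ 8 * (s ^ 3 * 2 ^ (n - n / k))) (initMem k F s)
      (fun _ => True) (fun m' => if Good F θ s m' then 1 else 0) v := by
  set X := inSize k F with hXdef
  have hX : 1 ≤ X := one_le_inSize F
  have hnX : n ≤ X := vars_le_inSize F
  -- Before the comparison of `s` with `2 ^ n` the bit length of `s` is bounded only by `s` itself;
  -- afterwards `β` bits suffice. The few early instructions can afford the factor `s`.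
  set β' := 10 * X + s with hβ'
  set β := 10 * X with hβ
  have hβ1 : 1 ≤ β := by omega
  have hβ1' : 1 ≤ β' := by omega
  set T := numTrials n k s with hT
  have hT1 : 1 ≤ T := Nat.one_le_iff_ne_zero.2 (by rw [hT, numTrials]; positivity)
  set P := 2 ^ (n - n / k) with hP
  have hP1 : 1 ≤ P := Nat.one_le_two_pow
  have hlt : ∀ {a b : ℕ}, a ≤ b → a < 2 ^ b := fun h => h.trans_lt Nat.lt_two_pow_self
  have hL : F.length ≤ X := length_le_inSize F
  have hnkX : n - n / k ≤ X := (Nat.sub_le _ _).trans hnX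
  have hkX : k + 1 ≤ X := by rw [hXdef]; unfold inSize; omega
  have harr : ∀ {b : ℕ}, 2 * X ≤ b → ∀ a p, (initMem k F s).arr a p < 2 ^ b := by
    intro b hb a p
    rw [initMem_arr]
    split_ifs
    · exact hlt ((litCode_le _).trans (by omega))
    · positivity
  have hbd : Bd β' (initMem k F s) := by
    refine ⟨fun x => ?_, harr (by omega)⟩
    rw [initMem_reg]
    split_ifs <;> exact hlt (by omega)
  set m₁ := (initMem k F s).setReg 3 k with hm₁
  have hbd₁ : Bd β' m₁ := hbd.setReg (hlt (by omega))
  -- time bookkeeping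
  have hpow2 : ∀ {U N : ℕ}, N ≤ X → U + (N * (U + 2 * U) + 2 * U) ≤ U * (6 * X) := by
    intro U N hN
    exact (add_time' (op_time' U hX) ((loop_time' (t := U) (U := U) (a := 1) (Z := 1) hX le_rfl hN
      (by omega)).trans (by rw [mul_one]))).trans (le_of_eq (by ring))
  have hU1 : 1 ≤ opCost (10 * inSize k F) := by unfold opCost; omega
  refine Wp.time_le ?_ (algorithm_time F hs)
  refine Wp.spec_seq (R := fun m' => m' = m₁) (g₀ := 0) (v₀ := 0)
    (Wp.assign ?_ rfl le_rfl) ?_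
  -- The constant `k` is arbitrary, so this instruction is not covered by `opCost` alone.
  · have h1 := (initMem k F s).cost_le hbd hβ1' (.const k)
    simp only [NExp.cw] at h1
    have h2 : β' * (k + 1) ≤ β' * X := Nat.mul_le_mul_left _ hkX
    have h3 : 1 ≤ β' * X := Nat.one_le_iff_ne_zero.2 (by positivity)
    change _ ≤ β' * 200 * (1 * X)
    rw [one_mul, mul_assoc, mul_comm 200, ← mul_assoc]
    omega
  rintro _ rfl
  have m₁r : ∀ x, m₁.reg x = if x = 3 then k else if x = 0 then n else if x = 1 then F.length
      else if x = 2 then s else 0 := by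
    intro x
    rw [hm₁, Mem.setReg_reg, initMem_reg]
  refine Wp.spec_seq (Wp.time_le (pow2_wp (N := n) hbd₁ hβ1' (by decide) (by decide)
    (fun m' h _ => by rw [Mem.eval_reg, h 0 (by omega), m₁r]; rfl) (by omega)) (hpow2 hnX)) ?_
  rintro m₂ ⟨ha, hr⟩
  have m₂r : ∀ x < 4, m₂.reg x = m₁.reg x := fun x hx => by
    rw [hr, if_neg (by omega), if_neg (by omega)]
  have hbd₂ : ∀ {b : ℕ}, 2 * X ≤ b → (s ≤ 2 ^ n ∨ s ≤ b) → Bd b m₂ := by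
    intro b hb hsb
    have h2n : 2 ^ n < 2 ^ b := Nat.pow_lt_pow_right (by norm_num) (by omega)
    have hsb' : s < 2 ^ b := by
      rcases hsb with h | h
      · omega
      · exact hlt h
    refine ⟨fun x => ?_, ha ▸ harr hb⟩
    rw [hr, m₁r]
    split_ifs
    · exact hlt (by omega)
    · exact h2n
    · exact hlt (by omega)
    · exact hlt (by omega)
    · exact hlt (by omega)
    · exact hsb'
    · positivity
  refine Wp.ite (m₂.cost_lt (hbd₂ (b := β') (by omega) (Or.inr (by omega))) hβ1' _ (by decide))
    (fun hne => ?_) (fun he => ?_)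
  · simp only [Mem.eval_sub, Mem.eval_reg, hr, m₁r] at hne
    norm_num only [if_true, if_false] at hne
    refine Wp.skip (by omega) trivial ((hv (by omega)).trans ?_)
    split_ifs <;> norm_num
  · simp only [Mem.eval_sub, Mem.eval_reg, hr, m₁r] at he
    norm_num only [if_true, if_false] at he
    have hs2 : s ≤ 2 ^ n := by omega
    have hbd₂' := hbd₂ (b := β) (by omega) (Or.inl hs2)
    refine Wp.spec_seq (Wp.time_le (pow2_wp (N := n - n / k) hbd₂' hβ1 (by decide) (by decide)
      (fun m' h _ => by simp only [Mem.eval_sub, Mem.eval_div, Mem.eval_reg, h 0 (by omega),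
        h 3 (by omega), m₂r 0 (by omega), m₂r 3 (by omega), m₁r]; rfl) (by omega))
        (hpow2 hnkX)) ?_
    rintro m₃ ⟨ha', hr'⟩
    have m₃r : ∀ x < 4, m₃.reg x = m₁.reg x := fun x hx => by
      rw [hr', if_neg (by omega), if_neg (by omega), m₂r x hx]
    have hbd₃ : Bd β m₃ := by
      refine ⟨fun x => ?_, ha' ▸ hbd₂'.2⟩
      rw [hr']
      split_ifs
      · exact hlt (by omega)
      · exact Nat.pow_lt_pow_right (by norm_num) (by omega)
      · exact hbd₂'.1 x
    have harr₃ : m₃.arr = (initMem k F s).arr := ha'.trans ha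
    have hI₃ : Inv k F s β m₃ := by
      refine ⟨?_, ?_, ?_, ?_, fun p => ?_, fun p => ?_, fun p => ?_, hbd₃⟩
      · rw [m₃r 0 (by omega), m₁r]; rfl
      · rw [m₃r 1 (by omega), m₁r]; rfl
      · rw [m₃r 2 (by omega), m₁r]; rfl
      · rw [m₃r 3 (by omega), m₁r]; rfl
      · rw [harr₃, initMem_arr]; rfl
      · rw [harr₃, initMem_arr]; simp
      · rw [harr₃, initMem_arr]; simp
    have e4 : m₃.reg 4 = P := by rw [hr']; rfl
    refine Wp.assign_seq hbd₃ hβ1 (by decide) ?_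
    have hev : m₃.eval (.mul (.mul (.mul (.const 2) (.add (.reg 3) (.const 1)))
        (.mul (.reg 2) (.mul (.add (.reg 0) (.const 1)) (.mul (.add (.reg 0) (.const 1))
        (.add (.reg 0) (.const 1)))))) (.reg 4)) = T := by
      simp only [Mem.eval_mul, Mem.eval_add, Mem.eval_reg, Mem.eval_const, e4, hI₃.r0, hI₃.r2,
        hI₃.r3]
      rfl
    rw [hev]
    exact Wp.mono (rounds_wp hk hs hF (fits F hs2)
      (hI₃.setReg (by omega) (numTrials_lt F hs2)) (by simp [hT]) hT1 hθ1 hθ hq0 hq1 hq) le_rfl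
      (fun _ => id) (fun _ _ => le_rfl) hv'

/-! ### The success probability -/

theorem succProb_nonneg : 0 ≤ succProb n k := by unfold succProb; positivity

theorem succProb_le_one (hk : 1 ≤ k) : succProb n k ≤ 1 := by
  have hk' : (1 : ℝ) ≤ k := by exact_mod_cast hk
  have h1 : (n : ℝ) / k ≤ n := div_le_self (by positivity) hk'
  unfold succProb
  rw [div_le_one (by linarith)]
  calc (2 : ℝ) ^ ((n : ℝ) / k - n) ≤ 1 :=
        Real.rpow_le_one_of_one_le_of_nonpos (by norm_num) (by linarith)
    _ ≤ k + 1 := by linarith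

/-- In `numTrials` the factors `s` and `(n + 1)^2` pay for guessing the parameters, and `(k + 1)
2^(n - n/k)` pays for `succProb`. The remaining `2 (n + 1)` is a lower bound for the expected number
of successes. -/
theorem failure_le (hk : 1 ≤ k) (hs : 1 ≤ s) :
    (1 - succProb n k / (n + 1) / (n + 1) / s) ^ numTrials n k s ≤ Real.exp (-(2 * n)) := by
  have hk' : (0 : ℝ) < k := by exact_mod_cast hk
  have hs' : (0 : ℝ) < s := by exact_mod_cast hs
  set p := succProb n k / (n + 1) / (n + 1) / s with hp
  have hp1 : p ≤ 1 := by
    have h1 : (1 : ℝ) ≤ n + 1 := by simp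
    have hs1 : (1 : ℝ) ≤ s := by exact_mod_cast hs
    have h0 := succProb_nonneg (n := n) (k := k)
    have h2 : succProb n k / (n + 1) ≤ 1 := (div_le_self h0 h1).trans (succProb_le_one hk)
    have h3 : succProb n k / (n + 1) / (n + 1) ≤ 1 := (div_le_self (by positivity) h1).trans h2
    exact (div_le_self (by positivity) hs1).trans h3
  have key : 2 * (n : ℝ) ≤ numTrials n k s * p := by
    have h2 : (1 : ℝ) ≤ 2 ^ (n - n / k) * (2 : ℝ) ^ ((n : ℝ) / k - n) := by
      rw [← Real.rpow_natCast, ← Real.rpow_add (by norm_num), Nat.cast_sub (Nat.div_le_self _ _)]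
      refine Real.one_le_rpow (by norm_num) ?_
      have : ((n / k : ℕ) : ℝ) ≤ n / k := Nat.cast_div_le
      linarith
    have e : (numTrials n k s : ℝ) * p =
        2 * (n + 1) * (2 ^ (n - n / k) * (2 : ℝ) ^ ((n : ℝ) / k - n)) := by
      rw [hp, succProb, numTrials]
      push_cast
      field_simp
    rw [e]
    have h3 : (0 : ℝ) ≤ n := by positivity
    nlinarith
  calc (1 - p) ^ numTrials n k s ≤ Real.exp (-p) ^ numTrials n k s :=
        pow_le_pow_left₀ (by linarith) (Real.one_sub_le_exp_neg p) _
    _ = Real.exp (-(numTrials n k s * p)) := by rw [← Real.exp_nat_mul]; ring_nf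
    _ ≤ Real.exp (-(2 * n)) := by gcongr

/-- A union bound in the form of Bernoulli's inequality, over at most `2^n ≤ e^n` rounds. -/
theorem success_ge (hk : 1 ≤ k) (hs : 1 ≤ s) (hs' : s ≤ 2 ^ n) :
    1 - Real.exp (-n) ≤
      (1 - (1 - succProb n k / (n + 1) / (n + 1) / s) ^ numTrials n k s) ^ s := by
  have hη := failure_le (n := n) hk hs
  set η := (1 - succProb n k / (n + 1) / (n + 1) / s) ^ numTrials n k s
  have hη1 : η ≤ 1 := hη.trans (Real.exp_le_one_iff.2 (by simp))
  have h1 := one_add_mul_le_pow (a := -η) (by linarith) s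
  have h2 : (s : ℝ) ≤ Real.exp n := by
    calc (s : ℝ) ≤ 2 ^ n := by exact_mod_cast hs'
      _ ≤ Real.exp 1 ^ n := by
        gcongr
        linarith [Real.add_one_le_exp (1 : ℝ)]
      _ = Real.exp n := by rw [← Real.exp_nat_mul, mul_one]
  have h3 : s * η ≤ Real.exp (-n) := by
    calc s * η ≤ s * Real.exp (-(2 * n)) := by gcongr
      _ ≤ Real.exp n * Real.exp (-(2 * n)) := by gcongr
      _ = Real.exp (-n) := by rw [← Real.exp_add]; ring_nf
  calc 1 - Real.exp (-n) ≤ 1 + s * -η := by linarith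
    _ ≤ (1 + -η) ^ s := h1
    _ = (1 - η) ^ s := by ring

/-- The program computes with `⌊n/k⌋`; rounding costs at most a factor `2`. -/
theorem time_bound (hk : 1 ≤ k) (F : CNF n) {t : ℕ}
    (ht : t ≤ 400000 * inSize k F ^ 8 * (s ^ 3 * 2 ^ (n - n / k))) :
    (t : ℝ) ≤ ((800000 * (k + 1) ^ 8 : ℕ) : ℝ) * ((n : ℝ) + (F.length : ℝ) + 1) ^ 8 *
      ((s : ℝ) ^ 3 * (2 : ℝ) ^ ((n : ℝ) - (n : ℝ) / (k : ℝ))) := by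
  have hk' : (0 : ℝ) < k := by exact_mod_cast hk
  have h1 : (t : ℝ) ≤ 400000 * (inSize k F : ℝ) ^ 8 * ((s : ℝ) ^ 3 * 2 ^ (n - n / k)) := by
    exact_mod_cast ht
  have h2 : (inSize k F : ℝ) ≤ (k + 1) * ((n : ℝ) + F.length + 1) := by
    have : inSize k F ≤ (k + 1) * (n + F.length + 1) := by
      unfold inSize
      nlinarith [Nat.zero_le (k * (n + F.length))]
    exact_mod_cast this
  have h3 : (2 : ℝ) ^ (n - n / k) ≤ 2 * (2 : ℝ) ^ ((n : ℝ) - n / k) := by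
    have h4 : (n : ℝ) / k ≤ (n / k : ℕ) + 1 := by
      have h5 : n < k * (n / k + 1) := by
        have := Nat.div_add_mod n k
        have := Nat.mod_lt n hk
        rw [mul_add]; omega
      rw [div_le_iff₀ hk']
      have : (n : ℝ) < k * ((n / k : ℕ) + 1) := by exact_mod_cast h5
      linarith
    calc (2 : ℝ) ^ (n - n / k) = (2 : ℝ) ^ ((n : ℝ) - (n / k : ℕ)) := by
          rw [← Real.rpow_natCast, Nat.cast_sub (Nat.div_le_self _ _)]
      _ ≤ (2 : ℝ) ^ (1 + ((n : ℝ) - n / k)) :=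
          Real.rpow_le_rpow_of_exponent_le (by norm_num) (by linarith)
      _ = 2 * (2 : ℝ) ^ ((n : ℝ) - n / k) := by
          rw [Real.rpow_add (by norm_num), Real.rpow_one]
  calc (t : ℝ) ≤ _ := h1
    _ ≤ 400000 * ((k + 1) * ((n : ℝ) + F.length + 1)) ^ 8 *
        ((s : ℝ) ^ 3 * (2 * (2 : ℝ) ^ ((n : ℝ) - n / k))) := by gcongr
    _ = _ := by push_cast; ring

theorem card_solutions_le (F : CNF n) : (solutions F).card ≤ 2 ^ n := by
  have := Finset.card_le_univ (solutions F)
  simpa using this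

end

open Classical in
/-- Turn the expectation of an indicator into a probability. -/
theorem le_toOuterMeasure {μ : PMF State} {v : ℝ} {G : Mem → Prop} {S : Set State}
    (h : ENNReal.ofReal v ≤ expect μ fun τ => ENNReal.ofReal (if G τ.mem then 1 else 0))
    (hG : ∀ τ : State, G τ.mem → τ ∈ S) : v ≤ (μ.toOuterMeasure S).toReal := by
  have hle : μ.toOuterMeasure S ≤ 1 := by
    rw [← (PMF.toOuterMeasure_apply_eq_one_iff (p := μ) (s := Set.univ)).2 (Set.subset_univ _)]
    exact μ.toOuterMeasure.mono (Set.subset_univ _)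
  refine (ENNReal.ofReal_le_iff_le_toReal (ne_top_of_le_ne_top ENNReal.one_ne_top hle)).1
    (h.trans ?_)
  rw [PMF.toOuterMeasure_apply]
  refine ENNReal.tsum_le_tsum fun τ => ?_
  by_cases hτ : G τ.mem
  · simp [hτ, hG τ hτ]
  · simp [hτ]

end Dispersion

/-- For each fixed `k ≥ 3` there is one randomized program that, for all `n`, all `k`-CNF formulas
`F` on `n` variables and all `s ≥ 1`, always halts within time `s³ · 2^(n - n/k)` up to a polynomial
factor in the input size, and that with probability `1 - o(1)` (as `n → ∞`, uniformly in `F`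
and `s`) outputs `s` distinct solutions that approximate the optimal dispersion, provided that
`F` has at least `s` solutions. -/
theorem mainTheorem7 (k : ℕ) (hk : 3 ≤ k) :
    ∃ (A : Dispersion.Prog) (C c : ℕ) (ε : ℕ → ℝ), Tendsto ε atTop (𝓝 0) ∧
      ∀ (n : ℕ) (F : Dispersion.CNF n) (s : ℕ), Dispersion.IsKCNF k F → 1 ≤ s →
        ∃ μ : PMF Dispersion.State, Dispersion.Exec A (Dispersion.input k F s) μ ∧
          (∀ σ ∈ μ.support, (σ.time : ℝ) ≤
            (C : ℝ) * ((n : ℝ) + (F.length : ℝ) + 1) ^ c *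
              ((s : ℝ) ^ 3 * (2 : ℝ) ^ ((n : ℝ) - (n : ℝ) / (k : ℝ)))) ∧
          (s ≤ (Dispersion.solutions F).card →
            1 - ε n ≤ (μ.toOuterMeasure {σ | Dispersion.ApproxOptMin F s
              (1 / 2 * (1 - 1 / ((k : ℝ) * Dispersion.binHInv (1 - 1 / (k : ℝ)))))
              (σ.output n s)}).toReal) := by
  classical
  open Dispersion in
  refine ⟨algorithm k, 800000 * (k + 1) ^ 8, 8, fun n => Real.exp (-n), ?_, ?_⟩
  · exact Real.tendsto_exp_neg_atTop_nhds_zero.comp tendsto_natCast_atTop_atTop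
  intro n F s hF hs
  have hstart : input k F s = (initMem k F s).state 0 := rfl
  by_cases h : 1 ≤ n ∧ s ≤ (solutions F).card
  · have hs2 := h.2.trans (card_solutions_le F)
    obtain ⟨μ, h1, h2, h3⟩ := algorithm_wp (F := F) (s := s) (θ := target k F s)
      (q := succProb n k) (v := 1 - Real.exp (-n)) (by omega) hs hF (le_max_left _ _)
      (target_le h.1 (by omega)) succProb_nonneg (succProb_le_one (by omega))
      (fun c hc rows => exists_reachable h.1 (by omega) h.2 hc rows) (fun h' => by omega)
      (success_ge (by omega) hs hs2) 0
    refine ⟨μ, h1, fun σ hσ => time_bound (by omega) F ?_, fun _ => le_toOuterMeasure h3 ?_⟩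
    · simpa using (h2 σ hσ).1
    · intro τ hτ
      exact approx_of_rows (m := τ.mem) hs hτ.1 hτ.2 τ.time
  · obtain ⟨μ, h1, h2, -⟩ := algorithm_wp (F := F) (s := s) (θ := 1) (q := 0) (v := 0)
      (by omega) hs hF le_rfl (by omega) le_rfl zero_le_one
      (fun c _ rows => ⟨0, by omega, 0, by omega, 0, by omega, Reachable.trivial _ _ _ _ _ _ _ _⟩)
      (fun _ => le_rfl) (by simp) 0
    refine ⟨μ, h1, fun σ hσ => time_bound (by omega) F ?_, fun hc => ?_⟩
    · simpa using (h2 σ hσ).1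
    -- For `n = 0` the error term is `e^0 = 1`, so nothing is claimed.
    · have hn : n = 0 := by
        by_contra hn
        exact h ⟨by omega, hc⟩
      subst hn
      simp
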